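/- Let $R_o$ be an irreducible simply-laced finite root system of rank $\ell$ with a base and highest root $\theta$. Let $Q^\vee=Q_o^\vee\oplus\mathbb Z\mathbf c$ be the coroot lattice of its untwisted affinization, where $\mathbf c$ is the minimal imaginary coroot. The simple affine coroots are the simple coroots $a_1^\vee,\dots,a_\ell^\vee$ of $R_o$ and $a_{\ell+1}^\vee=\mathbf c-\theta^\vee$; let $\Pi=\{a_1,\dots,a_{\ell+1}\}$ be the set of simple affine roots, and $W$ the affine Weyl group, generated by the simple reflections $w_a$, $a\in\Pi$. The coroots are the real ones $\alpha^\vee+n\mathbf c$ ($\alpha\in R_o$, $n\in\mathbb Z$), of multiplicity $m=1$, and the imaginary ones $n\mathbf c$ ($n\ne0$), of multiplicity $m=\ell$; let $R_+^\vee$ be the set of positive ones, i.e. those in $Q^\vee_+=\sum_i\mathbb Z_{\ge0}a_i^\vee$. Let $v$ be a formal variable, $\mathcal Q_v=\mathbb C[[v^{-1}]][[Q^\vee_-]]$ and $\mathcal Q_v^{fin}=\mathbb C[v^{-1}][[Q_-^\vee]]$ the rings of formal power series in the $e^{-a_i^\vee}$, and let $\mathcal Q^{fin}_v[W]^\vee$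 be the space of formal, possibly infinite, sums $\sum_{w\in W}f_w[w]$ with $f_w\in\mathcal Q^{fin}_v$. Let $R$ be the field of rational functions in the $e^x$, $x\in Q^\vee$, over $\mathbb C[v^{-1}]$, with its $W$-action $f\mapsto f^w$, and $R[W]$ the group algebra with $[w]f=f^w[w]$. For $a\in\Pi$ put $$T_a=\frac{1-v^{-1}e^{-a^\vee}}{1-e^{a^\vee}}[w_a]+\frac{v^{-1}-1}{1-e^{a^\vee}}[1]\in R[W],$$ and $T_w=T_{b_1}\cdots T_{b_r}$ for a reduced decomposition $w=w_{b_1}\cdots w_{b_r}$ with $b_1,\dots,b_r\in\Pi$. Rational functions are expanded in negative powers of the coroots. Put $$\mathfrak D=\prod_{\beta\in R_+^\vee}(1-e^{-\beta})^{m(\beta)},\qquad \mathfrak D_v=\prod_{\beta\in R_+^\vee}(1-v^{-1}e^{-\beta})^{m(\beta)},\qquad \Big(\frac1{\mathfrak D}\Big)^w=\prod_{\beta\in R_+^\vee}(1-e^{-w\beta})^{-m(\beta)},$$ so that $[w]\frac1{\mathfrak D}=\big(\frac1{\mathfrak D}\big)^w[w]$. Then $T_w$ does not depend on the reduced decomposition,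 and $T_w=\sum_u C_u(w)[u]$ with all $C_u(w)$ expanding in $\mathcal Q_v^{fin}$; the infinite products $\mathfrak D_v$ and $(1/\mathfrak D)^w$ converge in $\mathcal Q_v^{fin}$. For every $u\in W$ the sum $C_u=\sum_{w\in W}C_u(w)$ is well defined in $\mathcal Q_v$ (each monomial $v^{-d}e^{-\beta}$ occurs in only finitely many $C_u(w)$) and lies in $\mathcal Q_v^{fin}$. Moreover there is a $W$-invariant element $\mathfrak c(v)\in\mathbb C[v^{-1}][[e^{-\mathbf c}]]$ such that, in $\mathcal Q_v^{fin}[W]^\vee$, $$\mathcal P:=\sum_{w\in W}T_w=\sum_{u\in W}C_u[u]=\mathfrak c(v)\,\mathfrak D_v\sum_{w\in W}[w]\frac1{\mathfrak D}.$$ -/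

import Mathlib

open Polynomial

noncomputable section

namespace AffineCS

/-! ### Laurent polynomials, rational functions and their expansions

`I` indexes the simple affine coroots, `I →₀ ℤ` is the affine coroot lattice in the basis of the
simple affine coroots, and the polynomial variable `X : ℂ[X]` is the formal variable `v⁻¹`. -/

section Rings

variable (I : Type*)

/-- The group algebra `ℂ[v⁻¹][Q^∨]` of the coroot lattice. -/
abbrev Laurent : Type _ := AddMonoidAlgebra ℂ[X] (I →₀ ℤ)

/-- Rational functions in the `e^x`, `x ∈ Q^∨`, with coefficients in `ℂ[v⁻¹]`. -/
abbrev RatFun : Type _ := FractionRing (Laurent I)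

/-- The completion `ℂ[v⁻¹][[Q^∨_-]]`: the variable attached to `i : I` is `e^{-a_i^∨}`, so that the
monomial with exponent `n : I →₀ ℕ` is `e^{-n}`. -/
abbrev Qfin : Type _ := MvPowerSeries I ℂ[X]

/-- The completion `ℂ[[v⁻¹]][[Q^∨_-]]`. -/
abbrev Qv : Type _ := MvPowerSeries I (PowerSeries ℂ)

variable {I}

/-- The inclusion `ℂ[v⁻¹][[Q^∨_-]] ⊆ ℂ[[v⁻¹]][[Q^∨_-]]`. -/
def toQv : Qfin I →+* Qv I := MvPowerSeries.map Polynomial.coeToPowerSeries.ringHom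

/-- The inclusion `Q^∨_+ ⊆ Q^∨`. -/
def toLattice (n : I →₀ ℕ) : I →₀ ℤ := n.mapRange Nat.cast Nat.cast_zero

/-- The exponential `e^x` as a rational function. -/
def rexp (x : I →₀ ℤ) : RatFun I := algebraMap (Laurent I) (RatFun I) (AddMonoidAlgebra.single x 1)

/-- `v⁻¹` as a rational function. -/
def vinv : RatFun I := algebraMap (Laurent I) (RatFun I) (AddMonoidAlgebra.single 0 X)

instance instIsDomainQfin : IsDomain (Qfin I) := NoZeroDivisors.to_isDomain _

/-- The variable `e^{-a_i^∨}` in the fraction field of `ℂ[v⁻¹][[Q^∨_-]]`. -/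
def var (i : I) : FractionRing (Qfin I) :=
  algebraMap (Qfin I) (FractionRing (Qfin I)) (MvPowerSeries.X i)

lemma var_ne_zero (i : I) : var i ≠ 0 := by
  intro h
  have h2 : (MvPowerSeries.X i : Qfin I) = 0 :=
    IsFractionRing.injective (Qfin I) (FractionRing (Qfin I)) (by simpa [var] using h)
  have := congrArg (MvPowerSeries.coeff (Finsupp.single i 1)) h2
  simp at this

/-- The element `e^x = ∏ i, (e^{-a_i^∨}) ^ (-x_i)` in the fraction field of the completion. -/
def expo : Multiplicative (I →₀ ℤ) →* FractionRing (Qfin I) where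
  toFun x := (Multiplicative.toAdd x).prod fun i k => var i ^ (-k)
  map_one' := by simp
  map_mul' x y := by
    rw [toAdd_mul, Finsupp.prod_add_index']
    · simp
    · intro i a c
      rw [neg_add, zpow_add₀ (var_ne_zero i)]

/-- Laurent polynomials inside the fraction field of the completion. -/
def laurentToFrac : Laurent I →+* FractionRing (Qfin I) :=
  (AddMonoidAlgebra.lift ℂ[X] (FractionRing (Qfin I)) (I →₀ ℤ) expo).toRingHom

lemma expo_mul_pow (x : I →₀ ℤ) (N : ℕ) (s : Finset I) (hs : x.support ⊆ s)
    (hN : ∀ i, x i ≤ N) :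
    expo (Multiplicative.ofAdd x) * ∏ i ∈ s, var i ^ N =
      algebraMap (Qfin I) (FractionRing (Qfin I))
        (MvPowerSeries.monomial (Finsupp.indicator s fun i _ => ((N : ℤ) - x i).toNat) 1) := by
  classical
  have h1 : expo (Multiplicative.ofAdd x) = ∏ i ∈ s, var i ^ (-(x i)) := by
    change x.prod (fun i k => var i ^ (-k)) = _
    exact Finsupp.prod_of_support_subset x hs _ (by simp)
  rw [h1, ← Finset.prod_mul_distrib, MvPowerSeries.monomial_one_eq,
    Finsupp.prod_of_support_subset (s := s) _ (Finsupp.support_indicator_subset _ _) _ (by simp),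
    map_prod]
  refine Finset.prod_congr rfl fun i hi => ?_
  rw [Finsupp.indicator_of_mem hi, map_pow]
  change _ = var i ^ _
  rw [← zpow_natCast (var i) N, ← zpow_add₀ (var_ne_zero i), ← zpow_natCast,
    Int.toNat_of_nonneg (by have := hN i; omega)]
  congr 1
  ring

lemma laurentToFrac_injective : Function.Injective (laurentToFrac (I := I)) := by
  classical
  rw [injective_iff_map_eq_zero]
  intro p hp
  set T : Finset (I →₀ ℤ) := p.coeff.support with hT
  set s : Finset I := T.biUnion fun x => x.support with hs
  set N : ℕ := T.sup fun x => x.support.sup fun i => (x i).natAbs with hN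
  have hxs : ∀ x ∈ T, x.support ⊆ s := fun x hx =>
    Finset.subset_biUnion_of_mem (fun x : I →₀ ℤ => x.support) hx
  have hxN : ∀ x ∈ T, ∀ i, x i ≤ N := by
    intro x hx i
    by_cases hi : i ∈ x.support
    · have h1 : (x i).natAbs ≤ x.support.sup fun i => (x i).natAbs :=
        Finset.le_sup (f := fun i => (x i).natAbs) hi
      have h2 : (x.support.sup fun i => (x i).natAbs) ≤ N :=
        Finset.le_sup (f := fun x : I →₀ ℤ => x.support.sup fun i => (x i).natAbs) hx
      omega
    · rw [Finsupp.notMem_support_iff.mp hi]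
      positivity
  set φ : (I →₀ ℤ) → (I →₀ ℕ) := fun x => Finsupp.indicator s fun i _ => ((N : ℤ) - x i).toNat
    with hφ
  have hφinj : ∀ x ∈ T, ∀ y ∈ T, φ x = φ y → x = y := by
    intro x hx y hy hxy
    ext i
    by_cases hi : i ∈ s
    · have h := DFunLike.congr_fun hxy i
      simp only [hφ, Finsupp.indicator_of_mem hi] at h
      have h1 := hxN x hx i
      have h2 := hxN y hy i
      omega
    · rw [Finsupp.notMem_support_iff.mp fun h => hi (hxs x hx h),
        Finsupp.notMem_support_iff.mp fun h => hi (hxs y hy h)]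
  have hsum : laurentToFrac p = ∑ x ∈ T, (p.coeff x) • expo (Multiplicative.ofAdd x) := by
    change AddMonoidAlgebra.lift ℂ[X] (FractionRing (Qfin I)) (I →₀ ℤ) expo p = _
    rw [AddMonoidAlgebra.lift_apply]
    rfl
  have hzero : algebraMap (Qfin I) (FractionRing (Qfin I))
      (∑ x ∈ T, p.coeff x • MvPowerSeries.monomial (φ x) 1) = 0 := by
    have : laurentToFrac p * ∏ i ∈ s, var i ^ N = 0 := by rw [hp, zero_mul]
    rw [hsum, Finset.sum_mul] at this
    rw [map_sum, ← this]
    refine Finset.sum_congr rfl fun x hx => ?_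
    rw [smul_mul_assoc, expo_mul_pow x N s (hxs x hx) (hxN x hx)]
    exact map_smul (IsScalarTower.toAlgHom ℂ[X] (Qfin I) (FractionRing (Qfin I))) _ _
  have hz : (∑ x ∈ T, p.coeff x • MvPowerSeries.monomial (φ x) (1 : ℂ[X])) = 0 :=
    IsFractionRing.injective (Qfin I) (FractionRing (Qfin I)) (by rw [hzero, map_zero])
  ext1
  refine Finsupp.ext fun y => ?_
  by_contra hy
  have hyT : y ∈ T := Finsupp.mem_support_iff.mpr hy
  have h := congrArg (MvPowerSeries.coeff (φ y)) hz
  rw [map_sum, Finset.sum_eq_single y] at h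
  · simp at h
    exact hy h
  · intro x hx hxy
    rw [map_smul, MvPowerSeries.coeff_monomial, if_neg, smul_zero]
    exact fun h => hxy (hφinj x hx y hyT h.symm)
  · exact fun h => absurd hyT h

/-- Rational functions inside the fraction field of the completion: the formal expansion of rational
functions in negative powers of the coroots. -/
def ratToFrac : RatFun I →+* FractionRing (Qfin I) :=
  IsFractionRing.lift laurentToFrac_injective

/-- `g` is the expansion of the rational function `f` in negative powers of the coroots. -/
def Expands (f : RatFun I) (g : Qfin I) : Prop :=
  ratToFrac f = algebraMap (Qfin I) (FractionRing (Qfin I)) g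

open Classical in
/-- The expansion of a rational function in `ℂ[v⁻¹][[Q^∨_-]]` (`0` if it has none there). -/
def expansion (f : RatFun I) : Qfin I := if h : ∃ g, Expands f g then h.choose else 0

/-- Automorphisms of the lattice act on its group algebra by `g • e^x = e^{g x}`. -/
instance instActionLaurent : MulSemiringAction ((I →₀ ℤ) ≃ₗ[ℤ] (I →₀ ℤ)) (Laurent I) where
  smul g f := AddMonoidAlgebra.domCongr ℂ[X] ℂ[X] g.toAddEquiv f
  one_smul f := by
    change AddMonoidAlgebra.domCongr ℂ[X] ℂ[X] (AddEquiv.refl _) f = f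
    simp
  mul_smul g h f := by
    change AddMonoidAlgebra.domCongr ℂ[X] ℂ[X] (h.toAddEquiv.trans g.toAddEquiv) f =
      AddMonoidAlgebra.domCongr ℂ[X] ℂ[X] g.toAddEquiv
        (AddMonoidAlgebra.domCongr ℂ[X] ℂ[X] h.toAddEquiv f)
    rw [← AddMonoidAlgebra.trans_domCongr_domCongr]
    rfl
  smul_zero g := map_zero (AddMonoidAlgebra.domCongr ℂ[X] ℂ[X] g.toAddEquiv)
  smul_add g := map_add (AddMonoidAlgebra.domCongr ℂ[X] ℂ[X] g.toAddEquiv)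
  smul_one g := map_one (AddMonoidAlgebra.domCongr ℂ[X] ℂ[X] g.toAddEquiv)
  smul_mul g := map_mul (AddMonoidAlgebra.domCongr ℂ[X] ℂ[X] g.toAddEquiv)

/-- The induced action on rational functions. -/
instance instActionRatFun : MulSemiringAction ((I →₀ ℤ) ≃ₗ[ℤ] (I →₀ ℤ)) (RatFun I) :=
  IsFractionRing.mulSemiringAction _ (Laurent I) (RatFun I)

/-- The rational function `c(x) = (1 - v⁻¹ e^{-x}) / (1 - e^x)`. -/
def cFun (x : I →₀ ℤ) : RatFun I := (1 - vinv * rexp (-x)) / (1 - rexp x)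

/-- The rational function `b(x) = (v⁻¹ - 1) / (1 - e^x)`. -/
def bFun (x : I →₀ ℤ) : RatFun I := (vinv - 1) / (1 - rexp x)

/-- `F` is the infinite sum of the `f j`, formed coefficient by coefficient: for every monomial
`e^{-n} v^{-d}` only finitely many `f j` involve it, and its coefficients add up to that in `F`. -/
def HasFormalSum {J : Type*} (f : J → Qfin I) (F : Qv I) : Prop :=
  ∀ (n : I →₀ ℕ) (d : ℕ),
    {j | (MvPowerSeries.coeff n (f j)).coeff d ≠ 0}.Finite ∧
    PowerSeries.coeff d (MvPowerSeries.coeff n F) =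
      ∑ᶠ j, (MvPowerSeries.coeff n (f j)).coeff d

/-- `F` is the infinite product of the `f j`: every coefficient of the finite partial products is
eventually constant, equal to the coefficient of `F`. -/
def HasFormalProd {J : Type*} (f : J → Qfin I) (F : Qfin I) : Prop :=
  ∀ n : I →₀ ℕ, ∀ᶠ s : Finset J in Filter.atTop,
    MvPowerSeries.coeff n (∏ j ∈ s, f j) = MvPowerSeries.coeff n F

open Classical in
/-- The infinite product of the `f j` (`1` if it does not converge). -/
def formalProd {J : Type*} (f : J → Qfin I) : Qfin I :=
  if h : ∃ F, HasFormalProd f F then h.choose else 1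

open Classical in
/-- The coefficient of `e^x` in an element of `ℂ[v⁻¹][[Q^∨_-]]`, for an arbitrary `x ∈ Q^∨`. -/
def coeffExp (f : Qfin I) (x : I →₀ ℤ) : ℂ[X] :=
  if h : ∃ n : I →₀ ℕ, toLattice n = -x then MvPowerSeries.coeff h.choose f else 0

end Rings

/-! ### The untwisted affinization of a finite root system -/

section Affine

variable {ι k M N : Type*} [Field k] [AddCommGroup M] [Module k M]
  [AddCommGroup N] [Module k N] {P : RootPairing ι k M N} (b : P.Base)

/-- `θ` is the (index of the) highest root. -/
def IsHighestRoot (θ : ι) : Prop :=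
  ∀ i, P.root θ - P.root i ∈ AddSubmonoid.closure (P.root '' b.support)

/-- The index set of the simple affine (co)roots: `some i` is a simple (co)root of the finite root
system, `none` is the additional affine node. -/
abbrev Idx : Type _ := Option b.support

/-- The affine coroot lattice `Q^∨`, in the basis of the simple affine coroots. -/
abbrev Lattice : Type _ := Idx b →₀ ℤ

variable (θ : ι)

/-- The finite part of a simple affine (co)root: the affine node is `-θ` up to imaginary (co)roots. -/
def node : Idx b → ι
  | some i => i
  | none => P.reflectionPerm θ θ

/-- The simple affine coroot `a_i^∨`. -/
def simpleCoroot (i : Idx b) : Lattice b := Finsupp.single i 1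

/-- The projection of `Q^∨` to the finite coroot lattice, with kernel `ℤ c`: the coroot `a_i^∨` goes
to the simple coroot `i`, and the affine simple coroot `c - θ^∨` to `-θ^∨`. -/
def finPart : Lattice b →ₗ[ℤ] N :=
  Finsupp.linearCombination ℤ fun i => P.coroot (node b θ i)

lemma exists_corootCoord :
    ∃ f : b.support →₀ ℤ, Finsupp.linearCombination ℤ (fun i : b.support => P.coroot i) f =
      P.coroot θ := by
  have h := b.coroot_mem_span_int θ
  rw [Set.image_eq_range] at h
  exact (Finsupp.mem_span_range_iff_exists_finsupp).mp h

/-- The minimal imaginary coroot `c = a_0^∨ + θ^∨`, with `a_0^∨` the coroot of the affine node. -/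
def minImag : Lattice b :=
  simpleCoroot b none + (exists_corootCoord b θ).choose.embDomain Function.Embedding.some

lemma finPart_minImag : finPart b θ (minImag b θ) = 0 := by
  rw [minImag, map_add, Finsupp.embDomain_eq_mapDomain, finPart,
    Finsupp.linearCombination_mapDomain]
  have h := (exists_corootCoord b θ).choose_spec
  have h2 : ((fun i => P.coroot (node b θ i)) ∘ (Function.Embedding.some : b.support ↪ Idx b)) =
      fun i : b.support => P.coroot i := rfl
  rw [h2, h]
  simp [simpleCoroot, node]

/-- The affine coroots: modulo `c` they are a coroot of the finite root system (real coroots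
`α^∨ + n c`) or zero (imaginary coroots `n c`, `n ≠ 0`). -/
def IsAffineCoroot (x : Lattice b) : Prop :=
  x ≠ 0 ∧ (finPart b θ x ∈ Set.range P.coroot ∨ finPart b θ x = 0)

/-- The positive affine coroots. -/
abbrev PosCoroot : Type _ := {n : Idx b →₀ ℕ // IsAffineCoroot b θ (toLattice n)}

open Classical in
/-- The multiplicity of a coroot: the rank of the finite root system for imaginary coroots, and `1`
for real ones. -/
def mult (n : PosCoroot b θ) : ℕ :=
  if finPart b θ (toLattice n.1) = 0 then b.support.card else 1

variable [CharZero k] [P.IsCrystallographic]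

/-- The pairing `⟨a_i, x⟩` of a simple affine root with an element of `Q^∨`. -/
def simplePairing (i : Idx b) : Lattice b →ₗ[ℤ] ℤ :=
  Finsupp.linearCombination ℤ fun j => P.pairingIn ℤ (node b θ i) (node b θ j)

lemma simplePairing_self (i : Idx b) : simplePairing b θ i (simpleCoroot b i) = 2 := by
  simp [simplePairing, simpleCoroot]

/-- The simple reflection `x ↦ x - ⟨a_i, x⟩ a_i^∨` of `Q^∨`. -/
def simpleReflection (i : Idx b) : Lattice b ≃ₗ[ℤ] Lattice b :=
  Module.reflection (simplePairing_self b θ i)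

/-- The affine Weyl group, in its (faithful) action on `Q^∨`. -/
def weyl : Subgroup (Lattice b ≃ₗ[ℤ] Lattice b) :=
  Subgroup.closure (Set.range (simpleReflection b θ))

/-- The simple reflections as elements of the affine Weyl group. -/
def gen (i : Idx b) : weyl b θ :=
  ⟨simpleReflection b θ i, Subgroup.subset_closure (Set.mem_range_self i)⟩

/-- `l` is a reduced word of `w`. -/
def IsReducedWord (l : List (Idx b)) (w : weyl b θ) : Prop :=
  (l.map (gen b θ)).prod = w ∧
    ∀ l' : List (Idx b), (l'.map (gen b θ)).prod = w → l.length ≤ l'.length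

lemma gen_inv (i : Idx b) : (gen b θ i)⁻¹ = gen b θ i := by
  rw [inv_eq_iff_mul_eq_one]
  refine Subtype.ext (LinearEquiv.ext fun x => ?_)
  exact Module.involutive_reflection (simplePairing_self b θ i) x

lemma exists_word (w : weyl b θ) : ∃ l : List (Idx b), (l.map (gen b θ)).prod = w := by
  obtain ⟨w, hw⟩ := w
  induction hw using Subgroup.closure_induction with
  | mem x hx => obtain ⟨i, rfl⟩ := hx; exact ⟨[i], by simp [gen]⟩
  | one => exact ⟨[], rfl⟩
  | mul x y hx hy h1 h2 =>
    obtain ⟨l1, h1⟩ := h1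
    obtain ⟨l2, h2⟩ := h2
    exact ⟨l1 ++ l2, by rw [List.map_append, List.prod_append, h1, h2]; rfl⟩
  | inv x hx h =>
    obtain ⟨l, h⟩ := h
    refine ⟨l.reverse, ?_⟩
    have h3 : (fun g => g⁻¹) ∘ gen b θ = gen b θ := funext fun i => gen_inv b θ i
    have := congrArg (fun g => g⁻¹) h
    simp only [List.prod_inv_reverse, List.map_map, ← List.map_reverse, h3] at this
    rw [this]
    rfl

lemma exists_reducedWord (w : weyl b θ) : ∃ l, IsReducedWord b θ l w := by
  classical
  have h : ∃ n : ℕ, ∃ l : List (Idx b), (l.map (gen b θ)).prod = w ∧ l.length = n := by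
    obtain ⟨l, hl⟩ := exists_word b θ w
    exact ⟨_, l, hl, rfl⟩
  obtain ⟨l, hl, hn⟩ := Nat.find_spec h
  exact ⟨l, hl, fun l' hl' => hn ▸ Nat.find_min' h ⟨l', hl', rfl⟩⟩

/-- The group algebra of the affine Weyl group over the rational functions, with the commutation
relation `[w] f = f^w [w]`. -/
abbrev RW : Type _ := SkewMonoidAlgebra (RatFun (Idx b)) (weyl b θ)

/-- The Demazure-Lusztig operator `T_a = c(a^∨) [w_a] + b(a^∨) [1]` of a simple affine root. -/
def simpleT (i : Idx b) : RW b θ :=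
  SkewMonoidAlgebra.single (gen b θ i) (cFun (simpleCoroot b i)) +
    SkewMonoidAlgebra.single 1 (bFun (simpleCoroot b i))

/-- The product `T_{i_1} ⋯ T_{i_r}` along a word. -/
def wordT (l : List (Idx b)) : RW b θ := (l.map (simpleT b θ)).prod

/-- The element `T_w`, the product of the `T_a` along a reduced word of `w`. -/
def elemT (w : weyl b θ) : RW b θ := wordT b θ (exists_reducedWord b θ w).choose

/-- The coefficient `C_u(w)` of `[u]` in `T_w`, expanded in negative powers of the coroots. -/
def coeffC (u w : weyl b θ) : Qfin (Idx b) := expansion ((elemT b θ w).coeff u)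

/-- The factor `(1 - v⁻¹ e^{-β})^{m(β)}` of the deformed Weyl-Kac denominator. -/
def denomFactor (n : PosCoroot b θ) : Qfin (Idx b) :=
  (1 - MvPowerSeries.monomial n.1 X) ^ mult b θ n

/-- The `v`-deformed Weyl-Kac denominator `D_v = ∏ (1 - v⁻¹ e^{-β})^{m(β)}`, over all positive
affine coroots `β`. -/
def denomV : Qfin (Idx b) := formalProd (denomFactor b θ)

/-- The rational function `((1 - e^{-β})⁻¹)^w = (1 - e^{-wβ})⁻¹`. -/
def invFactorRat (w : weyl b θ) (n : PosCoroot b θ) : RatFun (Idx b) :=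
  w • (1 - rexp (-toLattice n.1))⁻¹

/-- The factor `(1 - e^{-wβ})^{-m(β)}` of `(1/D)^w`, expanded in negative powers of the coroots. -/
def invFactor (w : weyl b θ) (n : PosCoroot b θ) : Qfin (Idx b) :=
  expansion (invFactorRat b θ w n) ^ mult b θ n

/-- The translate `(1/D)^w` of the inverse of the Weyl-Kac denominator
`D = ∏ (1 - e^{-β})^{m(β)}`, i.e. the coefficient of `[w]` in `[w] (1/D) = (1/D)^w [w]`. -/
def invDenom (w : weyl b θ) : Qfin (Idx b) := formalProd (invFactor b θ w)

/-- The subring `ℂ[v⁻¹][[e^{-c}]]` of `ℂ[v⁻¹][[Q^∨_-]]`: only the powers `e^{-j c}` occur. -/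
def IsImagSeries (f : Qfin (Idx b)) : Prop :=
  ∀ n, MvPowerSeries.coeff n f ≠ 0 → ∃ j : ℕ, toLattice n = j • minImag b θ

end Affine

end AffineCS

end

/-! Write `T_w = ∑_u C_u(w) [u]`, and let `ε_u` be the product of the `-e^{-β}` over the inversions
`β` of `u⁻¹`. Expanding a reduced product of the `T_a` as a sum over paths in `W` gives
`C_u(w) = ε_u g_u(w)`, where `g_u(w)` involves only monomials of degree growing with the length of
`w`, and `g_u(w) + g_u(w s_i)` is unchanged when `u` is replaced by `u s_i`. Hence
`g = ∑_w g_u(w)` exists and does not depend on `u`, so that `C_u = ε_u g`. Since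
`(1/D)^u = ε_u / D`, this is the claimed formula with `c = g D / D_v`.

It remains to see that `c` is `W`-invariant, for then its exponents, which are bounded above, are
imaginary. Applying `∑_w T_w` to the constant function `1` gives `(∑_u ε_u) g`. Each `T_w` maps `1`
to a Laurent polynomial, and the relation between `T_w` and `T_{s_i w} = T_i T_w` shows that
`(∑_u ε_u) g / (1 - v⁻¹ e^{-a_i})` is `s_i`-invariant. So are `(∑_u ε_u) / (1 - e^{-a_i})`,
`D / (1 - e^{-a_i})` and `D_v / (1 - v⁻¹ e^{-a_i})`, and therefore `c`. -/

noncomputable section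

namespace AffineCS

/-! ### The invariant form and the real coroots -/

/-- The standing hypotheses on a base `b` and an index `θ`: the root system is simply laced, and
`θ` is its highest root. -/
class SimplyLacedAffine {ι k M N : Type*} [Field k] [AddCommGroup M] [Module k M]
    [AddCommGroup N] [Module k N] {P : RootPairing ι k M N} [CharZero k] [P.IsCrystallographic]
    (b : P.Base) (θ : ι) : Prop where
  isSimplyLaced : b.cartanMatrix.IsSimplyLaced
  isHighestRoot : IsHighestRoot b θ

section RootToCoroot

variable {ι k M N : Type*} [Field k] [AddCommGroup M] [Module k M] [AddCommGroup N] [Module k N]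
  {P : RootPairing ι k M N} (b : P.Base)

lemma pairing_comm_of_isSimplyLaced [Finite ι] [CharZero k] [P.IsCrystallographic]
    (hsl : b.cartanMatrix.IsSimplyLaced) (i j : b.support) : P.pairing i j = P.pairing j i := by
  rcases eq_or_ne i j with rfl | hij
  · rfl
  have hzero := b.cartanMatrix_apply_eq_zero_iff_symm (i := i) (j := j)
  have hcartan : P.pairingIn ℤ i j = P.pairingIn ℤ j i := by
    change b.cartanMatrix i j = b.cartanMatrix j i
    rcases hsl hij with h | h <;> rcases hsl hij.symm with h' | h' <;> simp_all
  rw [← P.algebraMap_pairingIn ℤ, ← P.algebraMap_pairingIn ℤ, hcartan]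

variable [P.IsRootSystem]

/-- The linear isomorphism sending each simple root to its coroot. In the simply-laced case it sends
every root to its coroot. -/
def rootToCoroot : M ≃ₗ[k] N := b.toWeightBasis.equiv b.toCoweightBasis (Equiv.refl _)

lemma rootToCoroot_simple (i : b.support) : rootToCoroot b (P.root i) = P.coroot i := by
  rw [rootToCoroot, ← b.toWeightBasis_apply, Module.Basis.equiv_apply, Equiv.refl_apply,
    b.toCoweightBasis_apply]

variable [Finite ι] [CharZero k] [P.IsCrystallographic]

lemma toLinearMap_rootToCoroot_comm (hsl : b.cartanMatrix.IsSimplyLaced) (x y : M) :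
    P.toLinearMap x (rootToCoroot b y) = P.toLinearMap y (rootToCoroot b x) := by
  have h : P.toLinearMap.compl₁₂ LinearMap.id (rootToCoroot b).toLinearMap =
      (P.toLinearMap.compl₁₂ LinearMap.id (rootToCoroot b).toLinearMap).flip := by
    refine b.toWeightBasis.ext fun i => b.toWeightBasis.ext fun j => ?_
    simpa [rootToCoroot_simple] using pairing_comm_of_isSimplyLaced b hsl i j
  exact LinearMap.congr_fun₂ h x y

lemma rootToCoroot_root [P.IsReduced] (hsl : b.cartanMatrix.IsSimplyLaced) (i : ι) :
    rootToCoroot b (P.root i) = P.coroot i := by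
  induction i using b.induction_reflect with
  | h₀ i hi =>
    rw [P.root_reflectionPerm, P.coroot_reflectionPerm, P.reflection_apply_self,
      P.coreflection_apply_self, map_neg, hi]
  | h₁ i hi => exact rootToCoroot_simple b ⟨i, hi⟩
  | h₂ i j hi hj =>
    have hpair : P.pairing i j = P.pairing j i := by
      have h := toLinearMap_rootToCoroot_comm b hsl (P.root i) (P.root j)
      rwa [hi, rootToCoroot_simple b ⟨j, hj⟩] at h
    rw [P.root_reflectionPerm, P.coroot_reflectionPerm, P.reflection_apply_root,
      P.coreflection_apply_coroot, map_sub, map_smul, hi, rootToCoroot_simple b ⟨j, hj⟩, hpair]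

end RootToCoroot

section RealCoroots

variable {ι k M N : Type*} [Field k] [AddCommGroup M] [Module k M] [AddCommGroup N] [Module k N]
  {P : RootPairing ι k M N} (b : P.Base) (θ : ι)

lemma finPart_simple (i : Idx b) : finPart b θ (simpleCoroot b i) = P.coroot (node b θ i) := by
  rw [finPart, simpleCoroot, Finsupp.linearCombination_single, one_smul]

/-- The real affine coroots `α^∨ + n c`: the elements of `Q^∨` that are coroots modulo `ℤ c`. -/
def IsReal (x : Lattice b) : Prop := finPart b θ x ∈ Set.range P.coroot

lemma isReal_simple (i : Idx b) : IsReal b θ (simpleCoroot b i) := ⟨_, (finPart_simple b θ i).symm⟩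

variable {b θ}

lemma IsReal.neg {x : Lattice b} (hx : IsReal b θ x) : IsReal b θ (-x) := by
  obtain ⟨α, hα⟩ := hx
  exact ⟨P.reflectionPerm α α, by
    rw [P.coroot_reflectionPerm, P.coreflection_apply_self, map_neg, hα]⟩

variable [CharZero k]

lemma IsReal.finPart_ne_zero {x : Lattice b} (hx : IsReal b θ x) : finPart b θ x ≠ 0 := by
  obtain ⟨α, hα⟩ := hx
  exact hα ▸ P.flip.ne_zero α

lemma IsReal.ne_zero {x : Lattice b} (hx : IsReal b θ x) : x ≠ 0 := by
  rintro rfl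
  exact hx.finPart_ne_zero (map_zero _)

end RealCoroots

section Form

variable {ι k M N : Type*} [Field k] [AddCommGroup M] [Module k M]
  [AddCommGroup N] [Module k N] {P : RootPairing ι k M N} [P.IsCrystallographic]
  (b : P.Base) (θ : ι)

/-- The bilinear form `(a_i^∨, y) = ⟨a_i, y⟩` on the affine coroot lattice. In the simply-laced case
it is symmetric and invariant under the affine Weyl group. -/
def form : Lattice b →ₗ[ℤ] Lattice b →ₗ[ℤ] ℤ :=
  Finsupp.linearCombination ℤ (simplePairing b θ)

lemma form_simple (i : Idx b) (y : Lattice b) :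
    form b θ (simpleCoroot b i) y = simplePairing b θ i y := by
  rw [form, simpleCoroot, Finsupp.linearCombination_single, one_smul]

lemma form_eq_sum (x y : Lattice b) :
    form b θ x y = x.sum fun i a => a * simplePairing b θ i y := by
  simp [form, Finsupp.linearCombination_apply, Finsupp.sum]

lemma intCast_simplePairing (i : Idx b) (y : Lattice b) :
    ((simplePairing b θ i y : ℤ) : k) = P.toLinearMap (P.root (node b θ i)) (finPart b θ y) := by
  induction y using Finsupp.induction_linear with
  | zero => simp
  | add f g hf hg => simp [hf, hg]
  | single j a =>
    have h := P.algebraMap_pairingIn ℤ (node b θ i) (node b θ j)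
    rw [algebraMap_int_eq, eq_intCast] at h
    rw [simplePairing, finPart, Finsupp.linearCombination_single,
      Finsupp.linearCombination_single, smul_eq_mul, Int.cast_mul, h, map_zsmul, zsmul_eq_mul]
    rfl

variable {b θ} in
lemma finPart_eq_zero_of_simplePairing [P.IsRootSystem] {x : Lattice b}
    (h : ∀ i, simplePairing b θ i x = 0) : finPart b θ x = 0 := by
  have hflip : P.toLinearMap.flip (finPart b θ x) = 0 := by
    refine b.toWeightBasis.ext fun i => ?_
    have hroot := intCast_simplePairing b θ (some i) x
    rw [h, Int.cast_zero] at hroot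
    rw [b.toWeightBasis_apply, LinearMap.flip_apply, LinearMap.zero_apply]
    exact hroot.symm
  exact (LinearMap.IsPerfPair.bijective_right (p := P.toLinearMap)).1
    (hflip.trans (map_zero _).symm)

/-- The reflection `y ↦ y - (x, y) x` in a real coroot `x`. -/
def realReflection (x y : Lattice b) : Lattice b := y - form b θ x y • x

variable [CharZero k]

lemma simpleReflection_apply (i : Idx b) (x : Lattice b) :
    simpleReflection b θ i x = x - simplePairing b θ i x • simpleCoroot b i :=
  Module.reflection_apply ..

lemma realReflection_simple (i : Idx b) (y : Lattice b) :
    realReflection b θ (simpleCoroot b i) y = simpleReflection b θ i y := by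
  rw [simpleReflection_apply, realReflection, form_simple]

end Form

section InvariantForm

variable {ι k M N : Type*} [Finite ι] [Field k] [CharZero k] [AddCommGroup M] [Module k M]
  [AddCommGroup N] [Module k N] {P : RootPairing ι k M N} [P.IsRootSystem] [P.IsCrystallographic]
  [P.IsReduced] {b : P.Base} {θ : ι} [hS : SimplyLacedAffine b θ]

variable (b θ) in
include hS in
lemma rootToCoroot_symm_coroot (α : ι) : (rootToCoroot b).symm (P.coroot α) = P.root α := by
  rw [LinearEquiv.symm_apply_eq, rootToCoroot_root b hS.isSimplyLaced]

lemma intCast_form (x y : Lattice b) : ((form b θ x y : ℤ) : k) =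
    P.toLinearMap ((rootToCoroot b).symm (finPart b θ x)) (finPart b θ y) := by
  induction x using Finsupp.induction_linear with
  | zero => simp
  | add f g hf hg => simp [hf, hg]
  | single i a =>
    have hsmul : (Finsupp.single i a : Lattice b) = a • simpleCoroot b i := by simp [simpleCoroot]
    rw [hsmul, map_zsmul, map_zsmul, LinearMap.smul_apply, form_simple, finPart_simple, map_zsmul,
      rootToCoroot_symm_coroot b θ, map_zsmul, LinearMap.smul_apply, ← intCast_simplePairing,
      smul_eq_mul, Int.cast_mul, zsmul_eq_mul]

lemma form_comm (x y : Lattice b) : form b θ x y = form b θ y x := by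
  have h := toLinearMap_rootToCoroot_comm b hS.isSimplyLaced
    ((rootToCoroot b).symm (finPart b θ x)) ((rootToCoroot b).symm (finPart b θ y))
  rw [LinearEquiv.apply_symm_apply, LinearEquiv.apply_symm_apply, ← intCast_form,
    ← intCast_form] at h
  exact_mod_cast h

lemma form_self {x : Lattice b} (hx : IsReal b θ x) : form b θ x x = 2 := by
  obtain ⟨α, hα⟩ := hx
  have h : ((form b θ x x : ℤ) : k) = 2 := by
    rw [intCast_form, ← hα, rootToCoroot_symm_coroot b θ]
    exact P.root_coroot_two α
  exact_mod_cast h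

lemma form_eq_zero_of_finPart {x : Lattice b} (hx : finPart b θ x = 0) (y : Lattice b) :
    form b θ x y = 0 := by
  have h := intCast_form (θ := θ) x y
  rw [hx, map_zero, map_zero, LinearMap.zero_apply] at h
  exact_mod_cast h

lemma finPart_realReflection {x : Lattice b} {α : ι} (hα : P.coroot α = finPart b θ x)
    (y : Lattice b) :
    finPart b θ (realReflection b θ x y) = P.coreflection α (finPart b θ y) := by
  have h := intCast_form (θ := θ) x y
  rw [← hα, rootToCoroot_symm_coroot b θ] at h
  rw [realReflection, P.coreflection_apply, map_sub, map_zsmul, ← hα, ← Int.cast_smul_eq_zsmul k, h]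

lemma IsReal.realReflection {x y : Lattice b} (hx : IsReal b θ x) (hy : IsReal b θ y) :
    IsReal b θ (realReflection b θ x y) := by
  obtain ⟨α, hα⟩ := hx
  obtain ⟨β, hβ⟩ := hy
  exact ⟨P.reflectionPerm α β, by rw [finPart_realReflection hα, ← hβ, P.coroot_reflectionPerm]⟩

lemma IsReal.simpleReflection (i : Idx b) {x : Lattice b} (hx : IsReal b θ x) :
    IsReal b θ (simpleReflection b θ i x) :=
  realReflection_simple b θ i x ▸ (isReal_simple b θ i).realReflection hx

lemma form_realReflection {x : Lattice b} (hx : IsReal b θ x) (y z : Lattice b) :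
    form b θ (realReflection b θ x y) (realReflection b θ x z) = form b θ y z := by
  simp only [realReflection, map_sub, map_smul, LinearMap.sub_apply, LinearMap.smul_apply,
    smul_eq_mul, form_self hx, form_comm (b := b) (θ := θ) y x]
  ring

lemma form_weyl (w : weyl b θ) (y z : Lattice b) :
    form b θ (w.1 y) (w.1 z) = form b θ y z := by
  obtain ⟨l, rfl⟩ := exists_word b θ w
  induction l with
  | nil => rfl
  | cons i l ih =>
    rw [List.map_cons, List.prod_cons, ← ih]
    have h := form_realReflection (isReal_simple b θ i) (θ := θ) ((l.map (gen b θ)).prod.1 y)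
      ((l.map (gen b θ)).prod.1 z)
    rwa [realReflection_simple, realReflection_simple] at h

lemma IsReal.weyl (w : weyl b θ) {x : Lattice b} (hx : IsReal b θ x) : IsReal b θ (w.1 x) := by
  obtain ⟨l, rfl⟩ := exists_word b θ w
  induction l with
  | nil => exact hx
  | cons i l ih => exact IsReal.simpleReflection i ih

lemma weyl_apply_of_finPart_eq_zero (w : weyl b θ) {x : Lattice b} (hx : finPart b θ x = 0) :
    w.1 x = x := by
  obtain ⟨l, rfl⟩ := exists_word b θ w
  induction l with
  | nil => rfl
  | cons i l ih =>
    rw [List.map_cons, List.prod_cons]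
    change simpleReflection b θ i ((l.map (gen b θ)).prod.1 x) = x
    rw [ih, simpleReflection_apply, ← form_simple, form_comm, form_eq_zero_of_finPart hx, zero_smul,
      sub_zero]

lemma finPart_weyl_eq_zero_iff (w : weyl b θ) {x : Lattice b} :
    finPart b θ (w.1 x) = 0 ↔ finPart b θ x = 0 := by
  refine ⟨fun h => ?_, fun h => by rw [weyl_apply_of_finPart_eq_zero w h, h]⟩
  have hinv : w.1 x = x := by
    have := weyl_apply_of_finPart_eq_zero w⁻¹ h
    exact this.symm.trans (w.1.symm_apply_apply x)
  rwa [hinv] at h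

end InvariantForm

section SimpleReflection

variable {ι k M N : Type*} [Field k] [AddCommGroup M] [Module k M] [AddCommGroup N] [Module k N]
  {P : RootPairing ι k M N} {b : P.Base}

lemma simpleCoroot_ne_zero (i : Idx b) : simpleCoroot b i ≠ 0 :=
  Finsupp.single_ne_zero.mpr one_ne_zero

lemma simpleCoroot_nonneg (i : Idx b) : 0 ≤ simpleCoroot b i :=
  Finsupp.single_nonneg.mpr zero_le_one

lemma simpleCoroot_add_ne_zero (i j : Idx b) : simpleCoroot b i + simpleCoroot b j ≠ 0 := by
  intro h
  have hi : simpleCoroot b i ≤ 0 := h ▸ le_add_of_nonneg_right (simpleCoroot_nonneg j)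
  simpa [simpleCoroot] using hi i

variable [CharZero k] [P.IsCrystallographic] {θ : ι}

lemma simpleReflection_self (i : Idx b) :
    simpleReflection b θ i (simpleCoroot b i) = -simpleCoroot b i := by
  rw [simpleReflection_apply, simplePairing_self]
  module

lemma simpleReflection_apply_of_ne {i j : Idx b} (h : j ≠ i) (x : Lattice b) :
    simpleReflection b θ i x j = x j := by
  rw [simpleReflection_apply, simpleCoroot, Finsupp.sub_apply, Finsupp.smul_apply,
    Finsupp.single_eq_of_ne h, smul_zero, sub_zero]

lemma simpleReflection_simpleReflection (i : Idx b) (x : Lattice b) :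
    simpleReflection b θ i (simpleReflection b θ i x) = x :=
  Module.involutive_reflection (simplePairing_self b θ i) x

end SimpleReflection

section MinImag

variable {ι k M N : Type*} [Field k] [AddCommGroup M] [Module k M] [AddCommGroup N] [Module k N]
  {P : RootPairing ι k M N} {b : P.Base} {θ : ι}

variable (b θ) in
/-- The highest coroot `θ^∨`, as an element of the affine coroot lattice. -/
def highest : Lattice b := minImag b θ - simpleCoroot b none

lemma highest_none : highest b θ none = 0 := by
  rw [highest, minImag, add_sub_cancel_left]
  exact Finsupp.embDomain_of_notMem_range _ _ _ (by simp)

lemma minImag_eq : minImag b θ = highest b θ + simpleCoroot b none :=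
  (sub_add_cancel _ _).symm

lemma minImag_none : minImag b θ none = 1 := by
  rw [minImag_eq, Finsupp.add_apply, highest_none, simpleCoroot, Finsupp.single_eq_same, zero_add]

lemma finPart_simpleCoroot_none : finPart b θ (simpleCoroot b none) = -P.coroot θ := by
  rw [finPart_simple, node, P.coroot_reflectionPerm, P.coreflection_apply_self]

lemma finPart_highest : finPart b θ (highest b θ) = P.coroot θ := by
  rw [highest, map_sub, finPart_minImag, finPart_simpleCoroot_none, zero_sub, neg_neg]

lemma finPart_eq_sum (y : Lattice b) (hy : y none = 0) :
    finPart b θ y = ∑ i : b.support, y (some i) • P.coroot i := by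
  classical
  rw [finPart, Finsupp.linearCombination_apply, Finsupp.sum_fintype _ _ (by simp),
    Fintype.sum_option, hy, zero_smul, zero_add]
  rfl

lemma exists_nonneg_finPart_eq [P.IsRootSystem] (θ : ι) {m : M}
    (hm : m ∈ AddSubmonoid.closure (P.root '' b.support)) :
    ∃ y : Lattice b, 0 ≤ y ∧ y none = 0 ∧ finPart b θ y = rootToCoroot b m := by
  induction hm using AddSubmonoid.closure_induction with
  | mem x hx =>
    obtain ⟨i, hi, rfl⟩ := hx
    refine ⟨simpleCoroot b (some ⟨i, hi⟩), simpleCoroot_nonneg _, by simp [simpleCoroot], ?_⟩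
    rw [finPart_simple, rootToCoroot_simple b ⟨i, hi⟩]
    rfl
  | zero => exact ⟨0, le_rfl, rfl, by simp⟩
  | add x y _ _ hx hy =>
    obtain ⟨x', hx', hxnone, hxfin⟩ := hx
    obtain ⟨y', hy', hynone, hyfin⟩ := hy
    exact ⟨x' + y', add_nonneg hx' hy', by simp [hxnone, hynone], by simp [hxfin, hyfin]⟩

variable [CharZero k]

lemma eq_zero_of_finPart_eq_zero {y : Lattice b} (hy : y none = 0) (h : finPart b θ y = 0) :
    y = 0 := by
  have hli : LinearIndependent ℤ (fun i : b.support => P.coroot i) :=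
    b.linearIndepOn_coroot.restrict_scalars' ℤ
  rw [finPart_eq_sum y hy] at h
  have hcoord := Fintype.linearIndependent_iff.mp hli _ h
  ext i
  cases i with
  | none => exact hy
  | some i => exact hcoord i

lemma eq_of_finPart_eq {x y : Lattice b} (hxy : x none = y none)
    (h : finPart b θ x = finPart b θ y) : x = y :=
  sub_eq_zero.mp (eq_zero_of_finPart_eq_zero (θ := θ) (by simp [hxy]) (by simp [h]))

lemma eq_smul_minImag {x : Lattice b} (hx : finPart b θ x = 0) : x = x none • minImag b θ :=
  eq_of_finPart_eq (θ := θ) (by simp [minImag_none])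
    (by rw [hx, map_smul, finPart_minImag, smul_zero])

end MinImag

section Positivity

variable {ι k M N : Type*} [Finite ι] [Field k] [CharZero k] [AddCommGroup M] [Module k M]
  [AddCommGroup N] [Module k N] {P : RootPairing ι k M N} [P.IsRootSystem] [P.IsCrystallographic]
  [P.IsReduced] {b : P.Base} {θ : ι} [hS : SimplyLacedAffine b θ]

variable (b θ) in
lemma exists_nonneg_finPart_eq_highest_sub (α : ι) :
    ∃ y : Lattice b, 0 ≤ y ∧ y none = 0 ∧ finPart b θ y = P.coroot θ - P.coroot α := by
  obtain ⟨y, hy, hnone, hfin⟩ := exists_nonneg_finPart_eq θ (hS.isHighestRoot α)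
  refine ⟨y, hy, hnone, ?_⟩
  rw [hfin, map_sub, rootToCoroot_root b hS.isSimplyLaced, rootToCoroot_root b hS.isSimplyLaced]

lemma simpleCoroot_le_highest (i : b.support) : simpleCoroot b (some i) ≤ highest b θ := by
  obtain ⟨y, hy, hnone, hfin⟩ := exists_nonneg_finPart_eq_highest_sub b θ i
  have h : highest b θ = simpleCoroot b (some i) + y := by
    refine eq_of_finPart_eq (θ := θ) (by simp [highest_none, hnone, simpleCoroot]) ?_
    rw [map_add, hfin, finPart_highest, finPart_simple, node, add_sub_cancel]
  exact h ▸ le_add_of_nonneg_right hy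

lemma one_le_minImag (i : Idx b) : 1 ≤ minImag b θ i := by
  cases i with
  | none => rw [minImag_none]
  | some i =>
    have h := simpleCoroot_le_highest (θ := θ) i (some i)
    simpa [minImag_eq, simpleCoroot] using h

lemma minImag_nonneg : 0 ≤ minImag b θ := fun i => zero_le_one.trans (one_le_minImag i)

lemma IsReal.nonneg_of_none_pos {x : Lattice b} (hx : IsReal b θ x) (h : 1 ≤ x none) : 0 ≤ x := by
  obtain ⟨α, hα⟩ := hx.neg
  obtain ⟨y, hy, hnone, hfin⟩ := exists_nonneg_finPart_eq_highest_sub b θ α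
  have hdecomp : x = (x none - 1) • minImag b θ + simpleCoroot b none + y := by
    refine eq_of_finPart_eq (θ := θ) (by simp [minImag_none, simpleCoroot, hnone]) ?_
    rw [map_add, map_add, map_smul, finPart_minImag, hfin, hα, finPart_simpleCoroot_none, map_neg]
    module
  rw [hdecomp]
  exact add_nonneg (add_nonneg (smul_nonneg (by omega) minImag_nonneg) (simpleCoroot_nonneg _)) hy

lemma IsReal.nonneg_or_nonpos_of_none_eq_zero {x : Lattice b} (hx : IsReal b θ x)
    (h : x none = 0) : 0 ≤ x ∨ x ≤ 0 := by
  obtain ⟨α, hα⟩ := hx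
  rcases b.root_mem_or_neg_mem α with hmem | hmem
  · obtain ⟨y, hy, hnone, hfin⟩ := exists_nonneg_finPart_eq θ hmem
    rw [rootToCoroot_root b hS.isSimplyLaced, hα] at hfin
    exact Or.inl (eq_of_finPart_eq (hnone.trans h.symm) hfin ▸ hy)
  · obtain ⟨y, hy, hnone, hfin⟩ := exists_nonneg_finPart_eq θ hmem
    rw [map_neg, rootToCoroot_root b hS.isSimplyLaced, hα, ← map_neg] at hfin
    have hyx : y = -x := eq_of_finPart_eq (by simp [h, hnone]) hfin
    exact Or.inr (neg_nonneg.mp (hyx ▸ hy))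

lemma IsReal.nonneg_or_nonpos {x : Lattice b} (hx : IsReal b θ x) : 0 ≤ x ∨ x ≤ 0 := by
  rcases lt_trichotomy (x none) 0 with h | h | h
  · exact Or.inr (neg_nonneg.mp (hx.neg.nonneg_of_none_pos (by rw [Finsupp.neg_apply]; omega)))
  · exact hx.nonneg_or_nonpos_of_none_eq_zero h
  · exact Or.inl (hx.nonneg_of_none_pos h)

lemma IsReal.not_nonneg_iff {x : Lattice b} (hx : IsReal b θ x) : ¬ 0 ≤ x ↔ x ≤ 0 :=
  ⟨hx.nonneg_or_nonpos.resolve_left, fun h h' => hx.ne_zero (le_antisymm h h')⟩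

lemma IsReal.exists_pos {x : Lattice b} (hx : IsReal b θ x) (h0 : 0 ≤ x) {i : Idx b}
    (hi : x ≠ simpleCoroot b i) : ∃ j, j ≠ i ∧ 0 < x j := by
  by_contra! hnonpos
  have hmul : x = x i • simpleCoroot b i := by
    ext j
    rcases eq_or_ne j i with rfl | hj
    · simp [simpleCoroot]
    · simpa [simpleCoroot, Finsupp.single_eq_of_ne hj] using (hnonpos j hj).antisymm (h0 j)
  have hnorm := form_self hx
  rw [hmul] at hnorm
  simp only [map_smul, LinearMap.smul_apply, smul_eq_mul,
    form_self (isReal_simple b θ i)] at hnorm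
  have hnn : 0 ≤ x i := h0 i
  have hone : x i = 1 := by nlinarith
  rw [hone, one_smul] at hmul
  exact hi hmul

lemma IsReal.simpleReflection_nonneg {x : Lattice b} (hx : IsReal b θ x) (h0 : 0 ≤ x) {i : Idx b}
    (hi : x ≠ simpleCoroot b i) : 0 ≤ AffineCS.simpleReflection b θ i x := by
  obtain ⟨j, hj, hpos⟩ := hx.exists_pos h0 hi
  refine (hx.simpleReflection i).nonneg_or_nonpos.resolve_right fun h => ?_
  have hle := h j
  rw [simpleReflection_apply_of_ne hj] at hle
  exact hle.not_gt hpos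

end Positivity

section ToLattice

variable {I : Type*}

lemma toLattice_apply (n : I →₀ ℕ) (i : I) : toLattice n i = n i := rfl

lemma toLattice_injective : Function.Injective (toLattice (I := I)) :=
  Finsupp.mapRange_injective _ Nat.cast_zero Nat.cast_injective

lemma toLattice_add (m n : I →₀ ℕ) : toLattice (m + n) = toLattice m + toLattice n :=
  Finsupp.mapRange_add Nat.cast_add m n

lemma toLattice_zero : toLattice (0 : I →₀ ℕ) = 0 := Finsupp.mapRange_zero

lemma toLattice_nonneg (n : I →₀ ℕ) : 0 ≤ toLattice n := fun i => Int.natCast_nonneg (n i)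

lemma toLattice_le_toLattice {m n : I →₀ ℕ} : toLattice m ≤ toLattice n ↔ m ≤ n := by
  simp only [Finsupp.le_def, toLattice_apply, Nat.cast_le]

/-- The coordinatewise absolute value of a lattice element: for a coroot `x`, the positive one of
`± x`. -/
def absCoords (x : I →₀ ℤ) : I →₀ ℕ := x.mapRange Int.natAbs rfl

lemma toLattice_absCoords_of_nonneg {x : I →₀ ℤ} (hx : 0 ≤ x) : toLattice (absCoords x) = x :=
  Finsupp.ext fun i => Int.natAbs_of_nonneg (hx i)

lemma absCoords_neg (x : I →₀ ℤ) : absCoords (-x) = absCoords x :=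
  Finsupp.ext fun i => Int.natAbs_neg (x i)

lemma toLattice_absCoords_of_nonpos {x : I →₀ ℤ} (hx : x ≤ 0) : toLattice (absCoords x) = -x := by
  rw [← absCoords_neg, toLattice_absCoords_of_nonneg (neg_nonneg.mpr hx)]

lemma absCoords_toLattice (n : I →₀ ℕ) : absCoords (toLattice n) = n :=
  toLattice_injective (toLattice_absCoords_of_nonneg (toLattice_nonneg n))

lemma exists_toLattice_eq {x : I →₀ ℤ} (hx : 0 ≤ x) : ∃ n, toLattice n = x :=
  ⟨absCoords x, toLattice_absCoords_of_nonneg hx⟩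

lemma toLattice_single (i : I) : toLattice (Finsupp.single i 1) = Finsupp.single i 1 := by
  rw [toLattice, Finsupp.mapRange_single, Nat.cast_one]

/-- The height of a lattice element: the sum of its coordinates. -/
def ht : (I →₀ ℤ) →ₗ[ℤ] ℤ := Finsupp.linearCombination ℤ fun _ => 1

lemma ht_toLattice (n : I →₀ ℕ) : ht (toLattice n) = n.degree := by
  induction n using Finsupp.induction_linear with
  | zero => simp [toLattice_zero]
  | add m n hm hn => simp [toLattice_add, hm, hn]
  | single i a => simp [toLattice, ht]

end ToLattice

/-! ### Length and inversions -/

section Words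

variable {ι k M N : Type*} [Field k] [CharZero k] [AddCommGroup M] [Module k M]
  [AddCommGroup N] [Module k N] {P : RootPairing ι k M N} [P.IsCrystallographic]
  {b : P.Base} {θ : ι}

lemma weyl_inv_apply_apply (w : weyl b θ) (x : Lattice b) : (w⁻¹).1 (w.1 x) = x :=
  w.1.symm_apply_apply x

lemma weyl_apply_inv_apply (w : weyl b θ) (x : Lattice b) : w.1 ((w⁻¹).1 x) = x :=
  w.1.apply_symm_apply x

lemma weyl_mul_apply (u w : weyl b θ) (x : Lattice b) : (u * w).1 x = u.1 (w.1 x) := rfl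

lemma weyl_ext {u w : weyl b θ} (h : ∀ x, u.1 x = w.1 x) : u = w :=
  Subtype.ext (LinearEquiv.ext h)

lemma gen_apply (i : Idx b) (x : Lattice b) : (gen b θ i).1 x = simpleReflection b θ i x := rfl

lemma ht_simpleReflection (i : Idx b) (x : Lattice b) :
    ht (simpleReflection b θ i x) = ht x - simplePairing b θ i x := by
  rw [simpleReflection_apply, map_sub, map_smul, simpleCoroot, ht, Finsupp.linearCombination_single,
    smul_eq_mul, smul_eq_mul, mul_one, mul_one]

lemma gen_mul_gen (i : Idx b) : gen b θ i * gen b θ i = 1 :=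
  inv_eq_iff_mul_eq_one.mp (gen_inv b θ i)

lemma mul_gen_mul_gen (u : weyl b θ) (i : Idx b) : u * gen b θ i * gen b θ i = u := by
  rw [mul_assoc, gen_mul_gen, mul_one]

lemma gen_mul_gen_mul (u : weyl b θ) (i : Idx b) : gen b θ i * (gen b θ i * u) = u := by
  rw [← mul_assoc, gen_mul_gen, one_mul]

lemma mul_gen_apply_simple (u : weyl b θ) (i : Idx b) :
    (u * gen b θ i).1 (simpleCoroot b i) = -u.1 (simpleCoroot b i) := by
  rw [weyl_mul_apply, gen_apply, simpleReflection_self, map_neg]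

lemma inv_gen_mul_apply_simple (u : weyl b θ) (i : Idx b) :
    ((gen b θ i * u)⁻¹).1 (simpleCoroot b i) = -(u⁻¹).1 (simpleCoroot b i) := by
  rw [mul_inv_rev, gen_inv, mul_gen_apply_simple]

variable (b θ) in
/-- The product of the simple reflections along a word. -/
def wprod (l : List (Idx b)) : weyl b θ := (l.map (gen b θ)).prod

@[simp] lemma wprod_nil : wprod b θ [] = 1 := rfl

@[simp] lemma wprod_cons (i : Idx b) (l : List (Idx b)) :
    wprod b θ (i :: l) = gen b θ i * wprod b θ l := by
  simp [wprod]

@[simp] lemma wprod_append (l l' : List (Idx b)) :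
    wprod b θ (l ++ l') = wprod b θ l * wprod b θ l' := by
  simp [wprod]

lemma wprod_induction {p : weyl b θ → Prop} (one : p 1)
    (mul_gen : ∀ u i, p u → p (u * gen b θ i)) (u : weyl b θ) : p u := by
  obtain ⟨l, rfl⟩ := exists_word b θ u
  change p (wprod b θ l)
  induction l using List.reverseRecOn with
  | nil => exact one
  | append_singleton l i ih =>
    rw [wprod_append, wprod_cons, wprod_nil, mul_one]
    exact mul_gen _ i ih

/-- The length of an element of the affine Weyl group. -/
def len (w : weyl b θ) : ℕ := (exists_reducedWord b θ w).choose.length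

lemma len_le_length (l : List (Idx b)) : len (wprod b θ l) ≤ l.length :=
  (exists_reducedWord b θ _).choose_spec.2 l rfl

lemma IsReducedWord.length_eq {l : List (Idx b)} {w : weyl b θ} (h : IsReducedWord b θ l w) :
    l.length = len w :=
  le_antisymm (h.2 _ (exists_reducedWord b θ w).choose_spec.1)
    ((exists_reducedWord b θ w).choose_spec.2 l h.1)

lemma IsReducedWord.wprod_eq {l : List (Idx b)} {w : weyl b θ} (h : IsReducedWord b θ l w) :
    wprod b θ l = w := h.1

lemma eq_one_of_len_eq_zero {u : weyl b θ} (h : len u = 0) : u = 1 := by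
  obtain ⟨l, hl⟩ := exists_reducedWord b θ u
  have hlength := hl.length_eq
  rw [h, List.length_eq_zero_iff] at hlength
  rw [← hl.wprod_eq, hlength, wprod_nil]

lemma isReducedWord_of_length {l : List (Idx b)} {w : weyl b θ} (hprod : wprod b θ l = w)
    (hlen : l.length = len w) : IsReducedWord b θ l w :=
  ⟨hprod, fun l' hl' => by rw [hlen, ← hl']; exact len_le_length l'⟩

lemma len_mul_le (u w : weyl b θ) : len (u * w) ≤ len u + len w := by
  obtain ⟨l, hl⟩ := exists_reducedWord b θ u
  obtain ⟨l', hl'⟩ := exists_reducedWord b θ w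
  calc len (u * w) = len (wprod b θ (l ++ l')) := by
        rw [wprod_append, hl.wprod_eq, hl'.wprod_eq]
    _ ≤ (l ++ l').length := len_le_length _
    _ = len u + len w := by rw [List.length_append, hl.length_eq, hl'.length_eq]

lemma len_gen_le (i : Idx b) : len (gen b θ i) ≤ 1 := by
  simpa using len_le_length (θ := θ) [i]

lemma IsReducedWord.of_append {l l' : List (Idx b)} {w : weyl b θ}
    (h : IsReducedWord b θ (l ++ l') w) :
    IsReducedWord b θ l (wprod b θ l) ∧ IsReducedWord b θ l' (wprod b θ l') := by
  have hlen := h.length_eq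
  rw [← h.wprod_eq, wprod_append, List.length_append] at hlen
  have hmul := len_mul_le (wprod b θ l) (wprod b θ l')
  have hl := len_le_length (θ := θ) l
  have hl' := len_le_length (θ := θ) l'
  exact ⟨isReducedWord_of_length rfl (by omega), isReducedWord_of_length rfl (by omega)⟩

lemma len_inv (u : weyl b θ) : len u⁻¹ = len u := by
  have hle (u : weyl b θ) : len u⁻¹ ≤ len u := by
    obtain ⟨l, hl⟩ := exists_reducedWord b θ u
    have hinv : (wprod b θ l)⁻¹ = wprod b θ l.reverse := by
      clear hl
      induction l with
      | nil => simp
      | cons i l ih => simp [ih, gen_inv]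
    rw [← hl.length_eq, ← hl.wprod_eq, hinv, ← List.length_reverse]
    exact len_le_length _
  exact (hle u).antisymm (by simpa using hle u⁻¹)

/-- The inversions of `u⁻¹`: the positive real coroots which `u⁻¹` makes negative. -/
def invSet (u : weyl b θ) : Set (Idx b →₀ ℕ) :=
  {n | IsReal b θ (toLattice n) ∧ ¬ 0 ≤ (u⁻¹).1 (toLattice n)}

lemma invSet_one : invSet (1 : weyl b θ) = ∅ := by
  ext m
  simp only [invSet, Set.mem_ofPred_eq, Set.mem_empty_iff_false, iff_false, not_and, not_not,
    inv_one]
  exact fun _ => toLattice_nonneg m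

lemma notMem_invSet_of_eq {u : weyl b θ} {i : Idx b} {n : Idx b →₀ ℕ}
    (hn : u.1 (simpleCoroot b i) = toLattice n) : n ∉ invSet u := by
  intro h
  apply h.2
  rw [← hn, weyl_inv_apply_apply]
  exact simpleCoroot_nonneg i

end Words

lemma finite_len_le {ι k M N : Type*} [Finite ι] [Field k] [CharZero k] [AddCommGroup M]
    [Module k M] [AddCommGroup N] [Module k N] {P : RootPairing ι k M N} [P.IsCrystallographic]
    {b : P.Base} {θ : ι} (n : ℕ) : {w : weyl b θ | len w ≤ n}.Finite := by
  refine ((List.finite_length_le (Idx b) n).image (wprod b θ)).subset fun w hw => ?_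
  obtain ⟨l, hl⟩ := exists_reducedWord b θ w
  exact ⟨l, by rwa [Set.mem_ofPred_eq, hl.length_eq], hl.wprod_eq⟩

section Length

variable {ι k M N : Type*} [Finite ι] [Field k] [CharZero k] [AddCommGroup M] [Module k M]
  [AddCommGroup N] [Module k N] {P : RootPairing ι k M N} [P.IsRootSystem] [P.IsCrystallographic]
  [P.IsReduced] {b : P.Base} {θ : ι} [hS : SimplyLacedAffine b θ]

lemma weyl_realReflection (w : weyl b θ) (x y : Lattice b) :
    w.1 (realReflection b θ x y) = realReflection b θ (w.1 x) (w.1 y) := by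
  simp [realReflection, form_weyl]

lemma mul_gen_mul_apply (u w : weyl b θ) (i : Idx b) (y : Lattice b) :
    (u * gen b θ i * w).1 y = realReflection b θ (u.1 (simpleCoroot b i)) ((u * w).1 y) := by
  rw [weyl_mul_apply u w, ← weyl_realReflection, realReflection_simple]
  rfl

lemma exists_word_of_inversion (l : List (Idx b)) {x : Lattice b} (hx : IsReal b θ x)
    (hpos : 0 ≤ x) (hl : ¬ 0 ≤ ((wprod b θ l)⁻¹).1 x) :
    ∃ l' : List (Idx b), l'.length + 1 = l.length ∧
      ∀ y, (wprod b θ l').1 y = realReflection b θ x ((wprod b θ l).1 y) := by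
  induction l generalizing x with
  | nil => exact absurd hpos (by simpa using hl)
  | cons i l ih =>
    by_cases hi : x = simpleCoroot b i
    · refine ⟨l, rfl, fun y => ?_⟩
      rw [wprod_cons, weyl_mul_apply, hi, realReflection_simple, gen_apply,
        simpleReflection_simpleReflection]
    · rw [wprod_cons, mul_inv_rev, gen_inv, weyl_mul_apply, gen_apply] at hl
      obtain ⟨l', hlength, hl'⟩ :=
        ih (hx.simpleReflection i) (hx.simpleReflection_nonneg hpos hi) hl
      refine ⟨i :: l', by simp [hlength], fun y => ?_⟩
      rw [wprod_cons, weyl_mul_apply, hl', weyl_realReflection, gen_apply,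
        simpleReflection_simpleReflection]
      rfl

lemma len_lt_of_inversion {v w : weyl b θ} {x : Lattice b} (hx : IsReal b θ x) (hpos : 0 ≤ x)
    (hw : ¬ 0 ≤ (w⁻¹).1 x) (hv : ∀ y, v.1 y = realReflection b θ x (w.1 y)) : len v < len w := by
  obtain ⟨l, hl⟩ := exists_reducedWord b θ w
  obtain ⟨l', hlength, hl'⟩ := exists_word_of_inversion l hx hpos (by rwa [hl.wprod_eq])
  have hvl' : v = wprod b θ l' := weyl_ext fun y => by rw [hv, hl', hl.wprod_eq]
  have hlen := len_le_length (θ := θ) l'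
  rw [← hvl'] at hlen
  have := hl.length_eq
  omega

lemma exists_simplePairing_pos {x : Lattice b} (hx : IsReal b θ x) (hpos : 0 ≤ x) :
    ∃ i, 0 < simplePairing b θ i x := by
  by_contra! hnonpos
  have htwo := form_self hx
  rw [form_eq_sum] at htwo
  have : (x.sum fun i a => a * simplePairing b θ i x) ≤ 0 :=
    Finset.sum_nonpos fun i _ => mul_nonpos_of_nonneg_of_nonpos (hpos i) (hnonpos i)
  omega

lemma exists_word_realReflection (n : Idx b →₀ ℕ) (hn : IsReal b θ (toLattice n)) :
    ∃ l : List (Idx b), l.length ≤ 2 * n.degree ∧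
      ∀ y, (wprod b θ l).1 y = realReflection b θ (toLattice n) y := by
  induction hd : n.degree using Nat.strong_induction_on generalizing n with
  | _ d ih =>
    obtain ⟨i, hi⟩ := exists_simplePairing_pos hn (toLattice_nonneg n)
    by_cases hni : toLattice n = simpleCoroot b i
    · have hn_single : n = Finsupp.single i 1 :=
        toLattice_injective (by rw [hni, toLattice_single]; rfl)
      refine ⟨[i], by simp [← hd, hn_single], fun y => ?_⟩
      rw [hni, realReflection_simple, wprod_cons, wprod_nil, mul_one, gen_apply]
    · obtain ⟨m, hm⟩ := exists_toLattice_eq (hn.simpleReflection_nonneg (toLattice_nonneg n) hni)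
      have hm_real : IsReal b θ (toLattice m) := hm ▸ hn.simpleReflection i
      have hm_lt : m.degree < d := by
        have h := congrArg ht hm
        rw [ht_simpleReflection, ht_toLattice, ht_toLattice, hd] at h
        omega
      obtain ⟨l, hlength, hl⟩ := ih _ hm_lt m hm_real rfl
      have hlength' : (i :: (l ++ [i])).length ≤ 2 * d := by
        rw [List.length_cons, List.length_append, List.length_singleton]
        omega
      refine ⟨i :: (l ++ [i]), hlength', fun y => ?_⟩
      rw [wprod_cons, wprod_append, weyl_mul_apply, weyl_mul_apply, hl, weyl_realReflection, hm]
      simp [gen_apply, simpleReflection_simpleReflection]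

lemma len_le_of_realReflection {v w : weyl b θ} {n : Idx b →₀ ℕ} (hn : IsReal b θ (toLattice n))
    (hv : ∀ y, v.1 y = realReflection b θ (toLattice n) (w.1 y)) :
    len v ≤ 2 * n.degree + len w := by
  obtain ⟨l, hlength, hl⟩ := exists_word_realReflection n hn
  have hvl : v = wprod b θ l * w := weyl_ext fun y => by rw [hv, weyl_mul_apply, hl]
  have hlen := len_le_length (θ := θ) l
  have hmul := len_mul_le (wprod b θ l) w
  rw [hvl]
  omega

lemma len_gen_mul_lt {u : weyl b θ} {i : Idx b} (h : ¬ 0 ≤ (u⁻¹).1 (simpleCoroot b i)) :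
    len (gen b θ i * u) + 1 = len u := by
  have hlt := len_lt_of_inversion (v := gen b θ i * u) (isReal_simple b θ i) (simpleCoroot_nonneg i)
    h fun y => by rw [realReflection_simple]; rfl
  have hle := len_mul_le (gen b θ i) (gen b θ i * u)
  rw [gen_mul_gen_mul] at hle
  have := len_gen_le (θ := θ) i
  omega

lemma len_gen_mul {u : weyl b θ} {i : Idx b} (h : 0 ≤ (u⁻¹).1 (simpleCoroot b i)) :
    len (gen b θ i * u) = len u + 1 := by
  have hneg : ¬ 0 ≤ ((gen b θ i * u)⁻¹).1 (simpleCoroot b i) := by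
    rwa [inv_gen_mul_apply_simple, ((isReal_simple b θ i).weyl u⁻¹).neg.not_nonneg_iff, neg_nonpos]
  have hlen := len_gen_mul_lt hneg
  rw [gen_mul_gen_mul] at hlen
  exact hlen.symm

lemma len_mul_gen {u : weyl b θ} {i : Idx b} (h : 0 ≤ u.1 (simpleCoroot b i)) :
    len (u * gen b θ i) = len u + 1 := by
  rw [← len_inv, mul_inv_rev, gen_inv, len_gen_mul (by rwa [inv_inv]), len_inv]

end Length

section Inversions

variable {ι k M N : Type*} [Finite ι] [Field k] [CharZero k] [AddCommGroup M] [Module k M]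
  [AddCommGroup N] [Module k N] {P : RootPairing ι k M N} [P.IsRootSystem] [P.IsCrystallographic]
  [P.IsReduced] {b : P.Base} {θ : ι} [hS : SimplyLacedAffine b θ]

lemma IsReal.simpleReflection_nonneg_iff {x : Lattice b} {i : Idx b} (hx : IsReal b θ x)
    (hne : x ≠ simpleCoroot b i) (hne' : x ≠ -simpleCoroot b i) :
    0 ≤ AffineCS.simpleReflection b θ i x ↔ 0 ≤ x := by
  refine ⟨fun h => ?_, fun h => hx.simpleReflection_nonneg h hne⟩
  rw [← simpleReflection_simpleReflection (θ := θ) i x]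
  refine (hx.simpleReflection i).simpleReflection_nonneg h fun hi => hne' ?_
  rw [← simpleReflection_simpleReflection (θ := θ) i x, hi, simpleReflection_self]

lemma invSet_mul_gen {u : weyl b θ} {i : Idx b} {n : Idx b →₀ ℕ}
    (hn : u.1 (simpleCoroot b i) = toLattice n) : invSet (u * gen b θ i) = insert n (invSet u) := by
  have hn_real : IsReal b θ (toLattice n) := hn ▸ (isReal_simple b θ i).weyl u
  ext m
  simp only [invSet, Set.mem_insert_iff, Set.mem_ofPred_eq, mul_inv_rev, gen_inv, weyl_mul_apply,
    gen_apply]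
  by_cases hmn : m = n
  · subst hmn
    simp only [true_or, iff_true]
    refine ⟨hn_real, ?_⟩
    rw [← hn, weyl_inv_apply_apply, simpleReflection_self,
      (isReal_simple b θ i).neg.not_nonneg_iff, neg_nonpos]
    exact simpleCoroot_nonneg i
  · simp only [hmn, false_or]
    refine and_congr_right fun hm_real => not_congr ?_
    refine (hm_real.weyl u⁻¹).simpleReflection_nonneg_iff (fun h => hmn ?_) fun h => ?_
    · exact toLattice_injective (by rw [← weyl_apply_inv_apply u (toLattice m), h, hn])
    · have hneg : toLattice m = -toLattice n := by
        rw [← weyl_apply_inv_apply u (toLattice m), h, map_neg, hn]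
      have hn_nonpos : toLattice n ≤ 0 := by
        rw [← neg_nonneg, ← hneg]
        exact toLattice_nonneg m
      exact hn_real.ne_zero (hn_nonpos.antisymm (toLattice_nonneg n))

lemma exists_weyl_simple_eq (u : weyl b θ) (i : Idx b) :
    ∃ n : Idx b →₀ ℕ, u.1 (simpleCoroot b i) = toLattice n ∨
      (u * gen b θ i).1 (simpleCoroot b i) = toLattice n := by
  rcases ((isReal_simple b θ i).weyl u).nonneg_or_nonpos with h | h
  · obtain ⟨n, hn⟩ := exists_toLattice_eq h
    exact ⟨n, Or.inl hn.symm⟩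
  · obtain ⟨n, hn⟩ := exists_toLattice_eq (neg_nonneg.mpr h)
    exact ⟨n, Or.inr (by rw [mul_gen_apply_simple, hn])⟩

lemma invSet_finite (u : weyl b θ) : (invSet u).Finite := by
  induction u using wprod_induction with
  | one => rw [invSet_one]; exact Set.finite_empty
  | mul_gen u i ih =>
    obtain ⟨n, hn | hn⟩ := exists_weyl_simple_eq u i
    · rw [invSet_mul_gen hn]
      exact ih.insert n
    · have h := invSet_mul_gen hn
      rw [mul_gen_mul_gen] at h
      exact ih.subset (h ▸ Set.subset_insert _ _)

lemma ncard_invSet (u : weyl b θ) : (invSet u).ncard = len u := by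
  induction u using wprod_induction with
  | one =>
    rw [invSet_one, Set.ncard_empty]
    exact (Nat.le_zero.mp (len_le_length (θ := θ) [])).symm
  | mul_gen u i ih =>
    have hcard {u : weyl b θ} {n} (hn : u.1 (simpleCoroot b i) = toLattice n) :
        (invSet (u * gen b θ i)).ncard = (invSet u).ncard + 1 := by
      rw [invSet_mul_gen hn,
        Set.ncard_insert_of_notMem (notMem_invSet_of_eq hn) (invSet_finite _)]
    have hlen {u : weyl b θ} {n} (hn : u.1 (simpleCoroot b i) = toLattice n) :
        len (u * gen b θ i) = len u + 1 :=
      len_mul_gen (hn ▸ toLattice_nonneg n)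
    obtain ⟨n, hn | hn⟩ := exists_weyl_simple_eq u i
    · rw [hcard hn, hlen hn, ih]
    · have hc := hcard hn
      have hl := hlen hn
      rw [mul_gen_mul_gen] at hc hl
      omega

end Inversions

/-! ### Braid relations -/

lemma inv_one_sub_inv {K : Type*} [Field K] {a : K} (ha : a ≠ 0) :
    (1 - a⁻¹)⁻¹ = -(a / (1 - a)) := by
  have h : 1 - a⁻¹ = -((1 - a) / a) := by
    field_simp
    ring
  rw [h, inv_neg, inv_div]

section RatFun

variable {I : Type*}

lemma rexp_add (x y : I →₀ ℤ) : rexp (x + y) = rexp x * rexp y := by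
  rw [rexp, rexp, rexp, ← map_mul, AddMonoidAlgebra.single_mul_single, mul_one]

lemma rexp_zero : rexp (0 : I →₀ ℤ) = 1 := by
  rw [rexp]
  exact map_one _

lemma rexp_neg_mul (x : I →₀ ℤ) : rexp (-x) * rexp x = 1 := by
  rw [← rexp_add, neg_add_cancel, rexp_zero]

lemma rexp_ne_zero (x : I →₀ ℤ) : rexp x ≠ 0 :=
  right_ne_zero_of_mul_eq_one (rexp_neg_mul x)

lemma rexp_neg (x : I →₀ ℤ) : rexp (-x) = (rexp x)⁻¹ :=
  eq_inv_of_mul_eq_one_left (rexp_neg_mul x)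

lemma rexp_injective : Function.Injective (rexp (I := I)) := by
  intro x y h
  have hsingle := IsFractionRing.injective (Laurent I) (RatFun I) h
  by_contra hxy
  simpa [Finsupp.single_eq_of_ne hxy] using congrArg (fun p => p.coeff x) hsingle

lemma one_sub_rexp_ne_zero {x : I →₀ ℤ} (hx : x ≠ 0) : 1 - rexp x ≠ 0 := by
  rw [sub_ne_zero, ← rexp_zero]
  exact fun h => hx (rexp_injective h).symm

lemma smul_algebraMap_laurent (g : (I →₀ ℤ) ≃ₗ[ℤ] (I →₀ ℤ)) (p : Laurent I) :
    g • algebraMap (Laurent I) (RatFun I) p = algebraMap (Laurent I) (RatFun I) (g • p) := by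
  change IsFractionRing.ringEquivOfRingEquiv _ _ = _
  rw [IsFractionRing.ringEquivOfRingEquiv_algebraMap]
  rfl

lemma smul_single_laurent (g : (I →₀ ℤ) ≃ₗ[ℤ] (I →₀ ℤ)) (x : I →₀ ℤ) (r : ℂ[X]) :
    g • (AddMonoidAlgebra.single x r : Laurent I) = AddMonoidAlgebra.single (g x) r := by
  change AddMonoidAlgebra.domCongr ℂ[X] ℂ[X] g.toAddEquiv _ = _
  rw [AddMonoidAlgebra.domCongr_single]
  rfl

lemma coeff_smul_laurent (g : (I →₀ ℤ) ≃ₗ[ℤ] (I →₀ ℤ)) (p : Laurent I) (x : I →₀ ℤ) :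
    (g • p).coeff (g x) = p.coeff x := by
  change (AddMonoidAlgebra.domCongr ℂ[X] ℂ[X] g.toAddEquiv p).coeff (g x) = _
  rw [AddMonoidAlgebra.coeff_domCongr]
  exact congrArg p.coeff (g.symm_apply_apply x)

lemma smul_rexp (g : (I →₀ ℤ) ≃ₗ[ℤ] (I →₀ ℤ)) (x : I →₀ ℤ) : g • rexp x = rexp (g x) := by
  rw [rexp, smul_algebraMap_laurent, smul_single_laurent, rexp]

lemma smul_vinv (g : (I →₀ ℤ) ≃ₗ[ℤ] (I →₀ ℤ)) : g • (vinv : RatFun I) = vinv := by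
  rw [vinv, smul_algebraMap_laurent, smul_single_laurent, map_zero]

lemma smul_cFun (g : (I →₀ ℤ) ≃ₗ[ℤ] (I →₀ ℤ)) (x : I →₀ ℤ) : g • cFun x = cFun (g x) := by
  simp only [cFun, div_eq_mul_inv, smul_mul', smul_inv'', smul_sub, smul_one, smul_rexp, smul_vinv,
    map_neg]

lemma smul_bFun (g : (I →₀ ℤ) ≃ₗ[ℤ] (I →₀ ℤ)) (x : I →₀ ℤ) : g • bFun x = bFun (g x) := by
  simp only [bFun, div_eq_mul_inv, smul_mul', smul_inv'', smul_sub, smul_one, smul_rexp, smul_vinv]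

lemma inv_one_sub_rexp_neg (x : I →₀ ℤ) : (1 - rexp (-x))⁻¹ = -(rexp x / (1 - rexp x)) := by
  rw [rexp_neg, inv_one_sub_inv (rexp_ne_zero x)]

lemma bFun_braid {x y : I →₀ ℤ} (hx : x ≠ 0) (hy : y ≠ 0) (hxy : x + y ≠ 0) :
    bFun (x + y) * bFun (-x) + bFun x * bFun y = bFun y * bFun (x + y) := by
  have hx' := one_sub_rexp_ne_zero hx
  have hy' := one_sub_rexp_ne_zero hy
  have hxy' := one_sub_rexp_ne_zero hxy
  rw [rexp_add] at hxy'
  simp only [bFun, div_eq_mul_inv, inv_one_sub_rexp_neg, rexp_add]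
  field_simp
  ring

lemma cFun_bFun_braid {x y : I →₀ ℤ} (hx : x ≠ 0) (hy : y ≠ 0) (hxy : x + y ≠ 0) :
    cFun x * bFun (x + y) * cFun (-x) + bFun x * bFun y * bFun x =
      cFun y * bFun (x + y) * cFun (-y) + bFun y * bFun x * bFun y := by
  have hx0 := rexp_ne_zero x
  have hy0 := rexp_ne_zero y
  have hx' := one_sub_rexp_ne_zero hx
  have hy' := one_sub_rexp_ne_zero hy
  have hxy' := one_sub_rexp_ne_zero hxy
  rw [rexp_add] at hxy'
  simp only [bFun, cFun, div_eq_mul_inv, inv_one_sub_rexp_neg, neg_neg]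
  simp only [rexp_neg, rexp_add]
  field_simp
  ring

end RatFun

section DemazureLusztig

variable {ι k M N : Type*} [Field k] [CharZero k] [AddCommGroup M] [Module k M]
  [AddCommGroup N] [Module k N] {P : RootPairing ι k M N} [P.IsCrystallographic]
  {b : P.Base} {θ : ι}

lemma weyl_smul_cFun (w : weyl b θ) (x : Lattice b) : w • cFun x = cFun (w.1 x) := smul_cFun w.1 x

lemma weyl_smul_bFun (w : weyl b θ) (x : Lattice b) : w • bFun x = bFun (w.1 x) := smul_bFun w.1 x

lemma wordT_cons (i : Idx b) (l : List (Idx b)) :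
    wordT b θ (i :: l) = simpleT b θ i * wordT b θ l := by
  simp [wordT]

lemma wordT_append_singleton (l : List (Idx b)) (i : Idx b) :
    wordT b θ (l ++ [i]) = wordT b θ l * simpleT b θ i := by
  simp [wordT]

lemma inv_gen_mul_apply (u : weyl b θ) (i : Idx b) (x : Lattice b) :
    ((gen b θ i * u)⁻¹).1 x = (u⁻¹).1 (simpleReflection b θ i x) := by
  rw [mul_inv_rev, gen_inv, weyl_mul_apply, gen_apply]

lemma IsReducedWord.tail {i : Idx b} {l : List (Idx b)} {w : weyl b θ}
    (hl : IsReducedWord b θ (i :: l) w) : IsReducedWord b θ l (gen b θ i * w) := by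
  rw [← hl.wprod_eq, wprod_cons, gen_mul_gen_mul]
  exact (IsReducedWord.of_append (l := [i]) hl).2

variable {i j : Idx b}

lemma simpleReflection_simple_of_eq_zero (h : simplePairing b θ i (simpleCoroot b j) = 0) :
    simpleReflection b θ i (simpleCoroot b j) = simpleCoroot b j := by
  rw [simpleReflection_apply, h, zero_smul, sub_zero]

lemma simpleReflection_simple_of_eq_neg_one
    (h : simplePairing b θ i (simpleCoroot b j) = -1) :
    simpleReflection b θ i (simpleCoroot b j) = simpleCoroot b i + simpleCoroot b j := by
  rw [simpleReflection_apply, h]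
  module

end DemazureLusztig

section Braid

variable {ι k M N : Type*} [Finite ι] [Field k] [CharZero k] [AddCommGroup M] [Module k M]
  [AddCommGroup N] [Module k N] {P : RootPairing ι k M N} [P.IsRootSystem] [P.IsCrystallographic]
  [P.IsReduced] {b : P.Base} {θ : ι} [hS : SimplyLacedAffine b θ] {i j : Idx b}

open SkewMonoidAlgebra

variable (θ) in
lemma simplePairing_simple_comm (i j : Idx b) : simplePairing b θ i (simpleCoroot b j) =
    simplePairing b θ j (simpleCoroot b i) := by
  rw [← form_simple, ← form_simple, form_comm]

lemma gen_comm (h : simplePairing b θ i (simpleCoroot b j) = 0) :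
    gen b θ i * gen b θ j = gen b θ j * gen b θ i := by
  refine weyl_ext fun x => ?_
  have h' := simplePairing_simple_comm θ i j
  simp only [weyl_mul_apply, gen_apply, simpleReflection_apply, map_sub, map_smul, ← h', h]
  module

lemma gen_braid (h : simplePairing b θ i (simpleCoroot b j) = -1) :
    gen b θ i * gen b θ j * gen b θ i = gen b θ j * gen b θ i * gen b θ j := by
  refine weyl_ext fun x => ?_
  have h' := simplePairing_simple_comm θ i j
  simp only [weyl_mul_apply, gen_apply, simpleReflection_apply, map_sub, map_smul, ← h', h,
    simplePairing_self]
  module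

lemma simpleT_comm (h : simplePairing b θ i (simpleCoroot b j) = 0) :
    simpleT b θ i * simpleT b θ j = simpleT b θ j * simpleT b θ i := by
  have hij := simpleReflection_simple_of_eq_zero h
  have hji := simpleReflection_simple_of_eq_zero ((simplePairing_simple_comm θ j i).trans h)
  simp only [simpleT, mul_add, add_mul, single_mul_single, weyl_smul_cFun, weyl_smul_bFun,
    gen_apply, hij, hji, one_smul, mul_one, one_mul, gen_comm h]
  rw [mul_comm (cFun (simpleCoroot b i)), mul_comm (bFun (simpleCoroot b i)),
    mul_comm (bFun (simpleCoroot b i)), mul_comm (cFun (simpleCoroot b i))]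
  abel

-- The right-hand side is symmetric in `i` and `j`, by `gen_braid` and `cFun_bFun_braid`.
lemma simpleT_mul_mul (h : simplePairing b θ i (simpleCoroot b j) = -1) :
    simpleT b θ i * simpleT b θ j * simpleT b θ i =
      single (gen b θ i * gen b θ j * gen b θ i) (cFun (simpleCoroot b i) *
        cFun (simpleCoroot b j) * cFun (simpleCoroot b i + simpleCoroot b j)) +
      single (gen b θ i * gen b θ j) (cFun (simpleCoroot b i) *
        bFun (simpleCoroot b j) * cFun (simpleCoroot b i + simpleCoroot b j)) +
      single (gen b θ j * gen b θ i) (cFun (simpleCoroot b j) *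
        bFun (simpleCoroot b i) * cFun (simpleCoroot b i + simpleCoroot b j)) +
      single (gen b θ i) (cFun (simpleCoroot b i) *
        bFun (simpleCoroot b j) * bFun (simpleCoroot b i + simpleCoroot b j)) +
      single (gen b θ j) (cFun (simpleCoroot b j) *
        bFun (simpleCoroot b i) * bFun (simpleCoroot b i + simpleCoroot b j)) +
      single 1 (cFun (simpleCoroot b i) * bFun (simpleCoroot b i + simpleCoroot b j) *
        cFun (-simpleCoroot b i) + bFun (simpleCoroot b i) * bFun (simpleCoroot b j) *
          bFun (simpleCoroot b i)) := by
  have hij := simpleReflection_simple_of_eq_neg_one h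
  have hji := simpleReflection_simple_of_eq_neg_one ((simplePairing_simple_comm θ j i).trans h)
  rw [add_comm] at hji
  have hb := bFun_braid (simpleCoroot_ne_zero i) (simpleCoroot_ne_zero j)
    (simpleCoroot_add_ne_zero i j)
  have hsingle : single (gen b θ i) (cFun (simpleCoroot b i) *
        bFun (simpleCoroot b j) * bFun (simpleCoroot b i + simpleCoroot b j)) =
      single (gen b θ i) (cFun (simpleCoroot b i) * bFun (simpleCoroot b i + simpleCoroot b j) *
        bFun (-simpleCoroot b i)) + single (gen b θ i) (bFun (simpleCoroot b i) *
          bFun (simpleCoroot b j) * cFun (simpleCoroot b i)) := by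
    rw [← single_add]
    congr 1
    rw [mul_assoc, ← hb]
    ring
  simp only [simpleT, mul_add, add_mul, single_mul_single, weyl_smul_cFun, weyl_smul_bFun,
    gen_apply, weyl_mul_apply, hij, hji, simpleReflection_self, map_add, one_smul, mul_one,
    one_mul, gen_mul_gen, single_add]
  rw [neg_add_cancel_left, hsingle, mul_right_comm (cFun (simpleCoroot b i)) (cFun _),
    mul_right_comm (cFun (simpleCoroot b i)) (bFun (simpleCoroot b j)),
    mul_comm (cFun (simpleCoroot b j)) (bFun (simpleCoroot b i))]
  abel

lemma simpleT_braid (h : simplePairing b θ i (simpleCoroot b j) = -1) :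
    simpleT b θ i * simpleT b θ j * simpleT b θ i =
      simpleT b θ j * simpleT b θ i * simpleT b θ j := by
  have hc := cFun_bFun_braid (simpleCoroot_ne_zero i) (simpleCoroot_ne_zero j)
    (simpleCoroot_add_ne_zero i j)
  rw [simpleT_mul_mul h, simpleT_mul_mul ((simplePairing_simple_comm θ j i).trans h), hc,
    gen_braid h, add_comm (simpleCoroot b j) (simpleCoroot b i),
    mul_comm (cFun (simpleCoroot b j)) (cFun (simpleCoroot b i))]
  abel

end Braid

section Matsumoto

variable {ι k M N : Type*} [Finite ι] [Field k] [CharZero k] [AddCommGroup M] [Module k M]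
  [AddCommGroup N] [Module k N] {P : RootPairing ι k M N} [P.IsRootSystem] [P.IsCrystallographic]
  [P.IsReduced] {b : P.Base} {θ : ι} [hS : SimplyLacedAffine b θ]

variable (θ) in
lemma simplePairing_simple_nonpos {i j : Idx b} (hij : i ≠ j) :
    simplePairing b θ i (simpleCoroot b j) ≤ 0 := by
  have hne : simpleCoroot b j ≠ simpleCoroot b i :=
    fun h => hij (Finsupp.single_left_injective one_ne_zero h).symm
  have h := (isReal_simple b θ j).simpleReflection_nonneg (simpleCoroot_nonneg j) hne i
  rw [simpleReflection_apply] at h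
  simpa [simpleCoroot, Finsupp.single_eq_of_ne hij] using h

lemma finPart_add_eq_zero_of_simplePairing_le {i j : Idx b}
    (h : simplePairing b θ i (simpleCoroot b j) ≤ -2) :
    finPart b θ (simpleCoroot b i + simpleCoroot b j) = 0 := by
  have hpair (i j : Idx b) :
      P.pairingIn ℤ (node b θ i) (node b θ j) = simplePairing b θ i (simpleCoroot b j) := by
    simp [simplePairing, simpleCoroot]
  have hmem := P.pairingIn_pairingIn_mem_set_of_isCrystal_of_isRed (node b θ i) (node b θ j)
  simp only [hpair, simplePairing_simple_comm θ j i, Set.mem_insert_iff, Prod.mk.injEq,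
    Set.mem_singleton_iff] at hmem
  have hpair_eq (i' j' : Idx b) (h : simplePairing b θ i' (simpleCoroot b j') = -2) :
      P.pairing (node b θ i') (node b θ j') = -2 := by
    rw [← P.algebraMap_pairingIn ℤ, hpair, h]
    simp
  have hcoroot : P.coroot (node b θ i) = -P.coroot (node b θ j) :=
    (P.flip.pairing_neg_two_neg_two_iff (node b θ i) (node b θ j)).mp
      ⟨hpair_eq j i (by rw [simplePairing_simple_comm]; omega), hpair_eq i j (by omega)⟩
  rw [map_add, finPart_simple, finPart_simple, hcoroot, neg_add_cancel]

-- Two simple coroots pairing to `-2` add up to an imaginary one, which `w⁻¹` fixes, so `w⁻¹` cannot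
-- make both negative.
lemma simplePairing_eq_of_descents {i j : Idx b} (hij : i ≠ j) {w : weyl b θ}
    (hi : ¬ 0 ≤ (w⁻¹).1 (simpleCoroot b i)) (hj : ¬ 0 ≤ (w⁻¹).1 (simpleCoroot b j)) :
    simplePairing b θ i (simpleCoroot b j) = 0 ∨ simplePairing b θ i (simpleCoroot b j) = -1 := by
  have hnonpos := simplePairing_simple_nonpos θ hij
  suffices -2 < simplePairing b θ i (simpleCoroot b j) by omega
  by_contra! hle
  have hfix := weyl_apply_of_finPart_eq_zero w⁻¹ (finPart_add_eq_zero_of_simplePairing_le hle)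
  have hsum : simpleCoroot b i + simpleCoroot b j ≤ 0 := by
    rw [← hfix, map_add]
    exact add_nonpos (((isReal_simple b θ i).weyl w⁻¹).not_nonneg_iff.mp hi)
      (((isReal_simple b θ j).weyl w⁻¹).not_nonneg_iff.mp hj)
  simpa [simpleCoroot, Finsupp.single_eq_of_ne hij] using hsum i

lemma IsReducedWord.cons {i : Idx b} {l : List (Idx b)} {w : weyl b θ}
    (hl : IsReducedWord b θ l (gen b θ i * w)) (h : ¬ 0 ≤ (w⁻¹).1 (simpleCoroot b i)) :
    IsReducedWord b θ (i :: l) w :=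
  isReducedWord_of_length (by rw [wprod_cons, hl.wprod_eq, gen_mul_gen_mul])
    (by rw [List.length_cons, hl.length_eq, len_gen_mul_lt h])

lemma IsReducedWord.not_nonneg {i : Idx b} {l : List (Idx b)} {w : weyl b θ}
    (hl : IsReducedWord b θ (i :: l) w) : ¬ 0 ≤ (w⁻¹).1 (simpleCoroot b i) := by
  intro h
  have hlen := hl.length_eq
  have htail := hl.tail.length_eq
  rw [len_gen_mul h] at htail
  rw [List.length_cons] at hlen
  omega

lemma exists_isReducedWord_of_commute {i j : Idx b} {w : weyl b θ}
    (h : simplePairing b θ i (simpleCoroot b j) = 0)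
    (hi : ¬ 0 ≤ (w⁻¹).1 (simpleCoroot b i)) (hj : ¬ 0 ≤ (w⁻¹).1 (simpleCoroot b j)) :
    ∃ m, IsReducedWord b θ (j :: m) (gen b θ i * w) ∧
      IsReducedWord b θ (i :: m) (gen b θ j * w) := by
  have hij := simpleReflection_simple_of_eq_zero h
  have hji := simpleReflection_simple_of_eq_zero ((simplePairing_simple_comm θ j i).trans h)
  obtain ⟨m, hm⟩ := exists_reducedWord b θ (gen b θ j * (gen b θ i * w))
  have hm' : IsReducedWord b θ m (gen b θ i * (gen b θ j * w)) := by
    rwa [← mul_assoc, gen_comm h, mul_assoc]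
  exact ⟨m, hm.cons (by rwa [inv_gen_mul_apply, hij]),
    hm'.cons (by rwa [inv_gen_mul_apply, hji])⟩

lemma exists_isReducedWord_of_braid {i j : Idx b} {w : weyl b θ}
    (h : simplePairing b θ i (simpleCoroot b j) = -1)
    (hi : ¬ 0 ≤ (w⁻¹).1 (simpleCoroot b i)) (hj : ¬ 0 ≤ (w⁻¹).1 (simpleCoroot b j)) :
    ∃ m, IsReducedWord b θ (j :: i :: m) (gen b θ i * w) ∧
      IsReducedWord b θ (i :: j :: m) (gen b θ j * w) := by
  have hij := simpleReflection_simple_of_eq_neg_one h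
  have hji := simpleReflection_simple_of_eq_neg_one ((simplePairing_simple_comm θ j i).trans h)
  have hi_real := isReal_simple b θ i
  have hj_real := isReal_simple b θ j
  have hsum : ¬ 0 ≤ (w⁻¹).1 (simpleCoroot b i + simpleCoroot b j) := by
    have hreal : IsReal b θ (simpleCoroot b i + simpleCoroot b j) :=
      hij ▸ hj_real.simpleReflection i
    rw [(hreal.weyl w⁻¹).not_nonneg_iff, map_add]
    exact add_nonpos ((hi_real.weyl w⁻¹).not_nonneg_iff.mp hi)
      ((hj_real.weyl w⁻¹).not_nonneg_iff.mp hj)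
  obtain ⟨m, hm⟩ := exists_reducedWord b θ (gen b θ i * (gen b θ j * (gen b θ i * w)))
  have hm' : IsReducedWord b θ m (gen b θ j * (gen b θ i * (gen b θ j * w))) := by
    rwa [← mul_assoc, ← mul_assoc, ← gen_braid h, mul_assoc, mul_assoc]
  refine ⟨m, (hm.cons ?_).cons ?_, (hm'.cons ?_).cons ?_⟩
  · rwa [inv_gen_mul_apply, hji, inv_gen_mul_apply, map_add, simpleReflection_self, hij,
      add_neg_cancel_comm]
  · rwa [inv_gen_mul_apply, hij]
  · rwa [inv_gen_mul_apply, hij, inv_gen_mul_apply, map_add, simpleReflection_self, hji,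
      add_neg_cancel_comm]
  · rwa [inv_gen_mul_apply, hji, add_comm]

lemma wordT_eq_of_isReducedWord {w : weyl b θ} {l l' : List (Idx b)}
    (hl : IsReducedWord b θ l w) (hl' : IsReducedWord b θ l' w) :
    wordT b θ l = wordT b θ l' := by
  induction hn : len w using Nat.strong_induction_on generalizing w l l' with
  | _ n ih =>
    have hlen : l.length = l'.length := hl.length_eq.trans hl'.length_eq.symm
    match l, l' with
    | [], [] => rfl
    | i :: l, j :: l' =>
      have hi := hl.not_nonneg
      have hj := hl'.not_nonneg
      have hi_lt : len (gen b θ i * w) < n := by have := len_gen_mul_lt hi; omega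
      have hj_lt : len (gen b θ j * w) < n := by have := len_gen_mul_lt hj; omega
      rw [wordT_cons, wordT_cons]
      by_cases hij : i = j
      · subst hij
        rw [ih _ hi_lt hl.tail hl'.tail rfl]
      rcases simplePairing_eq_of_descents hij hi hj with h | h
      · obtain ⟨m, hm, hm'⟩ := exists_isReducedWord_of_commute h hi hj
        rw [ih _ hi_lt hl.tail hm rfl, ih _ hj_lt hl'.tail hm' rfl, wordT_cons, wordT_cons,
          ← mul_assoc, ← mul_assoc, simpleT_comm h]
      · obtain ⟨m, hm, hm'⟩ := exists_isReducedWord_of_braid h hi hj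
        rw [ih _ hi_lt hl.tail hm rfl, ih _ hj_lt hl'.tail hm' rfl]
        simp only [wordT_cons, ← mul_assoc, simpleT_braid h]

lemma wordT_eq_elemT {w : weyl b θ} {l : List (Idx b)} (hl : IsReducedWord b θ l w) :
    wordT b θ l = elemT b θ w :=
  wordT_eq_of_isReducedWord hl (exists_reducedWord b θ w).choose_spec

lemma elemT_gen_mul {w : weyl b θ} {i : Idx b} (h : 0 ≤ (w⁻¹).1 (simpleCoroot b i)) :
    elemT b θ (gen b θ i * w) = simpleT b θ i * elemT b θ w := by
  obtain ⟨l, hl⟩ := exists_reducedWord b θ w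
  rw [← wordT_eq_elemT hl, ← wordT_cons]
  refine (wordT_eq_elemT (isReducedWord_of_length ?_ ?_)).symm
  · rw [wprod_cons, hl.wprod_eq]
  · rw [List.length_cons, hl.length_eq, len_gen_mul h]

end Matsumoto

/-! ### Expansion of the coefficients as sums over paths -/

section Series

variable {I : Type*}

/-- The monomial `e^{-n}`. -/
def mono (n : I →₀ ℕ) : Qfin I := MvPowerSeries.monomial n 1

/-- The parameter `v⁻¹` as a constant series. -/
def vinvSeries : Qfin I := MvPowerSeries.C X

/-- The geometric series `(1 - e^{-n})⁻¹`, for `n ≠ 0`. -/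
def geom (n : I →₀ ℕ) : Qfin I := MvPowerSeries.invOfUnit (1 - mono n) 1

lemma mono_ne_zero (n : I →₀ ℕ) : mono n ≠ 0 := fun h => by
  classical
  have hcoeff := congrArg (MvPowerSeries.coeff n) h
  simp [mono] at hcoeff

lemma one_sub_mono_mul_geom {n : I →₀ ℕ} (hn : n ≠ 0) : (1 - mono n) * geom n = 1 := by
  classical
  refine MvPowerSeries.mul_invOfUnit _ _ ?_
  rw [map_sub, map_one, mono, ← MvPowerSeries.coeff_zero_eq_constantCoeff_apply,
    MvPowerSeries.coeff_monomial, if_neg hn.symm, sub_zero, Units.val_one]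

lemma le_of_coeff_mono_mul_ne_zero {m n : I →₀ ℕ} {f : Qfin I}
    (h : MvPowerSeries.coeff m (mono n * f) ≠ 0) : n ≤ m := by
  by_contra hnm
  rw [mono, MvPowerSeries.coeff_monomial_mul, if_neg hnm] at h
  exact h rfl

lemma exists_coeff_ne_zero_of_mul {n : I →₀ ℕ} {f g : Qfin I}
    (h : MvPowerSeries.coeff n (f * g) ≠ 0) : ∃ m₁ m₂, m₁ + m₂ = n ∧
      MvPowerSeries.coeff m₁ f ≠ 0 ∧ MvPowerSeries.coeff m₂ g ≠ 0 := by
  classical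
  rw [MvPowerSeries.coeff_mul] at h
  obtain ⟨p, hp, hcoeff⟩ := Finset.exists_ne_zero_of_sum_ne_zero h
  exact ⟨p.1, p.2, Finset.HasAntidiagonal.mem_antidiagonal.mp hp, left_ne_zero_of_mul hcoeff,
    right_ne_zero_of_mul hcoeff⟩

lemma laurentToFrac_single (x : I →₀ ℤ) (r : ℂ[X]) :
    laurentToFrac (AddMonoidAlgebra.single x r) = r • expo (Multiplicative.ofAdd x) :=
  AddMonoidAlgebra.lift_single _ _ _

lemma ratToFrac_algebraMap (p : Laurent I) :
    ratToFrac (algebraMap (Laurent I) (RatFun I) p) = laurentToFrac p :=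
  IsFractionRing.lift_algebraMap _ _

lemma expo_neg_toLattice (n : I →₀ ℕ) : expo (Multiplicative.ofAdd (-toLattice n)) =
    algebraMap (Qfin I) (FractionRing (Qfin I)) (mono n) := by
  have hexpo := expo_mul_pow (-toLattice n) 0 n.support
    (fun i hi => by simpa [toLattice_apply] using hi) (fun i => by simp [toLattice_apply])
  simp only [pow_zero, Finset.prod_const_one, mul_one] at hexpo
  have hexponent :
      (Finsupp.indicator n.support fun i _ => (((0 : ℕ) : ℤ) - (-toLattice n) i).toNat) = n := by
    ext i
    by_cases hi : i ∈ n.support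
    · simp [Finsupp.indicator_of_mem hi, toLattice_apply]
    · rw [Finsupp.indicator_of_notMem hi, Finsupp.notMem_support_iff.mp hi]
  rw [hexpo, mono, hexponent]

lemma expands_rexp (n : I →₀ ℕ) : Expands (rexp (-toLattice n)) (mono n) := by
  rw [Expands, rexp, ratToFrac_algebraMap, laurentToFrac_single, expo_neg_toLattice, one_smul]

lemma expands_vinv : Expands (vinv : RatFun I) vinvSeries := by
  rw [Expands, vinv, ratToFrac_algebraMap, laurentToFrac_single, ofAdd_zero, map_one, vinvSeries,
    Algebra.smul_def, mul_one, IsScalarTower.algebraMap_apply ℂ[X] (Qfin I)]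
  rfl

lemma expands_one : Expands (1 : RatFun I) 1 := by
  rw [Expands, map_one, map_one]

lemma expands_zero : Expands (0 : RatFun I) 0 := by
  rw [Expands, map_zero, map_zero]

section Ring

variable {f f' : RatFun I} {g g' : Qfin I}

lemma Expands.add (h : Expands f g) (h' : Expands f' g') : Expands (f + f') (g + g') := by
  rw [Expands, map_add, map_add, h, h']

lemma Expands.sub (h : Expands f g) (h' : Expands f' g') : Expands (f - f') (g - g') := by
  rw [Expands, map_sub, map_sub, h, h']

lemma Expands.neg (h : Expands f g) : Expands (-f) (-g) := by
  rw [Expands, map_neg, map_neg, h]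

lemma Expands.mul (h : Expands f g) (h' : Expands f' g') : Expands (f * f') (g * g') := by
  rw [Expands, map_mul, map_mul, h, h']

lemma Expands.unique (h : Expands f g) (h' : Expands f g') : g = g' :=
  IsFractionRing.injective (Qfin I) (FractionRing (Qfin I)) (h.symm.trans h')

lemma Expands.expansion (h : Expands f g) : Expands f (expansion f) := by
  have hexists : ∃ g, Expands f g := ⟨g, h⟩
  rw [AffineCS.expansion, dif_pos hexists]
  exact hexists.choose_spec

lemma Expands.expansion_eq (h : Expands f g) : AffineCS.expansion f = g :=
  h.expansion.unique h

lemma Expands.of_mul_left (h : Expands f g) (hg : g ≠ 0) (hmul : Expands (f * f') (g * g')) :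
    Expands f' g' := by
  rw [Expands, map_mul, map_mul, h] at hmul
  exact mul_left_cancel₀ ((map_ne_zero_iff _
    (IsFractionRing.injective (Qfin I) (FractionRing (Qfin I)))).mpr hg) hmul

lemma Expands.ne_zero (h : Expands f g) (hg : g ≠ 0) : f ≠ 0 := by
  rintro rfl
  exact hg (h.unique expands_zero)

lemma Expands.inv (h : Expands f g) (hg : g * g' = 1) : Expands f⁻¹ g' := by
  have hg0 := left_ne_zero_of_mul_eq_one hg
  refine h.of_mul_left hg0 ?_
  rw [hg, mul_inv_cancel₀ (h.ne_zero hg0)]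
  exact expands_one

end Ring

variable {n : I →₀ ℕ}

lemma expands_inv_one_sub_rexp_neg (hn : n ≠ 0) :
    Expands (1 - rexp (-toLattice n))⁻¹ (geom n) :=
  (expands_one.sub (expands_rexp n)).inv (one_sub_mono_mul_geom hn)

lemma expands_inv_one_sub_rexp (hn : n ≠ 0) :
    Expands (1 - rexp (toLattice n))⁻¹ (-mono n * geom n) := by
  have hinv := inv_one_sub_rexp_neg (-toLattice n)
  rw [neg_neg, div_eq_mul_inv, ← neg_mul] at hinv
  rw [hinv]
  exact (expands_rexp n).neg.mul (expands_inv_one_sub_rexp_neg hn)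

lemma expands_bFun (hn : n ≠ 0) :
    Expands (bFun (toLattice n)) ((1 - vinvSeries) * mono n * geom n) := by
  have hsign : (1 - vinvSeries) * mono n * geom n = (vinvSeries - 1) * (-mono n * geom n) := by
    ring
  rw [bFun, div_eq_mul_inv, hsign]
  exact (expands_vinv.sub expands_one).mul (expands_inv_one_sub_rexp hn)

lemma expands_bFun_neg (hn : n ≠ 0) :
    Expands (bFun (-toLattice n)) (-(1 - vinvSeries) * geom n) := by
  rw [bFun, div_eq_mul_inv, neg_sub]
  exact (expands_vinv.sub expands_one).mul (expands_inv_one_sub_rexp_neg hn)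

lemma expands_cFun (hn : n ≠ 0) :
    Expands (cFun (toLattice n)) (-mono n * ((1 - vinvSeries * mono n) * geom n)) := by
  rw [cFun, div_eq_mul_inv, mul_left_comm]
  exact (expands_one.sub (expands_vinv.mul (expands_rexp n))).mul (expands_inv_one_sub_rexp hn)

lemma expands_neg_rexp_mul_cFun_neg (hn : n ≠ 0) :
    Expands (-rexp (-toLattice n) * cFun (-toLattice n)) ((vinvSeries - mono n) * geom n) := by
  have hmul : -rexp (-toLattice n) * cFun (-toLattice n) =
      (vinv - rexp (-toLattice n)) * (1 - rexp (-toLattice n))⁻¹ := by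
    rw [cFun, neg_neg, div_eq_mul_inv, ← mul_assoc]
    congr 1
    linear_combination vinv * rexp_neg_mul (toLattice n)
  rw [hmul]
  exact (expands_vinv.sub (expands_rexp n)).mul (expands_inv_one_sub_rexp_neg hn)

end Series

section PathWeights

variable {ι k M N : Type*} [Field k] [CharZero k] [AddCommGroup M] [Module k M]
  [AddCommGroup N] [Module k N] {P : RootPairing ι k M N} [P.IsCrystallographic]
  {b : P.Base} {θ : ι}

/-- The positive one of `± u a_i^∨`. -/
def posImage (u : weyl b θ) (i : Idx b) : Idx b →₀ ℕ := absCoords (u.1 (simpleCoroot b i))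

lemma toLattice_posImage_of_nonneg {u : weyl b θ} {i : Idx b}
    (h : 0 ≤ u.1 (simpleCoroot b i)) : toLattice (posImage u i) = u.1 (simpleCoroot b i) :=
  toLattice_absCoords_of_nonneg h

lemma posImage_mul_gen (u : weyl b θ) (i : Idx b) :
    posImage (u * gen b θ i) i = posImage u i := by
  rw [posImage, mul_gen_apply_simple, absCoords_neg, posImage]

open Classical in
/-- The weight of a path that reads the letter `i` at `u` and moves to `u s_i`: the expansion of
`c(u a_i^∨)`, up to the change of `invWt` along this move. -/
def moveWt (u : weyl b θ) (i : Idx b) : Qfin (Idx b) :=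
  if 0 ≤ u.1 (simpleCoroot b i) then (1 - vinvSeries * mono (posImage u i)) * geom (posImage u i)
  else (vinvSeries - mono (posImage u i)) * geom (posImage u i)

open Classical in
/-- The weight of a path that reads the letter `i` at `u` and stays there: the expansion of
`b(u a_i^∨)`. -/
def stayWt (u : weyl b θ) (i : Idx b) : Qfin (Idx b) :=
  if 0 ≤ u.1 (simpleCoroot b i) then (1 - vinvSeries) * mono (posImage u i) * geom (posImage u i)
  else -(1 - vinvSeries) * geom (posImage u i)

/-- Extends the paths with end point weights `φ` by reading the letter `i`. -/
def pathStep (φ : weyl b θ → Qfin (Idx b)) (i : Idx b) (t : weyl b θ) : Qfin (Idx b) :=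
  φ t * stayWt t i + φ (t * gen b θ i) * moveWt (t * gen b θ i) i

open Classical in
/-- The total weight of the paths from `1` along the word `l`, as a function of their end point. -/
def pathSum (l : List (Idx b)) : weyl b θ → Qfin (Idx b) := l.foldl pathStep (Pi.single 1 1)

lemma pathSum_append_singleton (l : List (Idx b)) (i : Idx b) :
    pathSum (θ := θ) (l ++ [i]) = pathStep (pathSum l) i := by
  simp [pathSum]

/-- The total weight of the paths from `1` along a reduced word of `w`, by end point. -/
def pathC (w : weyl b θ) : weyl b θ → Qfin (Idx b) := pathSum (exists_reducedWord b θ w).choose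

lemma coeff_mul_simpleT (Y : RW b θ) (i : Idx b) (t : weyl b θ) :
    (Y * simpleT b θ i).coeff t = Y.coeff t * bFun (t.1 (simpleCoroot b i)) +
      Y.coeff (t * gen b θ i) * cFun ((t * gen b θ i).1 (simpleCoroot b i)) := by
  rw [simpleT, mul_add, SkewMonoidAlgebra.coeff_add, Finsupp.add_apply,
    SkewMonoidAlgebra.coeff_mul_single, SkewMonoidAlgebra.coeff_mul_single_one, gen_inv,
    weyl_smul_cFun, weyl_smul_bFun, add_comm]

end PathWeights

section Paths

variable {ι k M N : Type*} [Finite ι] [Field k] [CharZero k] [AddCommGroup M] [Module k M]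
  [AddCommGroup N] [Module k N] {P : RootPairing ι k M N} [P.IsRootSystem] [P.IsCrystallographic]
  [P.IsReduced] {b : P.Base} {θ : ι} [hS : SimplyLacedAffine b θ]

lemma nonneg_mul_gen {u : weyl b θ} {i : Idx b} (h : ¬ 0 ≤ u.1 (simpleCoroot b i)) :
    0 ≤ (u * gen b θ i).1 (simpleCoroot b i) := by
  rw [mul_gen_apply_simple, neg_nonneg]
  exact ((isReal_simple b θ i).weyl u).not_nonneg_iff.mp h

lemma toLattice_posImage_of_not_nonneg {u : weyl b θ} {i : Idx b}
    (h : ¬ 0 ≤ u.1 (simpleCoroot b i)) :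
    toLattice (posImage u i) = -u.1 (simpleCoroot b i) :=
  toLattice_absCoords_of_nonpos (((isReal_simple b θ i).weyl u).not_nonneg_iff.mp h)

lemma isReal_posImage (u : weyl b θ) (i : Idx b) : IsReal b θ (toLattice (posImage u i)) := by
  have hreal := (isReal_simple b θ i).weyl u
  by_cases h : 0 ≤ u.1 (simpleCoroot b i)
  · rwa [toLattice_posImage_of_nonneg h]
  · rw [toLattice_posImage_of_not_nonneg h]
    exact hreal.neg

lemma posImage_ne_zero (u : weyl b θ) (i : Idx b) : posImage u i ≠ 0 := fun h =>
  (isReal_posImage u i).ne_zero (by rw [h, toLattice_zero])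

/-- The product of the `-e^{-β}` over the inversions `β` of `u⁻¹`. -/
def invWt (u : weyl b θ) : Qfin (Idx b) := ∏ n ∈ (invSet_finite u).toFinset, -mono n

lemma invWt_one : invWt (1 : weyl b θ) = 1 := by
  simp [invWt, invSet_one]

lemma invWt_mul_gen {u : weyl b θ} {i : Idx b} (h : 0 ≤ u.1 (simpleCoroot b i)) :
    invWt (u * gen b θ i) = -mono (posImage u i) * invWt u := by
  classical
  have hn := (toLattice_posImage_of_nonneg h).symm
  have hinsert : (invSet_finite (u * gen b θ i)).toFinset =
      insert (posImage u i) (invSet_finite u).toFinset := by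
    ext m
    simp [invSet_mul_gen hn]
  rw [invWt, hinsert, Finset.prod_insert, invWt]
  simpa using notMem_invSet_of_eq hn

lemma invWt_ne_zero (u : weyl b θ) : invWt u ≠ 0 :=
  Finset.prod_ne_zero_iff.mpr fun n _ => neg_ne_zero.mpr (mono_ne_zero n)

lemma expands_stayWt (t : weyl b θ) (i : Idx b) :
    Expands (bFun (t.1 (simpleCoroot b i))) (stayWt t i) := by
  have hn := posImage_ne_zero t i
  rw [stayWt]
  split_ifs with h
  · rw [← toLattice_posImage_of_nonneg h]
    exact expands_bFun hn
  · rw [← neg_neg (t.1 _), ← toLattice_posImage_of_not_nonneg h]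
    exact expands_bFun_neg hn

lemma Expands.mul_moveWt {f : RatFun (Idx b)} {u : weyl b θ} {g : Qfin (Idx b)}
    (hf : Expands f (invWt u * g)) (i : Idx b) :
    Expands (f * cFun (u.1 (simpleCoroot b i))) (invWt (u * gen b θ i) * (g * moveWt u i)) := by
  have hn := posImage_ne_zero u i
  by_cases h : 0 ≤ u.1 (simpleCoroot b i)
  · have hc := hf.mul (expands_cFun hn)
    rw [toLattice_posImage_of_nonneg h] at hc
    rw [moveWt, if_pos h, invWt_mul_gen h]
    convert hc using 1
    ring
  · have hwt := invWt_mul_gen (nonneg_mul_gen h)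
    rw [mul_gen_mul_gen, posImage_mul_gen] at hwt
    have hc := hf.mul (expands_neg_rexp_mul_cFun_neg hn)
    rw [toLattice_posImage_of_not_nonneg h, neg_neg, hwt] at hc
    refine Expands.of_mul_left (expands_rexp (posImage u i)).neg
      (neg_ne_zero.mpr (mono_ne_zero _)) ?_
    rw [toLattice_posImage_of_not_nonneg h, neg_neg, moveWt, if_neg h]
    convert hc using 1 <;> ring

lemma expands_wordT_coeff (l : List (Idx b)) (t : weyl b θ) :
    Expands ((wordT b θ l).coeff t) (invWt t * pathSum l t) := by
  classical
  induction l using List.reverseRecOn generalizing t with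
  | nil =>
    rw [show wordT b θ [] = 1 from rfl, SkewMonoidAlgebra.coeff_one, pathSum, List.foldl_nil]
    by_cases ht : t = 1
    · subst ht
      simpa [invWt_one] using expands_one
    · simpa [ht, Finsupp.single_eq_of_ne ht] using expands_zero
  | append_singleton l i ih =>
    rw [wordT_append_singleton, coeff_mul_simpleT, pathSum_append_singleton, pathStep, mul_add]
    refine Expands.add ?_ ?_
    · rw [← mul_assoc]
      exact (ih t).mul (expands_stayWt t i)
    · simpa only [mul_gen_mul_gen] using (ih (t * gen b θ i)).mul_moveWt i

lemma len_le_of_coeff_stayWt_ne_zero {i : Idx b} {t v : weyl b θ} {n : Idx b →₀ ℕ}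
    (hv : 0 ≤ (v⁻¹).1 (simpleCoroot b i)) (h : MvPowerSeries.coeff n (stayWt t i) ≠ 0) :
    len (t * gen b θ i * v) ≤ len (t * v) + 2 * n.degree := by
  by_cases ht : 0 ≤ t.1 (simpleCoroot b i)
  · rw [stayWt, if_pos ht, mul_comm (1 - vinvSeries), mul_assoc] at h
    obtain ⟨d, rfl⟩ := exists_add_of_le (le_of_coeff_mono_mul_ne_zero h)
    have hlen := len_le_of_realReflection (v := t * gen b θ i * v) (w := t * v)
      (isReal_posImage t i) fun y => by
        rw [mul_gen_mul_apply, toLattice_posImage_of_nonneg ht]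
    rw [map_add]
    omega
  · have hreal := (isReal_simple b θ i).weyl t
    have hinv : ¬ 0 ≤ ((t * v)⁻¹).1 (-t.1 (simpleCoroot b i)) := by
      rwa [mul_inv_rev, weyl_mul_apply, map_neg, weyl_inv_apply_apply, map_neg,
        ((isReal_simple b θ i).weyl v⁻¹).neg.not_nonneg_iff, neg_nonpos]
    have hlen := len_lt_of_inversion (v := t * gen b θ i * v) hreal.neg
      (neg_nonneg.mpr (hreal.not_nonneg_iff.mp ht)) hinv fun y => by
        rw [mul_gen_mul_apply]
        simp [realReflection]
    omega

lemma le_of_coeff_pathStep_ne_zero {L : ℕ} {i : Idx b} {t v : weyl b θ} {n : Idx b →₀ ℕ}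
    {φ : weyl b θ → Qfin (Idx b)} (hv : 0 ≤ (v⁻¹).1 (simpleCoroot b i))
    (hφ : ∀ u n, MvPowerSeries.coeff n (φ u) ≠ 0 → L ≤ len (u * (gen b θ i * v)) + 2 * n.degree)
    (h : MvPowerSeries.coeff n (pathStep φ i t) ≠ 0) : L ≤ len (t * v) + 2 * n.degree := by
  rw [pathStep, map_add] at h
  obtain hstay | hmove : MvPowerSeries.coeff n (φ t * stayWt t i) ≠ 0 ∨
      MvPowerSeries.coeff n (φ (t * gen b θ i) * moveWt (t * gen b θ i) i) ≠ 0 := by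
    by_contra! hzero
    rw [hzero.1, hzero.2, add_zero] at h
    exact h rfl
  · obtain ⟨m₁, m₂, rfl, hm₁, hm₂⟩ := exists_coeff_ne_zero_of_mul hstay
    have hL := hφ _ _ hm₁
    have hlen := len_le_of_coeff_stayWt_ne_zero hv hm₂
    rw [← mul_assoc] at hL
    rw [map_add]
    omega
  · obtain ⟨m₁, m₂, rfl, hm₁, -⟩ := exists_coeff_ne_zero_of_mul hmove
    have hL := hφ _ _ hm₁
    rw [← mul_assoc, mul_gen_mul_gen] at hL
    rw [map_add]
    omega

lemma IsReducedWord.nonneg_of_cons {i : Idx b} {l : List (Idx b)} {w : weyl b θ}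
    (hl : IsReducedWord b θ (i :: l) w) : 0 ≤ ((wprod b θ l)⁻¹).1 (simpleCoroot b i) := by
  have hneg := hl.not_nonneg
  rwa [← hl.wprod_eq, wprod_cons, inv_gen_mul_apply_simple,
    ((isReal_simple b θ i).weyl (wprod b θ l)⁻¹).neg.not_nonneg_iff, neg_nonpos] at hneg

lemma le_of_coeff_foldl_pathStep_ne_zero {L : ℕ} {l : List (Idx b)} {w u : weyl b θ}
    {n : Idx b →₀ ℕ} {φ : weyl b θ → Qfin (Idx b)} (hl : IsReducedWord b θ l w)
    (hφ : ∀ u n, MvPowerSeries.coeff n (φ u) ≠ 0 → L ≤ len (u * w) + 2 * n.degree)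
    (h : MvPowerSeries.coeff n (l.foldl pathStep φ u) ≠ 0) : L ≤ len u + 2 * n.degree := by
  induction l generalizing φ w with
  | nil => simpa [← hl.wprod_eq] using hφ u n h
  | cons i l ih =>
    have htail := (IsReducedWord.of_append (l := [i]) hl).2
    rw [← hl.wprod_eq, wprod_cons] at hφ
    exact ih htail (fun t m => le_of_coeff_pathStep_ne_zero hl.nonneg_of_cons hφ) h

lemma len_le_of_coeff_pathSum_ne_zero {l : List (Idx b)} {w : weyl b θ}
    (hl : IsReducedWord b θ l w) {u : weyl b θ} {n : Idx b →₀ ℕ}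
    (h : MvPowerSeries.coeff n (pathSum l u) ≠ 0) : len w ≤ len u + 2 * n.degree := by
  classical
  refine le_of_coeff_foldl_pathStep_ne_zero hl (fun t m hm => ?_) h
  obtain rfl : t = 1 := by
    by_contra ht
    rw [Pi.single_eq_of_ne ht] at hm
    exact hm rfl
  rw [one_mul]
  exact Nat.le_add_right _ _

lemma expands_elemT_coeff (w u : weyl b θ) :
    Expands ((elemT b θ w).coeff u) (invWt u * pathC w u) :=
  expands_wordT_coeff _ u

lemma coeffC_eq (u w : weyl b θ) : coeffC b θ u w = invWt u * pathC w u :=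
  (expands_elemT_coeff w u).expansion_eq

lemma pathSum_eq_pathC {l : List (Idx b)} {w : weyl b θ} (hl : IsReducedWord b θ l w) :
    pathSum l = pathC w := by
  funext u
  refine mul_left_cancel₀ (invWt_ne_zero u) ((expands_wordT_coeff l u).unique ?_)
  rw [wordT_eq_elemT hl]
  exact expands_elemT_coeff w u

lemma pathC_mul_gen {w : weyl b θ} {i : Idx b} (h : 0 ≤ w.1 (simpleCoroot b i)) :
    pathC (w * gen b θ i) = pathStep (pathC w) i := by
  obtain ⟨l, hl⟩ := exists_reducedWord b θ w
  rw [← pathSum_eq_pathC hl, ← pathSum_append_singleton]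
  refine (pathSum_eq_pathC (isReducedWord_of_length ?_ ?_)).symm
  · rw [wprod_append, hl.wprod_eq, wprod_cons, wprod_nil, mul_one]
  · rw [List.length_append, hl.length_eq, len_mul_gen h, List.length_singleton]

lemma one_add_stayWt (t : weyl b θ) (i : Idx b) : 1 + stayWt t i = moveWt t i := by
  have hgeom := one_sub_mono_mul_geom (posImage_ne_zero t i)
  rw [stayWt, moveWt]
  split_ifs <;> linear_combination -hgeom

lemma add_pathStep_mul_gen (φ : weyl b θ → Qfin (Idx b)) (i : Idx b) (t : weyl b θ) :
    φ (t * gen b θ i) + pathStep φ i (t * gen b θ i) = φ t + pathStep φ i t := by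
  rw [pathStep, pathStep, mul_gen_mul_gen]
  linear_combination φ (t * gen b θ i) * one_add_stayWt (t * gen b θ i) i -
    φ t * one_add_stayWt t i

lemma pathC_add_pathC_mul_gen (w : weyl b θ) (i : Idx b) (t : weyl b θ) :
    pathC w (t * gen b θ i) + pathC (w * gen b θ i) (t * gen b θ i) =
      pathC w t + pathC (w * gen b θ i) t := by
  by_cases h : 0 ≤ w.1 (simpleCoroot b i)
  · rw [pathC_mul_gen h]
    exact add_pathStep_mul_gen _ i t
  · have hstep := pathC_mul_gen (nonneg_mul_gen h)
    rw [mul_gen_mul_gen] at hstep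
    rw [hstep]
    linear_combination add_pathStep_mul_gen (pathC (w * gen b θ i)) i t

end Paths

/-! ### Coefficientwise convergence -/

section Topology

open scoped MvPowerSeries.WithPiTopology
open Filter

/-- Coefficients carry the discrete topology, so that convergence of series is coefficientwise
stabilization. -/
local instance instTopologicalSpaceCoeff : TopologicalSpace ℂ[X] := ⊥

local instance instDiscreteTopologyCoeff : DiscreteTopology ℂ[X] := ⟨rfl⟩

section Series

variable {I J : Type*}

lemma hasFormalProd_iff_hasProd {f : J → Qfin I} {F : Qfin I} :
    HasFormalProd f F ↔ HasProd f F := by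
  rw [HasProd, MvPowerSeries.WithPiTopology.tendsto_iff_coeff_tendsto]
  simp only [nhds_discrete, tendsto_pure, SummationFilter.unconditional_filter]
  rfl

lemma formalProd_eq {f : J → Qfin I} {F : Qfin I} (h : HasProd f F) : formalProd f = F := by
  have hexists : ∃ F, HasFormalProd f F := ⟨F, hasFormalProd_iff_hasProd.mpr h⟩
  rw [formalProd, dif_pos hexists]
  exact (hasFormalProd_iff_hasProd.mp hexists.choose_spec).unique h

lemma summable_of_finite_coeff {f : J → Qfin I}
    (h : ∀ n, {j | MvPowerSeries.coeff n (f j) ≠ 0}.Finite) : Summable f :=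
  MvPowerSeries.WithPiTopology.summable_iff_summable_coeff.mpr fun n =>
    summable_of_hasFiniteSupport (h n)

lemma hasFormalSum_of_hasSum {f : J → Qfin I} {F : Qfin I} (h : HasSum f F) :
    HasFormalSum f (toQv F) := by
  intro n d
  have hcoeff := MvPowerSeries.WithPiTopology.hasSum_iff_hasSum_coeff.mp h n
  have hfinite : {j | MvPowerSeries.coeff n (f j) ≠ 0}.Finite :=
    hcoeff.summable.hasFiniteSupport_of_discreteTopology
  refine ⟨hfinite.subset fun j hj hzero => hj (by rw [hzero, Polynomial.coeff_zero]), ?_⟩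
  rw [toQv, MvPowerSeries.coeff_map, ← hcoeff.tsum_eq, tsum_eq_finsum hfinite]
  exact (Polynomial.coeff_coe _ _).trans
    ((Polynomial.lcoeff ℂ d).toAddMonoidHom.map_finsum hfinite)

lemma multipliable_of_mono_dvd {f : J → Qfin I} (e : J → (I →₀ ℕ)) (he : Function.Injective e)
    (hf : ∀ j, mono (e j) ∣ f j - 1) : Multipliable f := by
  classical
  have hfinite (n : I →₀ ℕ) : {j | e j ≤ n}.Finite :=
    ((Set.finite_Icc 0 n).subset fun m hm => ⟨zero_le, hm⟩).preimage he.injOn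
  have hsum : Summable fun s : Finset J => ∏ j ∈ s, (f j - 1) := by
    refine summable_of_finite_coeff fun n =>
      (hfinite n).toFinset.powerset.finite_toSet.subset fun s hs => ?_
    simp only [Finset.coe_powerset, Set.mem_preimage, Set.mem_powerset_iff]
    intro j hj
    obtain ⟨g, hg⟩ : mono (e j) ∣ ∏ j ∈ s, (f j - 1) :=
      (hf j).trans (Finset.dvd_prod_of_mem (fun j => f j - 1) hj)
    rw [Set.mem_ofPred_eq, hg] at hs
    simpa using le_of_coeff_mono_mul_ne_zero hs
  simpa using multipliable_one_add_of_summable_prod hsum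

lemma coeffExp_neg_toLattice (f : Qfin I) (n : I →₀ ℕ) :
    coeffExp f (-toLattice n) = MvPowerSeries.coeff n f := by
  have hexists : ∃ m : I →₀ ℕ, toLattice m = - -toLattice n := ⟨n, (neg_neg _).symm⟩
  rw [coeffExp, dif_pos hexists]
  exact congrArg (fun m => MvPowerSeries.coeff m f)
    (toLattice_injective (hexists.choose_spec.trans (neg_neg _)))

lemma coeffExp_of_not_nonpos (f : Qfin I) {x : I →₀ ℤ} (hx : ¬ x ≤ 0) : coeffExp f x = 0 := by
  rw [coeffExp, dif_neg]
  rintro ⟨n, hn⟩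
  exact hx (neg_nonneg.mp (hn ▸ toLattice_nonneg n))

lemma nonpos_of_coeffExp_ne_zero {f : Qfin I} {x : I →₀ ℤ} (hx : coeffExp f x ≠ 0) : x ≤ 0 := by
  by_contra h
  exact hx (coeffExp_of_not_nonpos f h)

lemma exists_eq_neg_toLattice {x : I →₀ ℤ} (hx : x ≤ 0) : ∃ n, x = -toLattice n := by
  obtain ⟨n, hn⟩ := exists_toLattice_eq (neg_nonneg.mpr hx)
  exact ⟨n, by rw [hn, neg_neg]⟩

/-- The coefficient of `e^x` as an additive map. -/
def coeffExpHom (x : I →₀ ℤ) : Qfin I →+ ℂ[X] where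
  toFun f := coeffExp f x
  map_zero' := by
    by_cases hx : x ≤ 0
    · obtain ⟨n, rfl⟩ := exists_eq_neg_toLattice hx
      rw [coeffExp_neg_toLattice, map_zero]
    · exact coeffExp_of_not_nonpos _ hx
  map_add' f g := by
    by_cases hx : x ≤ 0
    · obtain ⟨n, rfl⟩ := exists_eq_neg_toLattice hx
      simp only [coeffExp_neg_toLattice, map_add]
    · simp only [coeffExp_of_not_nonpos _ hx, add_zero]

lemma continuous_coeffExpHom (x : I →₀ ℤ) : Continuous (coeffExpHom x) := by
  by_cases hx : x ≤ 0
  · obtain ⟨n, rfl⟩ := exists_eq_neg_toLattice hx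
    exact (MvPowerSeries.WithPiTopology.continuous_coeff ℂ[X] n).congr fun f =>
      (coeffExp_neg_toLattice f n).symm
  · exact continuous_const.congr fun f => (coeffExp_of_not_nonpos f hx).symm

lemma coeffExp_add (f g : Qfin I) (x : I →₀ ℤ) :
    coeffExp (f + g) x = coeffExp f x + coeffExp g x := map_add (coeffExpHom x) f g

lemma coeffExp_sub (f g : Qfin I) (x : I →₀ ℤ) :
    coeffExp (f - g) x = coeffExp f x - coeffExp g x := map_sub (coeffExpHom x) f g

lemma coeffExp_neg (f : Qfin I) (x : I →₀ ℤ) : coeffExp (-f) x = -coeffExp f x :=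
  map_neg (coeffExpHom x) f

lemma coeffExp_C_mul (r : ℂ[X]) (f : Qfin I) (x : I →₀ ℤ) :
    coeffExp (MvPowerSeries.C r * f) x = r * coeffExp f x := by
  by_cases hx : x ≤ 0
  · obtain ⟨n, rfl⟩ := exists_eq_neg_toLattice hx
    rw [coeffExp_neg_toLattice, coeffExp_neg_toLattice, MvPowerSeries.coeff_C_mul]
  · rw [coeffExp_of_not_nonpos _ hx, coeffExp_of_not_nonpos _ hx, mul_zero]

lemma coeffExp_mono_mul (n : I →₀ ℕ) (f : Qfin I) (x : I →₀ ℤ) :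
    coeffExp (mono n * f) x = coeffExp f (x + toLattice n) := by
  classical
  by_cases hx : x ≤ 0
  · obtain ⟨m, rfl⟩ := exists_eq_neg_toLattice hx
    rw [coeffExp_neg_toLattice, mono, MvPowerSeries.coeff_monomial_mul]
    split_ifs with h
    · obtain ⟨d, rfl⟩ := exists_add_of_le h
      rw [one_mul, add_tsub_cancel_left, toLattice_add, neg_add, neg_add_cancel_comm,
        coeffExp_neg_toLattice]
    · refine (coeffExp_of_not_nonpos f fun hmn => h ?_).symm
      rwa [neg_add_nonpos_iff, toLattice_le_toLattice] at hmn
  · rw [coeffExp_of_not_nonpos _ hx, coeffExp_of_not_nonpos]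
    exact fun h => hx ((le_add_of_nonneg_right (toLattice_nonneg n)).trans h)

lemma coeffExp_one [DecidableEq I] (x : I →₀ ℤ) :
    coeffExp (1 : Qfin I) x = if x = 0 then 1 else 0 := by
  by_cases hx : x ≤ 0
  · obtain ⟨n, rfl⟩ := exists_eq_neg_toLattice hx
    rw [coeffExp_neg_toLattice, MvPowerSeries.coeff_one]
    refine if_congr ?_ rfl rfl
    rw [neg_eq_zero, ← toLattice_zero, toLattice_injective.eq_iff]
  · rw [coeffExp_of_not_nonpos _ hx, if_neg fun h => hx h.le]

lemma coeffExp_mul (f g : Qfin I) (x : I →₀ ℤ) :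
    coeffExp (f * g) x = ∑ᶠ y, coeffExp f y * coeffExp g (x - y) := by
  classical
  have hsupport (y : I →₀ ℤ) (hy : coeffExp f y * coeffExp g (x - y) ≠ 0) : y ≤ 0 ∧ x ≤ y :=
    ⟨nonpos_of_coeffExp_ne_zero (left_ne_zero_of_mul hy),
      sub_nonpos.mp (nonpos_of_coeffExp_ne_zero (right_ne_zero_of_mul hy))⟩
  by_cases hx : x ≤ 0
  · obtain ⟨n, rfl⟩ := exists_eq_neg_toLattice hx
    have hsubset : (Function.support fun y => coeffExp f y * coeffExp g (-toLattice n - y)) ⊆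
        ((Finset.HasAntidiagonal.antidiagonal n).image fun p => -toLattice p.1 :
          Finset (I →₀ ℤ)) := by
      intro y hy
      obtain ⟨hy_nonpos, hny⟩ := hsupport y hy
      obtain ⟨m, rfl⟩ := exists_eq_neg_toLattice hy_nonpos
      obtain ⟨d, rfl⟩ := exists_add_of_le (toLattice_le_toLattice.mp (neg_le_neg_iff.mp hny))
      simp only [Finset.coe_image, Set.mem_image, Finset.mem_coe]
      exact ⟨(m, d), Finset.HasAntidiagonal.mem_antidiagonal.mpr rfl, rfl⟩
    rw [coeffExp_neg_toLattice, MvPowerSeries.coeff_mul,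
      finsum_eq_sum_of_support_subset _ hsubset, Finset.sum_image]
    · refine Finset.sum_congr rfl fun p hp => ?_
      rw [← Finset.HasAntidiagonal.mem_antidiagonal.mp hp, toLattice_add, neg_add,
        add_sub_cancel_left, coeffExp_neg_toLattice, coeffExp_neg_toLattice]
    · intro p hp q hq hpq
      have hsum := (Finset.HasAntidiagonal.mem_antidiagonal.mp hp).trans
        (Finset.HasAntidiagonal.mem_antidiagonal.mp hq).symm
      have hfst : p.1 = q.1 := toLattice_injective (neg_injective hpq)
      exact Prod.ext hfst (add_left_cancel (hfst ▸ hsum))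
  · rw [coeffExp_of_not_nonpos _ hx, finsum_eq_zero_of_forall_eq_zero]
    intro y
    by_contra hy
    exact hx ((hsupport y hy).2.trans (hsupport y hy).1)

/-- The coefficients of `f`, extended by zero to the whole lattice, are those of `g` moved by `s`:
this makes sense of `f = s g` although `s` does not act on the ring of series. -/
def Translates (s : (I →₀ ℤ) ≃ₗ[ℤ] (I →₀ ℤ)) (f g : Qfin I) : Prop :=
  ∀ x, coeffExp f (s x) = coeffExp g x

/-- The coefficients of `f` change sign under `x ↦ s x - a_i`, i.e. `e^{a_i / 2} f` is
anti-invariant under `s`, provided that `s a_i = -a_i`. -/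
def IsSkew (s : (I →₀ ℤ) ≃ₗ[ℤ] (I →₀ ℤ)) (i : I) (f : Qfin I) : Prop :=
  ∀ x, coeffExp f (s x - Finsupp.single i 1) = -coeffExp f x

variable {s : (I →₀ ℤ) ≃ₗ[ℤ] (I →₀ ℤ)} {f g f' g' : Qfin I}

lemma translates_one : Translates s 1 1 := fun x => by
  classical
  simp only [coeffExp_one, LinearEquiv.map_eq_zero_iff]

lemma Translates.sub (h : Translates s f g) (h' : Translates s f' g') :
    Translates s (f - f') (g - g') := fun x => by
  rw [coeffExp_sub, coeffExp_sub, h, h']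

lemma Translates.mul (h : Translates s f g) (h' : Translates s f' g') :
    Translates s (f * f') (g * g') := by
  intro x
  rw [coeffExp_mul, coeffExp_mul, ← finsum_comp_equiv s.toEquiv]
  refine finsum_congr fun y => ?_
  rw [← h y, ← h' (x - y), map_sub]
  rfl

lemma Translates.C_mul (h : Translates s f g) (r : ℂ[X]) :
    Translates s (MvPowerSeries.C r * f) (MvPowerSeries.C r * g) := fun x => by
  rw [coeffExp_C_mul, coeffExp_C_mul, h]

lemma Translates.prod {f g : J → Qfin I} (h : ∀ j, Translates s (f j) (g j)) (t : Finset J) :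
    Translates s (∏ j ∈ t, f j) (∏ j ∈ t, g j) := by
  classical
  induction t using Finset.induction_on with
  | empty => exact translates_one
  | insert j t hj ih =>
    rw [Finset.prod_insert hj, Finset.prod_insert hj]
    exact (h j).mul ih

lemma Translates.pow (h : Translates s f g) (m : ℕ) : Translates s (f ^ m) (g ^ m) := by
  simpa using Translates.prod (fun _ => h) (Finset.range m)

lemma translates_mono {n m : I →₀ ℕ} (h : s (toLattice m) = toLattice n) :
    Translates s (mono n) (mono m) := fun x => by
  rw [← mul_one (mono n), ← mul_one (mono m), coeffExp_mono_mul, coeffExp_mono_mul, ← h, ← map_add]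
  exact translates_one _

lemma Translates.hasProd {f g : J → Qfin I} (h : ∀ j, Translates s (f j) (g j)) {F G : Qfin I}
    (hF : HasProd f F) (hG : HasProd g G) : Translates s F G := by
  intro x
  have hFx := ((continuous_coeffExpHom (s x)).tendsto F).comp hF
  have hGx := ((continuous_coeffExpHom x).tendsto G).comp hG
  exact tendsto_nhds_unique hFx (hGx.congr fun t => (Translates.prod h t x).symm)

variable {i : I}

lemma ht_neg_of_neg {x : I →₀ ℤ} (hx : x < 0) : ht x < 0 := by
  obtain ⟨n, rfl⟩ := exists_eq_neg_toLattice hx.le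
  rw [map_neg, ht_toLattice, neg_lt_zero, Nat.cast_pos, Nat.pos_iff_ne_zero, Ne,
    Finsupp.degree_eq_zero_iff]
  rintro rfl
  simp [toLattice_zero] at hx

/-- The height of `-x` without the contribution of the `i`-th coordinate. -/
def coheight (i : I) : (I →₀ ℤ) →+ ℤ := -ht.toAddMonoidHom.comp (Finsupp.eraseAddHom i)

lemma coheight_apply (i : I) (x : I →₀ ℤ) : coheight i x = -ht (x.erase i) := rfl

lemma coheight_pos {x : I →₀ ℤ} (hx : x ≤ 0) (hne : x.erase i ≠ 0) : 0 < coheight i x := by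
  classical
  rw [coheight_apply]
  refine neg_pos.mpr (ht_neg_of_neg (lt_of_le_of_ne (fun j => ?_) hne))
  rw [Finsupp.erase_apply]
  split_ifs
  · exact le_rfl
  · exact hx j

lemma coheight_nonneg {x : I →₀ ℤ} (hx : x ≤ 0) : 0 ≤ coheight i x := by
  by_cases h : x.erase i = 0
  · rw [coheight_apply, h, map_zero, neg_zero]
  · exact (coheight_pos hx h).le

lemma coheight_apply_eq (hs : ∀ x j, j ≠ i → s x j = x j) (x : I →₀ ℤ) :
    coheight i (s x) = coheight i x := by
  classical
  have herase : (s x).erase i = x.erase i := by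
    ext j
    rw [Finsupp.erase_apply, Finsupp.erase_apply]
    split_ifs with hj
    · rfl
    · exact hs x j hj
  rw [coheight_apply, coheight_apply, herase]

lemma Translates.coheight_pos (hsi : s (Finsupp.single i 1) = -Finsupp.single i 1)
    (hf : Translates s f f) (hf0 : MvPowerSeries.coeff 0 f = 0) {y : I →₀ ℤ}
    (hy : coeffExp f y ≠ 0) : 0 < coheight i y := by
  classical
  have hy_nonpos := nonpos_of_coeffExp_ne_zero hy
  refine AffineCS.coheight_pos hy_nonpos fun herase => hy ?_
  have hsingle : y = y i • Finsupp.single i 1 := by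
    simpa [herase] using (Finsupp.single_add_erase i y).symm
  have hs_nonpos := nonpos_of_coeffExp_ne_zero (hf y ▸ hy)
  have hyi : y i = 0 := by
    refine le_antisymm (hy_nonpos i) ?_
    have hsyi := hs_nonpos i
    rw [hsingle, map_smul, hsi] at hsyi
    simpa using hsyi
  rw [hsingle, hyi, zero_smul, ← neg_zero, ← toLattice_zero, coeffExp_neg_toLattice, hf0]

/-- Since `1 - f` raises the `s`-invariant `coheight i`, the identity `g = f g + (1 - f) g`
determines the coefficients of `g` recursively, in an `s`-invariant way. -/
lemma Translates.of_mul_left (hs : ∀ x j, j ≠ i → s x j = x j)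
    (hsi : s (Finsupp.single i 1) = -Finsupp.single i 1) (hf : Translates s f f)
    (hf0 : MvPowerSeries.coeff 0 f = 1) (hfg : Translates s (f * g) (f * g)) :
    Translates s g g := by
  have hsub : Translates s (1 - f) (1 - f) := translates_one.sub hf
  have hrec (z : I →₀ ℤ) : coeffExp g z =
      coeffExp (f * g) z + ∑ᶠ y, coeffExp (1 - f) y * coeffExp g (z - y) := by
    rw [← coeffExp_mul, ← coeffExp_add]
    congr 1
    ring
  have hinvariant (N : ℕ) : ∀ x, coheight i x < N → coeffExp g (s x) = coeffExp g x := by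
    induction N with
    | zero =>
      intro x hx
      rw [Nat.cast_zero] at hx
      rw [coeffExp_of_not_nonpos _ fun h => (coheight_nonneg (i := i) h).not_gt
          (by rwa [coheight_apply_eq hs]),
        coeffExp_of_not_nonpos _ fun h => (coheight_nonneg h).not_gt hx]
    | succ N ih =>
      intro x hx
      rw [hrec x, hrec (s x), hfg x, ← finsum_comp_equiv s.toEquiv]
      congr 1
      refine finsum_congr fun y => ?_
      change coeffExp (1 - f) (s y) * coeffExp g (s x - s y) = _
      rw [hsub y, ← map_sub]
      by_cases hy : coeffExp (1 - f) y = 0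
      · rw [hy, zero_mul, zero_mul]
      · have hpos :=
          hsub.coheight_pos hsi (by rw [map_sub, hf0, MvPowerSeries.coeff_zero_one, sub_self]) hy
        rw [ih (x - y)]
        rw [map_sub]
        push_cast at hx
        omega
  exact fun x => hinvariant (coheight i x + 1).toNat x (by omega)

lemma isSkew_of_hasSum {f g : J → Qfin I} {F : Qfin I}
    (h : ∀ j x, coeffExp (g j) (s x - Finsupp.single i 1) = -coeffExp (f j) x)
    (hf : HasSum f F) (hg : HasSum g F) : IsSkew s i F := by
  intro x
  have hgF := hg.map (coeffExpHom (s x - Finsupp.single i 1)) (continuous_coeffExpHom _)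
  have hfF := (hf.map (coeffExpHom x) (continuous_coeffExpHom _)).neg
  exact HasSum.unique (hgF.congr_fun (fun j => (h j x).symm)) hfF

/-- The difference of the coefficients of `g` at `s x` and at `x` is anti-invariant under `s`, but
also periodic with period `a_i`, hence `s`-invariant. -/
lemma IsSkew.translates {p : (I →₀ ℤ) → ℤ} (hs : ∀ x, s x = x - p x • Finsupp.single i 1)
    (hsi : s (Finsupp.single i 1) = -Finsupp.single i 1)
    (h : IsSkew s i ((1 - mono (Finsupp.single i 1)) * g)) : Translates s g g := by
  have hcoeff (x : I →₀ ℤ) : coeffExp ((1 - mono (Finsupp.single i 1)) * g) x =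
      coeffExp g x - coeffExp g (x + Finsupp.single i 1) := by
    rw [sub_mul, one_mul, coeffExp_sub, coeffExp_mono_mul, toLattice_single]
  have hperiodic :
      Function.Periodic (fun x => coeffExp g (s x) - coeffExp g x) (Finsupp.single i 1) := by
    intro x
    have hx := h x
    rw [hcoeff, hcoeff, sub_add_cancel] at hx
    simp only [map_add, hsi, ← sub_eq_add_neg]
    linear_combination hx
  have hinvolutive (x : I →₀ ℤ) : s (s x) = x := by
    conv_lhs => rw [hs x, map_sub, map_smul, hsi, hs x]
    module
  intro x
  have hanti := (hperiodic.zsmul (p x)).sub_eq x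
  rw [← hs x, hinvolutive] at hanti
  have hself : coeffExp g x - coeffExp g (s x) = -(coeffExp g x - coeffExp g (s x)) := by
    rw [neg_sub, hanti]
  exact (sub_eq_zero.mp (self_eq_neg.mp hself)).symm

end Series

/-! ### Summation over the affine Weyl group -/

section ConstantCoeff

variable {I J : Type*}

lemma constantCoeff_mono {n : I →₀ ℕ} (hn : n ≠ 0) : MvPowerSeries.constantCoeff (mono n) = 0 := by
  classical
  rw [mono, ← MvPowerSeries.coeff_zero_eq_constantCoeff_apply, MvPowerSeries.coeff_monomial,
    if_neg hn.symm]

lemma constantCoeff_eq_one_of_dvd {n : I →₀ ℕ} (hn : n ≠ 0) {f : Qfin I} (h : mono n ∣ f - 1) :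
    MvPowerSeries.constantCoeff f = 1 := by
  obtain ⟨g, hg⟩ := h
  rw [sub_eq_iff_eq_add.mp hg, map_add, map_mul, constantCoeff_mono hn, zero_mul, zero_add, map_one]

lemma constantCoeff_eq_one_of_hasProd {f : J → Qfin I} {F : Qfin I} (h : HasProd f F)
    (hf : ∀ j, MvPowerSeries.constantCoeff (f j) = 1) : MvPowerSeries.constantCoeff F = 1 := by
  have hcoeff := h.map MvPowerSeries.constantCoeff
    (MvPowerSeries.WithPiTopology.continuous_constantCoeff ℂ[X])
  exact hcoeff.unique (hasProd_one.congr_fun hf)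

lemma dvd_pow_sub_one {R : Type*} [CommRing R] {a f : R} (h : a ∣ f - 1) (m : ℕ) :
    a ∣ f ^ m - 1 := by
  have := sub_dvd_pow_sub_pow f 1 m
  rw [one_pow] at this
  exact h.trans this

lemma add_self_injective : Function.Injective fun f : Qfin I => f + f := fun f g h => by
  ext1 n
  have hn : MvPowerSeries.coeff n (f + f) = MvPowerSeries.coeff n (g + g) := congrArg _ h
  rw [map_add, map_add, ← two_mul, ← two_mul] at hn
  exact mul_left_cancel₀ two_ne_zero hn

end ConstantCoeff

section PosCoroot

variable {ι k M N : Type*} [Field k] [AddCommGroup M] [Module k M] [AddCommGroup N] [Module k N]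
  {P : RootPairing ι k M N} {b : P.Base} {θ : ι}

lemma PosCoroot.ne_zero (n : PosCoroot b θ) : n.1 ≠ 0 := fun h =>
  n.2.1 (by rw [h, toLattice_zero])

lemma IsAffineCoroot.neg {x : Lattice b} (hx : IsAffineCoroot b θ x) : IsAffineCoroot b θ (-x) :=
  ⟨neg_ne_zero.mpr hx.1, hx.2.imp (IsReal.neg (x := x)) fun h => by rw [map_neg, h, neg_zero]⟩

lemma mono_dvd_one_sub_pow_sub_one (r : ℂ[X]) (n : PosCoroot b θ) :
    mono n.1 ∣ (1 - MvPowerSeries.C r * mono n.1) ^ mult b θ n - 1 :=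
  dvd_pow_sub_one ⟨-MvPowerSeries.C r, by ring⟩ _

variable (b θ) in
/-- The product `∏ (1 - r e^{-β})^{m(β)}` over the positive affine coroots, which is `D` for `r = 1`
and `D_v` for `r = v⁻¹`. -/
def twistedDenom (r : ℂ[X]) : Qfin (Idx b) :=
  ∏' n : PosCoroot b θ, (1 - MvPowerSeries.C r * mono n.1) ^ mult b θ n

lemma hasProd_twistedDenom (r : ℂ[X]) :
    HasProd (fun n : PosCoroot b θ => (1 - MvPowerSeries.C r * mono n.1) ^ mult b θ n)
      (twistedDenom b θ r) :=
  (multipliable_of_mono_dvd _ Subtype.val_injective (mono_dvd_one_sub_pow_sub_one r)).hasProd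

lemma constantCoeff_twistedDenom (r : ℂ[X]) :
    MvPowerSeries.constantCoeff (twistedDenom b θ r) = 1 :=
  constantCoeff_eq_one_of_hasProd (hasProd_twistedDenom r) fun n =>
    constantCoeff_eq_one_of_dvd n.ne_zero (mono_dvd_one_sub_pow_sub_one r n)

lemma hasProd_denomFactor : HasProd (denomFactor b θ) (twistedDenom b θ X) := by
  refine (hasProd_twistedDenom X).congr_fun fun n => ?_
  rw [denomFactor, mono, ← MvPowerSeries.monomial_zero_eq_C, MvPowerSeries.monomial_mul_monomial,
    zero_add, mul_one]

lemma denomV_eq : denomV b θ = twistedDenom b θ X := formalProd_eq hasProd_denomFactor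

lemma hasFormalProd_denomV : HasFormalProd (denomFactor b θ) (denomV b θ) :=
  hasFormalProd_iff_hasProd.mpr (denomV_eq (b := b) (θ := θ) ▸ hasProd_denomFactor)

variable (b θ) in
/-- The inverse `∏ (1 - e^{-β})^{-m(β)}` of the Weyl-Kac denominator. -/
def denomInv : Qfin (Idx b) := ∏' n : PosCoroot b θ, geom n.1 ^ mult b θ n

lemma hasProd_denomInv :
    HasProd (fun n : PosCoroot b θ => geom n.1 ^ mult b θ n) (denomInv b θ) := by
  refine (multipliable_of_mono_dvd _ Subtype.val_injective fun n => dvd_pow_sub_one ?_ _).hasProd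
  exact ⟨geom n.1, by linear_combination one_sub_mono_mul_geom (PosCoroot.ne_zero n)⟩

lemma twistedDenom_one_mul_denomInv : twistedDenom b θ 1 * denomInv b θ = 1 := by
  have hprod := (hasProd_twistedDenom (b := b) (θ := θ) 1).mul hasProd_denomInv
  simp only [map_one, one_mul, ← mul_pow, one_sub_mono_mul_geom (PosCoroot.ne_zero _), one_pow]
    at hprod
  exact hprod.unique hasProd_one

variable [CharZero k]

lemma mult_of_isReal {n : PosCoroot b θ} (h : IsReal b θ (toLattice n.1)) : mult b θ n = 1 :=
  if_neg h.finPart_ne_zero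

variable [P.IsCrystallographic]

lemma invFactorRat_eq (w : weyl b θ) (n : PosCoroot b θ) :
    invFactorRat b θ w n = (1 - rexp (-w.1 (toLattice n.1)))⁻¹ := by
  change w.1 • (1 - rexp (-toLattice n.1))⁻¹ = _
  rw [smul_inv'', smul_sub, smul_one, smul_rexp, map_neg]

end PosCoroot

section SimplyLaced

variable {ι k M N : Type*} [Finite ι] [Field k] [CharZero k] [AddCommGroup M] [Module k M]
  [AddCommGroup N] [Module k N] {P : RootPairing ι k M N} [P.IsRootSystem] [P.IsCrystallographic]
  [P.IsReduced] {b : P.Base} {θ : ι} [hS : SimplyLacedAffine b θ]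

section PathLimit

lemma summable_pathC (u : weyl b θ) : Summable fun w => pathC w u :=
  summable_of_finite_coeff fun n =>
    (finite_len_le (b := b) (θ := θ) (len u + 2 * n.degree)).subset fun w hw =>
      len_le_of_coeff_pathSum_ne_zero (exists_reducedWord b θ w).choose_spec hw

variable (b θ) in
/-- The sum of all path weights that end at `1`; the end point turns out to be immaterial. -/
def pathLimit : Qfin (Idx b) := ∑' w : weyl b θ, pathC w 1

lemma tsum_pathC_mul_gen (u : weyl b θ) (i : Idx b) :
    ∑' w, pathC w (u * gen b θ i) = ∑' w, pathC w u := by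
  have hdouble (t : weyl b θ) : HasSum (fun w => pathC w t + pathC (w * gen b θ i) t)
      (∑' w, pathC w t + ∑' w, pathC w t) := by
    have hsum := (summable_pathC t).hasSum
    have hshift := (Equiv.mulRight (gen b θ i)).hasSum_iff.mpr hsum
    exact hsum.add hshift
  have hgen := hdouble (u * gen b θ i)
  simp only [pathC_add_pathC_mul_gen _ i u] at hgen
  exact add_self_injective (hgen.unique (hdouble u))

lemma hasSum_pathC (u : weyl b θ) : HasSum (fun w => pathC w u) (pathLimit b θ) := by
  have htsum : ∑' w, pathC w u = pathLimit b θ := by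
    induction u using wprod_induction with
    | one => rfl
    | mul_gen u i ih => rw [tsum_pathC_mul_gen, ih]
  exact htsum ▸ (summable_pathC u).hasSum

lemma hasSum_coeffC (u : weyl b θ) :
    HasSum (fun w => coeffC b θ u w) (invWt u * pathLimit b θ) := by
  simp only [coeffC_eq]
  exact (hasSum_pathC u).mul_left _

end PathLimit

section InverseDenominator

lemma IsAffineCoroot.weyl (w : weyl b θ) {x : Lattice b} (hx : IsAffineCoroot b θ x) :
    IsAffineCoroot b θ (w.1 x) :=
  ⟨fun h => hx.1 (w.1.map_eq_zero_iff.mp h),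
    hx.2.imp (fun h => IsReal.weyl w h) (finPart_weyl_eq_zero_iff w).mpr⟩

lemma PosCoroot.weyl_nonneg_or_nonpos (w : weyl b θ) (n : PosCoroot b θ) :
    0 ≤ w.1 (toLattice n.1) ∨ w.1 (toLattice n.1) ≤ 0 ∧ IsReal b θ (toLattice n.1) := by
  rcases n.2.2 with hreal | himag
  · exact (IsReal.weyl w hreal).nonneg_or_nonpos.imp_right fun hnonpos => ⟨hnonpos, hreal⟩
  · left
    rw [weyl_apply_of_finPart_eq_zero w himag]
    exact toLattice_nonneg _

lemma PosCoroot.toLattice_absCoords_weyl (w : weyl b θ) (n : PosCoroot b θ) :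
    toLattice (absCoords (w.1 (toLattice n.1))) = w.1 (toLattice n.1) ∨
      toLattice (absCoords (w.1 (toLattice n.1))) = -w.1 (toLattice n.1) :=
  (n.weyl_nonneg_or_nonpos w).imp toLattice_absCoords_of_nonneg
    fun h => toLattice_absCoords_of_nonpos h.1

lemma PosCoroot.isAffineCoroot_absCoords_weyl (w : weyl b θ) (n : PosCoroot b θ) :
    IsAffineCoroot b θ (toLattice (absCoords (w.1 (toLattice n.1)))) := by
  rcases n.toLattice_absCoords_weyl w with h | h <;> rw [h]
  · exact n.2.weyl w
  · exact (n.2.weyl w).neg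

lemma PosCoroot.absCoords_weyl_inv (w : weyl b θ) (n : PosCoroot b θ) :
    absCoords ((w⁻¹).1 (toLattice (absCoords (w.1 (toLattice n.1))))) = n.1 := by
  rcases n.toLattice_absCoords_weyl w with h | h <;> rw [h]
  · rw [weyl_inv_apply_apply, absCoords_toLattice]
  · rw [map_neg, absCoords_neg, weyl_inv_apply_apply, absCoords_toLattice]

/-- The permutation of the positive affine coroots that `w` induces up to signs. -/
def absPerm (w : weyl b θ) : Equiv.Perm (PosCoroot b θ) where
  toFun n := ⟨absCoords (w.1 (toLattice n.1)), n.isAffineCoroot_absCoords_weyl w⟩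
  invFun n := ⟨absCoords ((w⁻¹).1 (toLattice n.1)), n.isAffineCoroot_absCoords_weyl w⁻¹⟩
  left_inv n := Subtype.ext (n.absCoords_weyl_inv w)
  right_inv n := Subtype.ext (by
    have := n.absCoords_weyl_inv w⁻¹
    rwa [inv_inv] at this)

lemma toLattice_absPerm_of_nonneg {w : weyl b θ} {n : PosCoroot b θ}
    (h : 0 ≤ w.1 (toLattice n.1)) : toLattice (absPerm w n).1 = w.1 (toLattice n.1) :=
  toLattice_absCoords_of_nonneg h

lemma toLattice_absPerm_of_nonpos {w : weyl b θ} {n : PosCoroot b θ}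
    (h : w.1 (toLattice n.1) ≤ 0) : toLattice (absPerm w n).1 = -w.1 (toLattice n.1) :=
  toLattice_absCoords_of_nonpos h

lemma mult_absPerm (w : weyl b θ) (n : PosCoroot b θ) : mult b θ (absPerm w n) = mult b θ n := by
  classical
  have hfinPart :
      finPart b θ (toLattice (absPerm w n).1) = 0 ↔ finPart b θ (toLattice n.1) = 0 := by
    change finPart b θ (toLattice (absCoords (w.1 (toLattice n.1)))) = 0 ↔ _
    rcases n.toLattice_absCoords_weyl w with h | h <;> rw [h]
    · exact finPart_weyl_eq_zero_iff w
    · rw [map_neg, neg_eq_zero, finPart_weyl_eq_zero_iff]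
  simp only [mult, hfinPart]

lemma absPerm_mem_invSet_iff (w : weyl b θ) (n : PosCoroot b θ) :
    (absPerm w n).1 ∈ invSet w ↔ ¬ 0 ≤ w.1 (toLattice n.1) := by
  constructor
  · intro hmem hnonneg
    apply hmem.2
    rw [toLattice_absPerm_of_nonneg hnonneg, weyl_inv_apply_apply]
    exact toLattice_nonneg _
  · intro h
    obtain ⟨hnonpos, hreal⟩ := (n.weyl_nonneg_or_nonpos w).resolve_left h
    refine ⟨?_, ?_⟩ <;> rw [toLattice_absPerm_of_nonpos hnonpos]
    · exact (IsReal.weyl w hreal).neg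
    · rw [map_neg, weyl_inv_apply_apply, hreal.neg.not_nonneg_iff, neg_nonpos]
      exact toLattice_nonneg _

open Classical in
lemma expands_invFactorRat (w : weyl b θ) (n : PosCoroot b θ) :
    Expands (invFactorRat b θ w n)
      ((if (absPerm w n).1 ∈ invSet w then -mono (absPerm w n).1 else 1) *
        geom (absPerm w n).1) := by
  have hne : (absPerm w n).1 ≠ 0 := (absPerm w n).ne_zero
  rw [invFactorRat_eq]
  by_cases h : 0 ≤ w.1 (toLattice n.1)
  · rw [if_neg fun hmem => (absPerm_mem_invSet_iff w n).mp hmem h, one_mul,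
      ← toLattice_absPerm_of_nonneg h]
    exact expands_inv_one_sub_rexp_neg hne
  · rw [if_pos ((absPerm_mem_invSet_iff w n).mpr h), ← toLattice_absPerm_of_nonpos
      ((n.weyl_nonneg_or_nonpos w).resolve_left h).1]
    exact expands_inv_one_sub_rexp hne

open Classical in
lemma invFactor_eq (w : weyl b θ) (n : PosCoroot b θ) : invFactor b θ w n =
    (if (absPerm w n).1 ∈ invSet w then -mono (absPerm w n).1 else 1) *
      geom (absPerm w n).1 ^ mult b θ (absPerm w n) := by
  rw [invFactor, (expands_invFactorRat w n).expansion_eq, ← mult_absPerm w n]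
  by_cases h : (absPerm w n).1 ∈ invSet w
  · rw [mult_of_isReal h.1, pow_one, pow_one]
  · rw [if_neg h, one_mul, one_mul]

open Classical in
lemma hasProd_invWt (w : weyl b θ) :
    HasProd (fun n : PosCoroot b θ => if n.1 ∈ invSet w then -mono n.1 else 1) (invWt w) := by
  set S := (invSet_finite w).toFinset.subtype fun n => IsAffineCoroot b θ (toLattice n) with hS
  have hinvWt : invWt w = ∏ n ∈ S, if n.1 ∈ invSet w then -mono n.1 else 1 := by
    rw [Finset.prod_subtype_of_mem (f := fun n => if n ∈ invSet w then -mono n else 1), invWt]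
    · exact Finset.prod_congr rfl fun n hn =>
        (if_pos ((invSet_finite w).mem_toFinset.mp hn)).symm
    · intro n hn
      have hreal := ((invSet_finite w).mem_toFinset.mp hn).1
      exact ⟨hreal.ne_zero, Or.inl hreal⟩
  rw [hinvWt]
  refine hasProd_prod_of_ne_finset_one fun n hn => if_neg fun hmem => hn ?_
  rwa [hS, Finset.mem_subtype, Set.Finite.mem_toFinset]

lemma hasProd_invFactor (w : weyl b θ) :
    HasProd (invFactor b θ w) (invWt w * denomInv b θ) := by
  classical
  have hprod := (hasProd_invWt w).mul (hasProd_denomInv (b := b) (θ := θ))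
  exact ((absPerm w).hasProd_iff.mpr hprod).congr_fun (invFactor_eq w)

lemma invDenom_eq (w : weyl b θ) : invDenom b θ w = invWt w * denomInv b θ :=
  formalProd_eq (hasProd_invFactor w)

lemma hasFormalProd_invDenom (w : weyl b θ) : HasFormalProd (invFactor b θ w) (invDenom b θ w) :=
  hasFormalProd_iff_hasProd.mpr (invDenom_eq w ▸ hasProd_invFactor w)

end InverseDenominator

end SimplyLaced

section SimplePosCoroot

variable {ι k M N : Type*} [Field k] [CharZero k] [AddCommGroup M] [Module k M]
  [AddCommGroup N] [Module k N] {P : RootPairing ι k M N} {b : P.Base} {θ : ι}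

variable (b θ) in
/-- The simple affine coroot `a_i^∨` as a positive affine coroot. -/
def simplePosCoroot (i : Idx b) : PosCoroot b θ :=
  have hreal : IsReal b θ (toLattice (Finsupp.single i 1)) :=
    toLattice_single i ▸ isReal_simple b θ i
  ⟨Finsupp.single i 1, hreal.ne_zero, Or.inl hreal⟩

lemma toLattice_simplePosCoroot (i : Idx b) :
    toLattice (simplePosCoroot b θ i).1 = simpleCoroot b i := toLattice_single i

lemma mult_simplePosCoroot (i : Idx b) : mult b θ (simplePosCoroot b θ i) = 1 :=
  mult_of_isReal (toLattice_simplePosCoroot (θ := θ) i ▸ isReal_simple b θ i)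

open Classical in
variable (b θ) in
/-- The factors of `twistedDenom`, with the one at the simple coroot `a_i^∨` replaced by `1`. -/
def reducedFactor (r : ℂ[X]) (i : Idx b) (n : PosCoroot b θ) : Qfin (Idx b) :=
  if n = simplePosCoroot b θ i then 1 else (1 - MvPowerSeries.C r * mono n.1) ^ mult b θ n

lemma mono_dvd_reducedFactor_sub_one (r : ℂ[X]) (i : Idx b) (n : PosCoroot b θ) :
    mono n.1 ∣ reducedFactor b θ r i n - 1 := by
  rw [reducedFactor]
  split_ifs
  · rw [sub_self]
    exact dvd_zero _
  · exact mono_dvd_one_sub_pow_sub_one r n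

end SimplePosCoroot

section SimplyLaced

variable {ι k M N : Type*} [Finite ι] [Field k] [CharZero k] [AddCommGroup M] [Module k M]
  [AddCommGroup N] [Module k N] {P : RootPairing ι k M N} [P.IsRootSystem] [P.IsCrystallographic]
  [P.IsReduced] {b : P.Base} {θ : ι} [hS : SimplyLacedAffine b θ]

section InvariantSeries

/-- The pairings of `x` with the simple roots, weighted by the positive coefficients of `c`, sum to
the pairing of `x` with `c`, which vanishes. -/
lemma finPart_eq_zero_of_simplePairing_nonpos {x : Lattice b}
    (h : ∀ i, simplePairing b θ i x ≤ 0) : finPart b θ x = 0 := by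
  have hsum := form_eq_zero_of_finPart (finPart_minImag b θ) x
  rw [form_eq_sum, Finsupp.sum_fintype _ _ fun i => zero_mul _] at hsum
  refine finPart_eq_zero_of_simplePairing fun i => ?_
  have hterm := (Finset.sum_eq_zero_iff_of_nonpos fun i _ =>
    mul_nonpos_of_nonneg_of_nonpos (minImag_nonneg (θ := θ) i) (h i)).mp hsum i (Finset.mem_univ i)
  exact (mul_eq_zero.mp hterm).resolve_left (zero_lt_one.trans_le (one_le_minImag i)).ne'

/-- An element of least height in the `W`-orbit of an exponent is paired non-positively with all
simple roots, hence imaginary. -/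
lemma isImagSeries_of_invariant {c : Qfin (Idx b)}
    (h : ∀ (w : weyl b θ) x, coeffExp c (w.1 x) = coeffExp c x) : IsImagSeries b θ c := by
  intro n hn
  have horbit (w : weyl b θ) : ∃ m, toLattice m = w.1 (toLattice n) := by
    refine exists_toLattice_eq ?_
    rw [← coeffExp_neg_toLattice, ← h w] at hn
    have hnonpos := nonpos_of_coeffExp_ne_zero hn
    rwa [map_neg, neg_nonpos] at hnonpos
  choose m hm using horbit
  obtain ⟨w, hw⟩ : ∃ w, ∀ w', (m w).degree ≤ (m w').degree :=
    ⟨_, fun w' => Function.argmin_le (fun w => (m w).degree) w'⟩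
  have himag : finPart b θ (toLattice (m w)) = 0 := by
    refine finPart_eq_zero_of_simplePairing_nonpos fun i => ?_
    have hht := congrArg ht (hm (gen b θ i * w))
    rw [weyl_mul_apply, gen_apply, ← hm w, ht_simpleReflection, ht_toLattice, ht_toLattice] at hht
    have hmin := hw (gen b θ i * w)
    omega
  rw [hm w, finPart_weyl_eq_zero_iff] at himag
  refine ⟨n none, ?_⟩
  rw [← natCast_zsmul]
  exact eq_smul_minImag himag

end InvariantSeries

section InversionSum

lemma mono_sum_dvd_invWt (u : weyl b θ) :
    mono (∑ n ∈ (invSet_finite u).toFinset, n) ∣ invWt u := by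
  have hprod := MvPowerSeries.prod_monomial (R := ℂ[X]) id (fun _ => 1) (invSet_finite u).toFinset
  rw [Finset.prod_const_one] at hprod
  rw [mono, invWt]
  exact hprod ▸ Finset.prod_dvd_prod_of_dvd _ _ fun n _ => (dvd_neg.mpr dvd_rfl)

lemma len_le_of_coeff_invWt_ne_zero {u : weyl b θ} {n : Idx b →₀ ℕ}
    (h : MvPowerSeries.coeff n (invWt u) ≠ 0) : len u ≤ n.degree := by
  obtain ⟨g, hg⟩ := mono_sum_dvd_invWt u
  rw [hg] at h
  obtain ⟨d, rfl⟩ := exists_add_of_le (le_of_coeff_mono_mul_ne_zero h)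
  rw [map_add, map_sum, ← ncard_invSet, Set.ncard_eq_toFinset_card _ (invSet_finite u),
    Finset.card_eq_sum_ones]
  refine (Finset.sum_le_sum fun m hm => ?_).trans (Nat.le_add_right _ _)
  rw [Nat.one_le_iff_ne_zero, Ne, Finsupp.degree_eq_zero_iff]
  rintro rfl
  exact ((invSet_finite u).mem_toFinset.mp hm).1.ne_zero toLattice_zero

lemma coeffExp_invWt_mul_gen (u : weyl b θ) (i : Idx b) (x : Lattice b) :
    coeffExp (invWt (u * gen b θ i)) x = -coeffExp (invWt u) (x + u.1 (simpleCoroot b i)) := by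
  by_cases h : 0 ≤ u.1 (simpleCoroot b i)
  · rw [invWt_mul_gen h, neg_mul, coeffExp_neg, coeffExp_mono_mul, toLattice_posImage_of_nonneg h]
  · have hnonneg := nonneg_mul_gen h
    have hwt := invWt_mul_gen hnonneg
    rw [mul_gen_mul_gen] at hwt
    rw [hwt, neg_mul, coeffExp_neg, coeffExp_mono_mul, toLattice_posImage_of_nonneg hnonneg,
      mul_gen_apply_simple, neg_neg, add_neg_cancel_right]

lemma coeffExp_invWt_gen_mul (i : Idx b) (u : weyl b θ) (x : Lattice b) :
    coeffExp (invWt (gen b θ i * u)) (simpleReflection b θ i x - simpleCoroot b i) =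
      -coeffExp (invWt u) x := by
  induction u using wprod_induction generalizing x with
  | one =>
    rw [mul_one, ← one_mul (gen b θ i), coeffExp_invWt_mul_gen, invWt_one]
    change -coeffExp 1 (simpleReflection b θ i x - simpleCoroot b i + simpleCoroot b i) = _
    rw [sub_add_cancel, translates_one]
  | mul_gen u j ih =>
    rw [← mul_assoc, coeffExp_invWt_mul_gen, coeffExp_invWt_mul_gen, weyl_mul_apply, gen_apply,
      sub_add_eq_add_sub, ← map_add, ih]

lemma summable_invWt : Summable (invWt : weyl b θ → Qfin (Idx b)) :=
  summable_of_finite_coeff fun n => (finite_len_le (b := b) (θ := θ) n.degree).subset fun _ hu =>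
    len_le_of_coeff_invWt_ne_zero hu

variable (b θ) in
/-- The sum over `w ∈ W` of the products of the `-e^{-β}` over the inversions `β` of `w⁻¹`. -/
def invSum : Qfin (Idx b) := ∑' u : weyl b θ, invWt u

lemma hasSum_invWt : HasSum (invWt : weyl b θ → Qfin (Idx b)) (invSum b θ) := summable_invWt.hasSum

lemma constantCoeff_invSum : MvPowerSeries.constantCoeff (invSum b θ) = 1 := by
  have hcoeff := (hasSum_invWt (b := b) (θ := θ)).map (MvPowerSeries.constantCoeff (R := ℂ[X]))
    (MvPowerSeries.WithPiTopology.continuous_constantCoeff ℂ[X])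
  have hsingle (u : weyl b θ) (hu : u ≠ 1) : MvPowerSeries.constantCoeff (invWt u) = 0 := by
    by_contra h
    have hlen := len_le_of_coeff_invWt_ne_zero (n := 0) h
    rw [map_zero, Nat.le_zero] at hlen
    exact hu (eq_one_of_len_eq_zero hlen)
  rw [hcoeff.unique (hasSum_single 1 hsingle), invWt_one, map_one]

lemma isSkew_invSum (i : Idx b) : IsSkew (simpleReflection b θ i) i (invSum b θ) := by
  have hshift := (Equiv.mulLeft (gen b θ i)).hasSum_iff.mpr (hasSum_invWt (b := b) (θ := θ))
  exact isSkew_of_hasSum (coeffExp_invWt_gen_mul i) hasSum_invWt hshift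

lemma exists_invSum_eq_mul (i : Idx b) : ∃ J, invSum b θ = (1 - mono (Finsupp.single i 1)) * J ∧
    MvPowerSeries.constantCoeff J = 1 ∧ Translates (simpleReflection b θ i) J J := by
  have hne : (Finsupp.single i 1 : Idx b →₀ ℕ) ≠ 0 := Finsupp.single_ne_zero.mpr one_ne_zero
  have hmul : invSum b θ =
      (1 - mono (Finsupp.single i 1)) * (geom (Finsupp.single i 1) * invSum b θ) := by
    rw [← mul_assoc, one_sub_mono_mul_geom hne, one_mul]
  refine ⟨geom (Finsupp.single i 1) * invSum b θ, hmul, ?_, ?_⟩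
  · have hcoeff := congrArg MvPowerSeries.constantCoeff hmul
    rwa [map_mul, map_sub, map_one, constantCoeff_mono hne, sub_zero, one_mul,
      constantCoeff_invSum, eq_comm] at hcoeff
  · refine IsSkew.translates (simpleReflection_apply b θ i) (simpleReflection_self i) ?_
    exact hmul ▸ isSkew_invSum i

end InversionSum

section DenominatorReflection

lemma absPerm_gen_simplePosCoroot (i : Idx b) :
    absPerm (gen b θ i) (simplePosCoroot b θ i) = simplePosCoroot b θ i := by
  have hneg : (gen b θ i).1 (toLattice (simplePosCoroot b θ i).1) = -simpleCoroot b i := by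
    rw [toLattice_simplePosCoroot, gen_apply, simpleReflection_self]
  refine Subtype.ext (toLattice_injective ?_)
  rw [toLattice_absPerm_of_nonpos (hneg.trans_le (neg_nonpos.mpr (simpleCoroot_nonneg i))), hneg,
    neg_neg, toLattice_simplePosCoroot]

lemma toLattice_absPerm_gen {i : Idx b} {n : PosCoroot b θ} (hn : n ≠ simplePosCoroot b θ i) :
    toLattice (absPerm (gen b θ i) n).1 = simpleReflection b θ i (toLattice n.1) := by
  refine toLattice_absPerm_of_nonneg ?_
  rcases n.2.2 with hreal | himag
  · refine IsReal.simpleReflection_nonneg hreal (toLattice_nonneg _) fun h => hn ?_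
    exact Subtype.ext (toLattice_injective (h.trans (toLattice_simplePosCoroot i).symm))
  · rw [weyl_apply_of_finPart_eq_zero _ himag]
    exact toLattice_nonneg _

lemma translates_reducedFactor (r : ℂ[X]) (i : Idx b) (n : PosCoroot b θ) :
    Translates (simpleReflection b θ i) (reducedFactor b θ r i n)
      (reducedFactor b θ r i (absPerm (gen b θ i) n)) := by
  by_cases hn : n = simplePosCoroot b θ i
  · rw [hn, absPerm_gen_simplePosCoroot, reducedFactor, if_pos rfl]
    exact translates_one
  · have hn' : absPerm (gen b θ i) n ≠ simplePosCoroot b θ i := by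
      rwa [← absPerm_gen_simplePosCoroot, (absPerm (gen b θ i)).injective.ne_iff]
    rw [reducedFactor, reducedFactor, if_neg hn, if_neg hn', mult_absPerm]
    refine (translates_one.sub ((translates_mono ?_).C_mul r)).pow _
    rw [toLattice_absPerm_gen hn, simpleReflection_simpleReflection]

lemma exists_twistedDenom_eq_mul (r : ℂ[X]) (i : Idx b) :
    ∃ G, twistedDenom b θ r = (1 - MvPowerSeries.C r * mono (Finsupp.single i 1)) * G ∧
      MvPowerSeries.constantCoeff G = 1 ∧ Translates (simpleReflection b θ i) G G := by
  classical
  have hdvd := mono_dvd_reducedFactor_sub_one (b := b) (θ := θ) r i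
  have hG := (multipliable_of_mono_dvd _ Subtype.val_injective hdvd).hasProd
  refine ⟨∏' n, reducedFactor b θ r i n, ?_, constantCoeff_eq_one_of_hasProd hG fun n =>
    constantCoeff_eq_one_of_dvd (PosCoroot.ne_zero n) (hdvd n), ?_⟩
  · have hprod := (hasProd_ite_eq (simplePosCoroot b θ i)
      (1 - MvPowerSeries.C r * mono (Finsupp.single i 1))).mul hG
    refine (hasProd_twistedDenom r).unique (hprod.congr_fun fun n => ?_)
    rw [reducedFactor]
    split_ifs with hn
    · rw [hn, mult_simplePosCoroot, pow_one, mul_one]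
      rfl
    · rw [one_mul]
  · have hshift := (absPerm (gen b θ i)).hasProd_iff.mpr hG
    exact Translates.hasProd (translates_reducedFactor r i) hG hshift

end DenominatorReflection

end SimplyLaced

/-! ### The action on the constant function -/

section LaurentExpansion

variable {I : Type*}

lemma one_sub_single_dvd_single_zsmul_sub_one (a : I →₀ ℤ) (m : ℤ) :
    (1 - AddMonoidAlgebra.single a 1 : Laurent I) ∣ AddMonoidAlgebra.single (m • a) 1 - 1 := by
  have hnat (m : ℕ) : (1 - AddMonoidAlgebra.single a 1 : Laurent I) ∣
      1 - AddMonoidAlgebra.single ((m : ℤ) • a) 1 := by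
    have hpow := sub_dvd_pow_sub_pow (1 : Laurent I) (AddMonoidAlgebra.single a 1) m
    rwa [one_pow, AddMonoidAlgebra.single_pow, one_pow, ← natCast_zsmul] at hpow
  obtain ⟨n, rfl | rfl⟩ := m.eq_nat_or_neg
  · rw [dvd_sub_comm]
    exact hnat n
  · have hneg : (AddMonoidAlgebra.single ((-(n : ℤ)) • a) 1 - 1 : Laurent I) =
        (1 - AddMonoidAlgebra.single ((n : ℤ) • a) 1) *
          AddMonoidAlgebra.single ((-(n : ℤ)) • a) 1 := by
      rw [sub_mul, one_mul, AddMonoidAlgebra.single_mul_single, neg_smul, add_neg_cancel, mul_one]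
      rfl
    rw [hneg]
    exact (hnat n).mul_right _

section Reflection

variable {s : (I →₀ ℤ) ≃ₗ[ℤ] (I →₀ ℤ)} {c : (I →₀ ℤ) → ℤ} {a : I →₀ ℤ}

lemma one_sub_single_dvd_smul_sub (hs : ∀ x, s x = x - c x • a) (p : Laurent I) :
    (1 - AddMonoidAlgebra.single a 1 : Laurent I) ∣ s • p - p := by
  induction p using AddMonoidAlgebra.induction_linear with
  | zero => simp
  | add p q hp hq =>
    rw [smul_add, add_sub_add_comm]
    exact dvd_add hp hq
  | single x r =>
    have hmul : s • (AddMonoidAlgebra.single x r : Laurent I) - AddMonoidAlgebra.single x r =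
        (AddMonoidAlgebra.single ((-c x) • a) 1 - 1) * AddMonoidAlgebra.single x r := by
      rw [smul_single_laurent, hs, sub_mul, one_mul, AddMonoidAlgebra.single_mul_single, one_mul,
        neg_smul, neg_add_eq_sub]
    rw [hmul]
    exact (one_sub_single_dvd_single_zsmul_sub_one a (-c x)).mul_right _

lemma exists_laurent_eq_cFun_mul_add_bFun_mul (hs : ∀ x, s x = x - c x • a) (ha : a ≠ 0)
    (p : Laurent I) : ∃ q : Laurent I,
      cFun a * (s • algebraMap (Laurent I) (RatFun I) p) + bFun a * algebraMap _ _ p =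
        algebraMap _ _ q := by
  obtain ⟨d, hd⟩ := one_sub_single_dvd_smul_sub hs p
  have hdiff := congrArg (algebraMap (Laurent I) (RatFun I)) hd
  rw [map_sub, map_mul, map_sub, map_one, ← rexp] at hdiff
  refine ⟨(1 - AddMonoidAlgebra.single 0 X) * d -
    AddMonoidAlgebra.single 0 X * AddMonoidAlgebra.single (-a) 1 * (s • p), ?_⟩
  have ha' := one_sub_rexp_ne_zero ha
  rw [smul_algebraMap_laurent, map_sub, map_mul, map_mul, map_mul, map_sub, map_one, ← vinv,
    ← rexp, cFun, bFun]
  field_simp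
  linear_combination (1 - vinv) * hdiff -
    vinv * algebraMap (Laurent I) (RatFun I) (s • p) * rexp_neg_mul a

end Reflection

lemma expands_C (r : ℂ[X]) :
    Expands (algebraMap (Laurent I) (RatFun I) (AddMonoidAlgebra.single 0 r))
      (MvPowerSeries.C r) := by
  rw [Expands, ratToFrac_algebraMap, laurentToFrac_single, ofAdd_zero, map_one,
    Algebra.smul_def, mul_one, IsScalarTower.algebraMap_apply ℂ[X] (Qfin I)]
  rfl

lemma exists_expands_single (x : I →₀ ℤ) (r : ℂ[X]) : ∃ (m : I →₀ ℕ) (g : Qfin I),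
    Expands (rexp (-toLattice m) *
      algebraMap (Laurent I) (RatFun I) (AddMonoidAlgebra.single x r)) g ∧
      ∀ y, coeffExp g (y - toLattice m) = (AddMonoidAlgebra.single x r : Laurent I).coeff y := by
  classical
  obtain ⟨m, hm⟩ := exists_toLattice_eq (x := x ⊔ 0) le_sup_right
  have hxm : x - toLattice m ≤ 0 := by
    rw [hm, sub_nonpos]
    exact le_sup_left
  obtain ⟨n, hn⟩ := exists_eq_neg_toLattice hxm
  refine ⟨m, MvPowerSeries.C r * mono n, ?_, fun y => ?_⟩
  · have hsplit : rexp (-toLattice m) *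
          algebraMap (Laurent I) (RatFun I) (AddMonoidAlgebra.single x r) =
        algebraMap (Laurent I) (RatFun I) (AddMonoidAlgebra.single 0 r) * rexp (-toLattice n) := by
      rw [← hn, rexp, rexp, ← map_mul, ← map_mul, AddMonoidAlgebra.single_mul_single,
        AddMonoidAlgebra.single_mul_single, one_mul, mul_one, zero_add, neg_add_eq_sub]
    rw [hsplit]
    exact (expands_C r).mul (expands_rexp n)
  · have hmono := coeffExp_mono_mul n 1 (y - toLattice m)
    have hiff : y - toLattice m + toLattice n = 0 ↔ x = y := by
      rw [← neg_eq_iff_eq_neg.mpr hn, neg_sub, sub_add_sub_cancel, sub_eq_zero, eq_comm]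
    rw [mul_one, coeffExp_one] at hmono
    rw [coeffExp_C_mul, hmono, AddMonoidAlgebra.coeff_single, Finsupp.single_apply]
    simp only [hiff, mul_ite, mul_one, mul_zero]

lemma exists_expands_laurent (p : Laurent I) : ∃ (m : I →₀ ℕ) (g : Qfin I),
    Expands (rexp (-toLattice m) * algebraMap (Laurent I) (RatFun I) p) g ∧
      ∀ x, coeffExp g (x - toLattice m) = p.coeff x := by
  induction p using AddMonoidAlgebra.induction_linear with
  | zero =>
    refine ⟨0, 0, ?_, fun x => map_zero (coeffExpHom _)⟩
    rw [map_zero, mul_zero]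
    exact expands_zero
  | add p p' hp hp' =>
    obtain ⟨m, g, hg, hcoeff⟩ := hp
    obtain ⟨m', g', hg', hcoeff'⟩ := hp'
    refine ⟨m + m', mono m' * g + mono m * g', ?_, fun x => ?_⟩
    · have hsplit : rexp (-toLattice (m + m')) * algebraMap (Laurent I) (RatFun I) (p + p') =
          rexp (-toLattice m') * (rexp (-toLattice m) * algebraMap (Laurent I) (RatFun I) p) +
          rexp (-toLattice m) * (rexp (-toLattice m') * algebraMap (Laurent I) (RatFun I) p') := by
        rw [toLattice_add, neg_add, rexp_add, map_add]
        ring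
      rw [hsplit]
      exact ((expands_rexp m').mul hg).add ((expands_rexp m).mul hg')
    · rw [coeffExp_add, coeffExp_mono_mul, coeffExp_mono_mul, toLattice_add,
        AddMonoidAlgebra.coeff_add, Finsupp.add_apply, ← hcoeff, ← hcoeff']
      congr 2 <;> abel
  | single x r => exact exists_expands_single x r

lemma coeffExp_of_expands_laurent {p : Laurent I} {g : Qfin I}
    (h : Expands (algebraMap (Laurent I) (RatFun I) p) g) (x : I →₀ ℤ) :
    coeffExp g x = p.coeff x := by
  obtain ⟨m, g', hg', hcoeff⟩ := exists_expands_laurent p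
  rw [← hcoeff, hg'.unique ((expands_rexp m).mul h), coeffExp_mono_mul, sub_add_cancel]

end LaurentExpansion

section Augmentation

variable {ι k M N : Type*} [Field k] [CharZero k] [AddCommGroup M] [Module k M]
  [AddCommGroup N] [Module k N] {P : RootPairing ι k M N} [P.IsCrystallographic]
  {b : P.Base} {θ : ι}

/-- The sum of the coefficients of an element of `R[W]`, that is, its value at the vector `1` of
the `R[W]`-module `R`. -/
def aug : RW b θ →+ RatFun (Idx b) where
  toFun Y := Y.coeff.sum fun _ r => r
  map_zero' := Finsupp.sum_zero_index
  map_add' Y Z := by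
    rw [SkewMonoidAlgebra.coeff_add]
    exact Finsupp.sum_add_index' (h := fun _ r => r) (fun _ => rfl) fun _ _ _ => rfl

lemma aug_single (w : weyl b θ) (r : RatFun (Idx b)) :
    aug (SkewMonoidAlgebra.single w r : RW b θ) = r := by
  change (SkewMonoidAlgebra.single w r : RW b θ).coeff.sum (fun _ r => r) = _
  rw [SkewMonoidAlgebra.coeff_single]
  exact Finsupp.sum_single_index (h := fun _ r => r) rfl

lemma aug_simpleT_mul (i : Idx b) (Y : RW b θ) : aug (simpleT b θ i * Y) =
    cFun (simpleCoroot b i) * (simpleReflection b θ i • aug Y) +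
      bFun (simpleCoroot b i) * aug Y := by
  induction Y using SkewMonoidAlgebra.induction_on with
  | zero => rw [mul_zero, map_zero, smul_zero, mul_zero, mul_zero, add_zero]
  | single w r =>
    rw [simpleT, add_mul, SkewMonoidAlgebra.single_mul_single, SkewMonoidAlgebra.single_mul_single,
      map_add, aug_single, aug_single, aug_single, one_smul]
    rfl
  | add Y Z hY hZ =>
    rw [mul_add, map_add, map_add, hY, hZ, smul_add]
    ring

lemma exists_aug_wordT_eq (l : List (Idx b)) :
    ∃ p, aug (wordT b θ l) = algebraMap (Laurent (Idx b)) _ p := by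
  induction l with
  | nil =>
    refine ⟨1, ?_⟩
    change aug (1 : RW b θ) = _
    rw [map_one (algebraMap (Laurent (Idx b)) (RatFun (Idx b))), SkewMonoidAlgebra.one_def,
      aug_single]
  | cons i l ih =>
    obtain ⟨p, hp⟩ := ih
    rw [wordT_cons, aug_simpleT_mul, hp]
    exact exists_laurent_eq_cFun_mul_add_bFun_mul (simpleReflection_apply b θ i)
      (simpleCoroot_ne_zero i) p

/-- The expansion of the sum of the coefficients of `T_w`. -/
def augSeries (w : weyl b θ) : Qfin (Idx b) := ∑ u ∈ (elemT b θ w).coeff.support, coeffC b θ u w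

lemma coeffC_eq_zero {u w : weyl b θ} (h : u ∉ (elemT b θ w).coeff.support) :
    coeffC b θ u w = 0 := by
  rw [coeffC, Finsupp.notMem_support_iff.mp h]
  exact expands_zero.expansion_eq

end Augmentation

section AntiInvariance

variable {I : Type*} {s : (I →₀ ℤ) ≃ₗ[ℤ] (I →₀ ℤ)} {a : I →₀ ℤ}

lemma one_sub_rexp_mul_inv_mul_add_eq (ha : a ≠ 0) (hv : 1 - vinv * rexp (-a) ≠ 0)
    (f g : RatFun I) : (1 - rexp (-a)) * ((1 - vinv * rexp (-a))⁻¹ *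
      (f + (cFun a * g + bFun a * f))) = f - rexp (-a) * g := by
  have ha' := one_sub_rexp_ne_zero ha
  rw [cFun, bFun, mul_left_comm, inv_mul_eq_iff_eq_mul₀ hv]
  field_simp
  linear_combination (f * (1 - vinv) - g + rexp (-a) * vinv * g) * rexp_neg_mul a

lemma coeff_sub_single_mul_smul (hs : ∀ x, s (s x) = x) (p : Laurent I) (x : I →₀ ℤ) :
    (p - AddMonoidAlgebra.single (-a) 1 * (s • p)).coeff x = p.coeff x - p.coeff (s (x + a)) := by
  rw [AddMonoidAlgebra.coeff_sub, Finsupp.sub_apply,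
    AddMonoidAlgebra.coeff_single_mul_eq_mul_coeff (x + a), one_mul]
  · have hcoeff := coeff_smul_laurent s p (s (x + a))
    rw [hs] at hcoeff
    rw [hcoeff]
  · intro z _
    rw [neg_add_eq_iff_eq_add, add_comm]

lemma coeff_sub_single_mul_smul_apply_sub (hs : ∀ x, s (s x) = x) (ha : s a = -a) (p : Laurent I)
    (x : I →₀ ℤ) : (p - AddMonoidAlgebra.single (-a) 1 * (s • p)).coeff (s x - a) =
      -(p - AddMonoidAlgebra.single (-a) 1 * (s • p)).coeff x := by
  rw [coeff_sub_single_mul_smul hs, coeff_sub_single_mul_smul hs, sub_add_cancel, hs, map_add, ha,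
    ← sub_eq_add_neg, neg_sub]

end AntiInvariance

section SkewAugmentation

variable {ι k M N : Type*} [Finite ι] [Field k] [CharZero k] [AddCommGroup M] [Module k M]
  [AddCommGroup N] [Module k N] {P : RootPairing ι k M N} [P.IsRootSystem] [P.IsCrystallographic]
  [P.IsReduced] {b : P.Base} {θ : ι} [hS : SimplyLacedAffine b θ]

lemma expands_aug_elemT (w : weyl b θ) : Expands (aug (elemT b θ w)) (augSeries w) := by
  have haug : aug (elemT b θ w) =
      ∑ u ∈ (elemT b θ w).coeff.support, (elemT b θ w).coeff u := rfl
  rw [haug, Expands, augSeries, map_sum, map_sum]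
  exact Finset.sum_congr rfl fun u _ => (expands_elemT_coeff w u).expansion

/-- If `s_i w > w` and `f = aug T_w`, then the series is the expansion of the Laurent polynomial
`f - e^{-a_i^∨} f^{s_i}`. -/
lemma isSkew_augSeries_add {i : Idx b} {g : Qfin (Idx b)}
    (hg : (1 - vinvSeries * mono (Finsupp.single i 1)) * g = 1) (w : weyl b θ) :
    IsSkew (simpleReflection b θ i) i ((1 - mono (Finsupp.single i 1)) *
      (g * (augSeries w + augSeries (gen b θ i * w)))) := by
  wlog hw : 0 ≤ (w⁻¹).1 (simpleCoroot b i) generalizing w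
  · have hflip := this (gen b θ i * w) (by
      rw [inv_gen_mul_apply_simple, neg_nonneg]
      exact ((isReal_simple b θ i).weyl w⁻¹).not_nonneg_iff.mp hw)
    rwa [gen_mul_gen_mul, add_comm (augSeries (gen b θ i * w))] at hflip
  obtain ⟨p, hp⟩ := exists_aug_wordT_eq (θ := θ) (exists_reducedWord b θ w).choose
  rw [← elemT] at hp
  have hone := expands_one.sub (expands_rexp (Finsupp.single i 1))
  have hvinv := expands_one.sub (expands_vinv.mul (expands_rexp (Finsupp.single i 1)))
  have hexpands := hone.mul ((hvinv.inv hg).mul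
    ((expands_aug_elemT w).add (expands_aug_elemT (gen b θ i * w))))
  have hlaurent : (1 - rexp (-toLattice (Finsupp.single i 1))) *
      ((1 - vinv * rexp (-toLattice (Finsupp.single i 1)))⁻¹ *
        (aug (elemT b θ w) + aug (elemT b θ (gen b θ i * w)))) = algebraMap _ _
      (p - AddMonoidAlgebra.single (-simpleCoroot b i) 1 * (simpleReflection b θ i • p)) := by
    have hcoroot : toLattice (Finsupp.single i 1) = simpleCoroot b i := toLattice_single i
    rw [hcoroot] at hvinv ⊢
    rw [elemT_gen_mul hw, aug_simpleT_mul, one_sub_rexp_mul_inv_mul_add_eq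
      (simpleCoroot_ne_zero i) (hvinv.ne_zero (left_ne_zero_of_mul_eq_one hg)), hp,
      smul_algebraMap_laurent, rexp, map_sub, map_mul]
  rw [hlaurent] at hexpands
  intro x
  have hskew := coeff_sub_single_mul_smul_apply_sub (s := simpleReflection b θ i)
    (simpleReflection_simpleReflection i) (simpleReflection_self i) p x
  rw [← coeffExp_of_expands_laurent hexpands, ← coeffExp_of_expands_laurent hexpands] at hskew
  exact hskew

end SkewAugmentation

lemma Translates.of_add_self {I : Type*} {s : (I →₀ ℤ) ≃ₗ[ℤ] (I →₀ ℤ)} {f g : Qfin I}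
    (h : Translates s (f + f) (g + g)) : Translates s f g := fun x => by
  have hdouble := h x
  rw [coeffExp_add, coeffExp_add, ← two_mul, ← two_mul] at hdouble
  exact mul_left_cancel₀ two_ne_zero hdouble

section WeylInvariance

variable {ι k M N : Type*} [Field k] [CharZero k] [AddCommGroup M] [Module k M]
  [AddCommGroup N] [Module k N] {P : RootPairing ι k M N} [P.IsCrystallographic]
  {b : P.Base} {θ : ι}

lemma coeffExp_weyl_apply {c : Qfin (Idx b)} (h : ∀ i, Translates (simpleReflection b θ i) c c)
    (w : weyl b θ) (x : Lattice b) : coeffExp c (w.1 x) = coeffExp c x := by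
  induction w using wprod_induction generalizing x with
  | one => rfl
  | mul_gen u i ih =>
    rw [weyl_mul_apply, ih]
    exact h i x

end WeylInvariance

variable {ι k M N : Type*} [Finite ι] [Field k] [CharZero k] [AddCommGroup M] [Module k M]
  [AddCommGroup N] [Module k N] {P : RootPairing ι k M N} [P.IsRootSystem] [P.IsCrystallographic]
  [P.IsReduced] {b : P.Base} {θ : ι} [hS : SimplyLacedAffine b θ]

lemma summable_coeffC :
    Summable fun p : weyl b θ × weyl b θ => coeffC b θ p.1 p.2 := by
  refine summable_of_finite_coeff fun n => ((finite_len_le (b := b) (θ := θ) n.degree).prod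
    (finite_len_le (b := b) (θ := θ) (n.degree + 2 * n.degree))).subset ?_
  rintro ⟨u, w⟩ h
  rw [Set.mem_ofPred_eq, coeffC_eq] at h
  obtain ⟨m₁, m₂, hm, hinv, hpath⟩ := exists_coeff_ne_zero_of_mul h
  have hu : len u ≤ m₁.degree := len_le_of_coeff_invWt_ne_zero hinv
  have hw : len w ≤ len u + 2 * m₂.degree :=
    len_le_of_coeff_pathSum_ne_zero (exists_reducedWord b θ w).choose_spec hpath
  rw [Set.mem_prod, Set.mem_ofPred_eq, Set.mem_ofPred_eq, ← hm, map_add]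
  change len u ≤ _ ∧ len w ≤ _
  omega

/-- Sum the `C_u(w)` in both orders. -/
lemma hasSum_augSeries : HasSum (augSeries : weyl b θ → Qfin (Idx b))
    (invSum b θ * pathLimit b θ) := by
  have : RegularSpace (Qfin (Idx b)) := inferInstanceAs (RegularSpace ((Idx b →₀ ℕ) → ℂ[X]))
  obtain ⟨S, hsum⟩ := summable_coeffC (b := b) (θ := θ)
  have hfirst : HasSum (fun u => invWt u * pathLimit b θ) S := hsum.prod_fiberwise hasSum_coeffC
  have hswap := (Equiv.prodComm (weyl b θ) (weyl b θ)).hasSum_iff.mpr hsum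
  have haug (w : weyl b θ) : HasSum (fun u => coeffC b θ u w) (augSeries w) :=
    hasSum_sum_of_ne_finset_zero fun u hu => coeffC_eq_zero hu
  rw [← hfirst.unique (hasSum_invWt.mul_right (pathLimit b θ))]
  exact hswap.prod_fiberwise haug

lemma translates_mul_invSum_mul_pathLimit {i : Idx b} {g : Qfin (Idx b)}
    (hg : (1 - vinvSeries * mono (Finsupp.single i 1)) * g = 1) :
    Translates (simpleReflection b θ i) (g * (invSum b θ * pathLimit b θ))
      (g * (invSum b θ * pathLimit b θ)) := by
  have hshift := (Equiv.mulLeft (gen b θ i)).hasSum_iff.mpr (hasSum_augSeries (b := b) (θ := θ))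
  have hsum := ((hasSum_augSeries.add hshift).mul_left g).mul_left (1 - mono (Finsupp.single i 1))
  have hskew := isSkew_of_hasSum (fun w => isSkew_augSeries_add hg w) hsum hsum
  rw [mul_add] at hskew
  exact (hskew.translates (simpleReflection_apply b θ i) (simpleReflection_self i)).of_add_self

/-- With the factors at `a_i^∨` split off, `invSum * pathLimit`, `invSum` and the two denominators
are `s_i`-invariant, and the split off factors cancel in `c`. -/
lemma translates_of_mul_denomV_eq {c : Qfin (Idx b)}
    (hc : c * denomV b θ = pathLimit b θ * twistedDenom b θ 1) (i : Idx b) :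
    Translates (simpleReflection b θ i) c c := by
  obtain ⟨g, hg⟩ : ∃ g : Qfin (Idx b), (1 - vinvSeries * mono (Finsupp.single i 1)) * g = 1 := by
    refine (MvPowerSeries.isUnit_iff_constantCoeff.mpr ?_).exists_right_inv
    rw [map_sub, map_mul, constantCoeff_mono (Finsupp.single_ne_zero.mpr one_ne_zero), mul_zero,
      sub_zero, map_one]
    exact isUnit_one
  obtain ⟨J, hJ, hJ0, hJs⟩ := exists_invSum_eq_mul (b := b) (θ := θ) i
  obtain ⟨D, hD, -, hDs⟩ := exists_twistedDenom_eq_mul (b := b) (θ := θ) 1 i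
  obtain ⟨V, hV, hV0, hVs⟩ := exists_twistedDenom_eq_mul (b := b) (θ := θ) X i
  rw [← vinvSeries, ← denomV_eq] at hV
  rw [map_one, one_mul] at hD
  refine Translates.of_mul_left (fun x j hj => simpleReflection_apply_of_ne hj x)
    (simpleReflection_self i) (hVs.mul hJs) ?_ ?_
  · rw [MvPowerSeries.coeff_zero_eq_constantCoeff_apply, map_mul, hV0, hJ0, mul_one]
  · have hcancel : V * J * c = g * (invSum b θ * pathLimit b θ) * D := by
      rw [hV, hD] at hc
      rw [hJ]
      linear_combination g * J * hc - c * V * J * hg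
    rw [hcancel]
    exact (translates_mul_invSum_mul_pathLimit hg).mul hDs

variable (b θ) in
lemma exists_correction : ∃ c : Qfin (Idx b), IsImagSeries b θ c ∧
    (∀ (w : weyl b θ) (x : Lattice b), coeffExp c (w.1 x) = coeffExp c x) ∧
    ∀ u : weyl b θ, HasFormalSum (fun w => coeffC b θ u w)
      (toQv (c * denomV b θ * invDenom b θ u)) := by
  obtain ⟨V, hV⟩ : ∃ V, denomV b θ * V = 1 := by
    refine (MvPowerSeries.isUnit_iff_constantCoeff.mpr ?_).exists_right_inv
    rw [denomV_eq, constantCoeff_twistedDenom]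
    exact isUnit_one
  have hc : pathLimit b θ * twistedDenom b θ 1 * V * denomV b θ =
      pathLimit b θ * twistedDenom b θ 1 := by
    linear_combination pathLimit b θ * twistedDenom b θ 1 * hV
  have hinvariant := coeffExp_weyl_apply (translates_of_mul_denomV_eq hc)
  refine ⟨_, isImagSeries_of_invariant hinvariant, hinvariant, fun u => ?_⟩
  have hcoeff : pathLimit b θ * twistedDenom b θ 1 * V * denomV b θ * invDenom b θ u =
      invWt u * pathLimit b θ := by
    rw [hc, invDenom_eq]
    linear_combination pathLimit b θ * invWt u * twistedDenom_one_mul_denomInv (b := b) (θ := θ)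
  rw [hcoeff]
  exact hasFormalSum_of_hasSum (hasSum_coeffC u)

end Topology

end AffineCS

end

theorem proposition5p7 {ι k M N : Type*} [Finite ι] [Field k] [CharZero k]
    [AddCommGroup M] [Module k M] [AddCommGroup N] [Module k N]
    -- a simply-laced irreducible finite root system, a base, and its highest root
    (P : RootPairing ι k M N) [P.IsRootSystem] [P.IsCrystallographic] [P.IsReduced]
    [P.IsIrreducible] (b : P.Base) (hsl : b.cartanMatrix.IsSimplyLaced)
    (θ : ι) (hθ : AffineCS.IsHighestRoot b θ) :
    -- `T_w` does not depend on the reduced word, and lies in `ℂ[v⁻¹][[Q^∨_-]][W]`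
    (∀ (w : AffineCS.weyl b θ) (l : List (AffineCS.Idx b)), AffineCS.IsReducedWord b θ l w →
      AffineCS.wordT b θ l = AffineCS.elemT b θ w) ∧
    (∀ u w : AffineCS.weyl b θ,
      AffineCS.Expands ((AffineCS.elemT b θ w).coeff u) (AffineCS.coeffC b θ u w)) ∧
    -- the products defining `D_v` and the translates of `1 / D` make sense
    AffineCS.HasFormalProd (AffineCS.denomFactor b θ) (AffineCS.denomV b θ) ∧
    (∀ (w : AffineCS.weyl b θ) (n : AffineCS.PosCoroot b θ),
      AffineCS.Expands (AffineCS.invFactorRat b θ w n)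
        (AffineCS.expansion (AffineCS.invFactorRat b θ w n))) ∧
    (∀ w : AffineCS.weyl b θ,
      AffineCS.HasFormalProd (AffineCS.invFactor b θ w) (AffineCS.invDenom b θ w)) ∧
    -- `P = ∑_w T_w` is well defined and equal to `c(v) D_v ∑_w [w] (1 / D)`
    ∃ c : AffineCS.Qfin (AffineCS.Idx b),
      AffineCS.IsImagSeries b θ c ∧
      (∀ (w : AffineCS.weyl b θ) (x : AffineCS.Lattice b),
        AffineCS.coeffExp c (w.1 x) = AffineCS.coeffExp c x) ∧
      ∀ u : AffineCS.weyl b θ,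
        AffineCS.HasFormalSum (fun w => AffineCS.coeffC b θ u w)
          (AffineCS.toQv (c * AffineCS.denomV b θ * AffineCS.invDenom b θ u)) := by
  have : AffineCS.SimplyLacedAffine b θ := ⟨hsl, hθ⟩
  exact ⟨fun w l hl => AffineCS.wordT_eq_elemT hl,
    fun u w => (AffineCS.expands_elemT_coeff w u).expansion,
    AffineCS.hasFormalProd_denomV,
    fun w n => (AffineCS.expands_invFactorRat w n).expansion,
    AffineCS.hasFormalProd_invDenom,
    AffineCS.exists_correction b θ⟩
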